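/- **Setting.** Let $(\Omega,\mathcal F,\mathbb P)$ be a probability space with a group of measure-preserving maps $\tau_x:\Omega\to\Omega$, $x\in\mathbb R$ ($\tau_0=\mathrm{id}$, $\tau_{x+y}=\tau_x\circ\tau_y$), under which $\mathbb P$ is ergodic, i.e. $\mathbb P(\bigcap_{x\in\mathbb R}\tau_xA)\in\{0,1\}$ for every $A\in\mathcal F$ for which this intersection is an event. Let $V:\mathbb R\times\Omega\to\mathbb R$ be measurable with $V(x,\omega)=V(0,\tau_x\omega)$, with $V(\cdot,\omega)$ bounded and uniformly continuous for every $\omega$, and with $\inf_xV(x,\omega)=0$, $\sup_xV(x,\omega)=1$ for $\mathbb P$-a.e. $\omega$. Let $G:\mathbb R\to[0,\infty)$ be continuous with $G(p)\to+\infty$ as $p\to\pm\infty$, and let $p_m<p_M<0$ and $m,M\in\mathbb R$ be such that $G(0)=0\le G(p_m)=m<G(p_M)=M$, $G$ is strictly decreasing on $(-\infty,p_m]$ and on $[p_M,0]$, and strictly increasing on $[p_m,p_M]$ and on $[0,\infty)$. Let $\beta>0$. A function $\overline H:\mathbb R\to\mathbb R$ is called an *effective Hamiltonian* if it is continuous,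 $\overline H(\theta)\to+\infty$ as $\theta\to\pm\infty$, and, for $\mathbb P$-a.e. $\omega$ and every uniformly continuous $g:\mathbb R\to\mathbb R$, the viscosity solutions $u^\epsilon$ ($\epsilon>0$) and $\overline u$ of $$\partial_tu^\epsilon+G(\partial_xu^\epsilon)+\beta V(x/\epsilon,\omega)=0,\qquad \partial_t\overline u+\overline H(\partial_x\overline u)=0\qquad\text{on }(0,\infty)\times\mathbb R$$ with $u^\epsilon(0,\cdot)=\overline u(0,\cdot)=g$ exist and are unique in the class of uniformly continuous functions on $[0,\infty)\times\mathbb R$, and $u^\epsilon\to\overline u$ locally uniformly on $[0,\infty)\times\mathbb R$ as $\epsilon\to0^+$. A function $H:\mathbb R\to\mathbb R$ *has a flat piece at height $\lambda$* if there are $a<b$ with $H=\lambda$ on $[a,b]$. For $\lambda\in(\max\{\beta,M\},m+\beta)$ let $f=\lambda-\beta V(\cdot,\omega)$, and let the real sequences $(\underline x_i),(\overline y_i),(\overline x_i),(\underline y_i)$, $i\in\mathbb Z$, be given by $$\underline x_i=\inf\{x\ge\overline y_{i-1}:f(x)\ge M\},\quad \overline y_i=\inf\{x\ge\underline x_i:f(x)<m\},\quad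 \underline x_{-1}\le0<\underline x_0,$$ $$\overline x_i=\inf\{x\ge\underline y_{i-1}:f(x)>M\},\quad \underline y_i=\inf\{x\ge\overline x_i:f(x)\le m\},\quad \overline x_{-1}<0\le\overline x_0,$$ all infima being over nonempty sets (such sequences exist and are unique for $\mathbb P$-a.e. $\omega$). Let $U_\lambda$ be the event that $(\underline x_i),(\overline y_i)$ exist and $f$ has no local maximum at $\underline x_0$, and let $D_\lambda$ be the event that $(\overline x_i),(\underline y_i)$ exist and $f$ has no local minimum at $\underline y_0$. **Theorem.** Assume $\max\{\beta,M\}<m+\beta$. Then there is exactly one effective Hamiltonian $\overline H$, and for every $\lambda\in(\max\{\beta,M\},m+\beta)$, the graph of $\overline H$ has a flat piece at height $\lambda$ if and only if $\mathbb P(U_\lambda\cap D_\lambda)<1$. -/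

import Mathlib

open MeasureTheory Filter Topology Set

/-- A group `(τ x)`, `x ∈ ℝ`, of measure-preserving transformations of `(Ω, μ)` under which `μ` is
ergodic: `⋂ x, τ x A` has measure `0` or `1` for every event `A`, whenever this (uncountable)
intersection is itself an event.  Equivalently, every event invariant under all `τ x` is trivial. -/
structure IsErgodicFlow {Ω : Type*} [MeasurableSpace Ω] (μ : Measure Ω) (τ : ℝ → Ω → Ω) : Prop where
  measurePreserving : ∀ x, MeasurePreserving (τ x) μ μ
  zero : τ 0 = id
  add : ∀ x y, τ (x + y) = τ x ∘ τ y
  ergodic : ∀ A : Set Ω, MeasurableSet A → MeasurableSet (⋂ x, τ x '' A) →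
    μ (⋂ x, τ x '' A) = 0 ∨ μ (⋂ x, τ x '' A) = 1

/-- A measurable stationary potential with bounded uniformly continuous realizations, normalized
so that almost surely its infimum is `0` and its supremum is `1`. -/
structure IsStationaryPotential {Ω : Type*} [MeasurableSpace Ω] (μ : Measure Ω) (τ : ℝ → Ω → Ω)
    (V : ℝ → Ω → ℝ) : Prop where
  measurable : Measurable (Function.uncurry V)
  stationary : ∀ x ω, V x ω = V 0 (τ x ω)
  bounded : ∀ ω, ∃ C, ∀ x, |V x ω| ≤ C
  uniformContinuous : ∀ ω, UniformContinuous fun x => V x ω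
  normalized : ∀ᵐ ω ∂μ, IsGLB (range fun x => V x ω) 0 ∧ IsLUB (range fun x => V x ω) 1

/-- `F` is continuous and `F p → +∞` as `p → ±∞`. -/
structure IsContinuousCoercive (F : ℝ → ℝ) : Prop where
  continuous : Continuous F
  tendsto_atTop : Tendsto F atTop atTop
  tendsto_atBot : Tendsto F atBot atTop

/-- Double-well shape of `G : ℝ → [0, ∞)`: a local minimum at `pm` with value `m`, a local maximum
at `pM` with value `M`, and an absolute minimum at `0` with value `0`. -/
structure IsDoubleWell (G : ℝ → ℝ) (m M pm pM : ℝ) : Prop where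
  nonneg : ∀ p, 0 ≤ G p
  pm_lt_pM : pm < pM
  pM_neg : pM < 0
  map_zero : G 0 = 0
  map_pm : G pm = m
  map_pM : G pM = M
  m_nonneg : 0 ≤ m
  m_lt_M : m < M
  anti₁ : StrictAntiOn G (Iic pm)
  mono₂ : StrictMonoOn G (Icc pm pM)
  anti₃ : StrictAntiOn G (Icc pM 0)
  mono₄ : StrictMonoOn G (Ici 0)

/-- `u` is a viscosity solution in `UC([0,∞) × ℝ)` of the Cauchy problem
`∂ₜu + F(∂ₓu, x) = 0` on `(0,∞) × ℝ`, `u(0,·) = g`.  Points are pairs `(t, x)`; the values of `u`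
at negative times are irrelevant. -/
structure IsViscositySolution (F : ℝ → ℝ → ℝ) (g : ℝ → ℝ) (u : ℝ × ℝ → ℝ) : Prop where
  uniformContinuousOn : UniformContinuousOn u (Ici 0 ×ˢ univ)
  initial : ∀ x, u (0, x) = g x
  subsolution : ∀ φ : ℝ × ℝ → ℝ, ContDiff ℝ 1 φ → ∀ t x : ℝ, 0 < t →
    IsLocalMax (fun z => u z - φ z) (t, x) →
    fderiv ℝ φ (t, x) (1, 0) + F (fderiv ℝ φ (t, x) (0, 1)) x ≤ 0
  supersolution : ∀ φ : ℝ × ℝ → ℝ, ContDiff ℝ 1 φ → ∀ t x : ℝ, 0 < t →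
    IsLocalMin (fun z => u z - φ z) (t, x) →
    0 ≤ fderiv ℝ φ (t, x) (1, 0) + F (fderiv ℝ φ (t, x) (0, 1)) x

/-- `u` is the viscosity solution of the Cauchy problem, unique on `[0,∞) × ℝ`. -/
def IsUniqueViscositySolution (F : ℝ → ℝ → ℝ) (g : ℝ → ℝ) (u : ℝ × ℝ → ℝ) : Prop :=
  IsViscositySolution F g u ∧
    ∀ v, IsViscositySolution F g v → EqOn v u (Ici 0 ×ˢ univ)

/-- `∂ₜu + G(∂ₓu) + β V(x/ε, ω) = 0` homogenizes to `∂ₜu + Hbar(∂ₓu) = 0`: almost surely, for every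
uniformly continuous initial condition `g`, the unique solutions of the former equations converge
locally uniformly on `[0,∞) × ℝ`, as `ε → 0+`, to the unique solution of the latter. -/
structure IsEffectiveHamiltonian {Ω : Type*} [MeasurableSpace Ω] (μ : Measure Ω) (G : ℝ → ℝ)
    (β : ℝ) (V : ℝ → Ω → ℝ) (Hbar : ℝ → ℝ) : Prop where
  continuousCoercive : IsContinuousCoercive Hbar
  homogenization : ∀ᵐ ω ∂μ, ∀ g : ℝ → ℝ, UniformContinuous g →
    ∃ (u : ℝ → ℝ × ℝ → ℝ) (ubar : ℝ × ℝ → ℝ),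
      (∀ ε, 0 < ε → IsUniqueViscositySolution (fun p x => G p + β * V (x / ε) ω) g (u ε)) ∧
      IsUniqueViscositySolution (fun p _ => Hbar p) g ubar ∧
      TendstoLocallyUniformlyOn u ubar (𝓝[>] 0) (Ici 0 ×ˢ univ)

/-- The graph of `H` has a flat piece at height `h`. -/
def HasFlatPiece (H : ℝ → ℝ) (h : ℝ) : Prop :=
  ∃ a b, a < b ∧ ∀ θ ∈ Icc a b, H θ = h

/-- The anchored sequences `(x̲ᵢ)` and `(y̅ᵢ)` of a path `f`:
`x̲ᵢ = inf {s ≥ y̅ᵢ₋₁ : f s ≥ M}`, `y̅ᵢ = inf {s ≥ x̲ᵢ : f s < m}`, `x̲₋₁ ≤ 0 < x̲₀`.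
(`IsGLB` makes every infimum a finite one, over a nonempty set.) -/
structure IsLowerUpcrossing (m M : ℝ) (f : ℝ → ℝ) (x y : ℤ → ℝ) : Prop where
  up : ∀ i, IsGLB {s | y (i - 1) ≤ s ∧ M ≤ f s} (x i)
  down : ∀ i, IsGLB {s | x i ≤ s ∧ f s < m} (y i)
  anchor : x (-1) ≤ 0 ∧ 0 < x 0

/-- The anchored sequences `(x̅ᵢ)` and `(y̲ᵢ)` of a path `f`:
`x̅ᵢ = inf {s ≥ y̲ᵢ₋₁ : f s > M}`, `y̲ᵢ = inf {s ≥ x̅ᵢ : f s ≤ m}`, `x̅₋₁ < 0 ≤ x̅₀`. -/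
structure IsUpperUpcrossing (m M : ℝ) (f : ℝ → ℝ) (x y : ℤ → ℝ) : Prop where
  up : ∀ i, IsGLB {s | y (i - 1) ≤ s ∧ M < f s} (x i)
  down : ∀ i, IsGLB {s | x i ≤ s ∧ f s ≤ m} (y i)
  anchor : x (-1) < 0 ∧ 0 ≤ x 0

/-- The event that `h - β V(·, ω)` has no local maximum at `x̲₀(h, ω)`. -/
def upcrossingEvent {Ω : Type*} (m M β : ℝ) (V : ℝ → Ω → ℝ) (h : ℝ) : Set Ω :=
  {ω | ∃ x y : ℤ → ℝ, IsLowerUpcrossing m M (fun s => h - β * V s ω) x y ∧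
    ¬ IsLocalMax (fun s => h - β * V s ω) (x 0)}

/-- The event that `h - β V(·, ω)` has no local minimum at `y̲₀(h, ω)`. -/
def downcrossingEvent {Ω : Type*} (m M β : ℝ) (V : ℝ → Ω → ℝ) (h : ℝ) : Set Ω :=
  {ω | ∃ x y : ℤ → ℝ, IsUpperUpcrossing m M (fun s => h - β * V s ω) x y ∧
    ¬ IsLocalMin (fun s => h - β * V s ω) (y 0)}

/-! Correctors are solutions F of G(F') + βV = λ with an asymptotic slope. Put f = λ - βV, which is
nonnegative for λ ≥ β. One corrector takes its gradient on the increasing branch, F' = p₄(f). The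
other has F' ≤ 0 and must choose between the decreasing branches p₁, available while f ≥ m, and p₃,
available while f ≤ M. Read from left to right, a jump from p₃ down to p₁ is a concave kink,
admissible only at f = M; a jump from p₁ up to p₃ is a convex kink, admissible only at f = m. This
leads to the hysteresis rule `negSelection`: use p₁ from the moment f exceeds M until it returns to
m, and p₃ otherwise. By Birkhoff's theorem (`IsStationaryField.ae_hasSlope`) the two correctors have
deterministic slopes θL(λ) and θR(λ), the first strictly decreasing and the second strictly
increasing in λ. The candidate `effHam` at θ is the smallest level whose slopes enclose θ.

Homogenization. At level c = H(θ), two correctors of levels near c and with slopes on either side of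
θ are glued at one point. In one order this gives an approximate supercorrector above the line of
slope θ, in the other order an approximate subcorrector below it. The gluing point must be one where
the gradients between the two correctors keep G + βV near c; since V comes close to 0 and to 1 at
every macroscopic place, and since m > 0 and M < m + β, such points are always available
(`IsGoodPath.hasCorrectors`). The perturbed test function method (`IsUpperLimit.isSubsol`),
comparison (`IsSubsol.le_of_initial_le`) and Perron's method (`isSupersol_perronSup`) then give
well-posedness and convergence (`homogenization_of_correctors`). Linear initial data show that the
effective Hamiltonian is unique.

Flat pieces. For h > β, θR is continuous and θL is left-continuous at h, so H is flat at height h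
exactly when θL drops to the right of h (`IsSlopePair.hasFlatPiece_iff`). As λ decreases to h, the
selection tends to p₃ in the low phase (below m at some earlier time and below M ever since) and to
p₁ elsewhere. It therefore differs from the selection at h exactly on the points in neither phase,
the neutral set. Hence a flat piece means that 0 is neutral with positive probability or, by Fubini
and stationarity, that the neutral set is not almost surely Lebesgue null.

Neutral set and events. A local maximum at an upcrossing would make an interval to its right neutral
(`IsCrossing.not_isLocalMax`), and symmetrically for minima; so a null neutral set puts almost every
path in both events. Conversely, if the neutral set is not countable, the path shows a local maximum
at height M or a local minimum at height m that is recognized by finitely many rationals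
(`countable_neutralSet`). One such rational pattern then has positive probability, and shifting its
starting point to 0 makes one of the two events fail with positive probability. -/

/-! ### Viscosity sub- and supersolutions -/

/-- Viscosity subsolutions of `∂ₜu + G(∂ₓu) + W(x) = 0` on `(0,∞) × ℝ`. -/
def IsSubsol (G W : ℝ → ℝ) (u : ℝ × ℝ → ℝ) : Prop :=
  ∀ φ : ℝ × ℝ → ℝ, ContDiff ℝ 1 φ → ∀ t x : ℝ, 0 < t →
    IsLocalMax (fun z => u z - φ z) (t, x) →
    fderiv ℝ φ (t, x) (1, 0) + (G (fderiv ℝ φ (t, x) (0, 1)) + W x) ≤ 0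

/-- Viscosity supersolutions of `∂ₜu + G(∂ₓu) + W(x) = 0` on `(0,∞) × ℝ`. -/
def IsSupersol (G W : ℝ → ℝ) (u : ℝ × ℝ → ℝ) : Prop :=
  ∀ φ : ℝ × ℝ → ℝ, ContDiff ℝ 1 φ → ∀ t x : ℝ, 0 < t →
    IsLocalMin (fun z => u z - φ z) (t, x) →
    0 ≤ fderiv ℝ φ (t, x) (1, 0) + (G (fderiv ℝ φ (t, x) (0, 1)) + W x)

/-- The reflection u ↦ -u replaces G by p ↦ -G(-p), which is no longer coercive. So only results
that need no coercivity, such as stability and the perturbed test function argument, are transferred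
in this way. -/
theorem isSubsol_neg_iff {G W : ℝ → ℝ} {u : ℝ × ℝ → ℝ} :
    IsSubsol (fun p => -G (-p)) (fun x => -W x) (fun z => -u z) ↔ IsSupersol G W u := by
  constructor
  · intro h φ hφ t x ht hm
    have := h (fun z => -φ z) hφ.neg t x ht (by
      have := hm.neg
      refine this.congr (Eventually.of_forall fun z => ?_)
      simp; ring)
    have e : fderiv ℝ (fun z => -φ z) (t, x) = -fderiv ℝ φ (t, x) := fderiv_fun_neg
    rw [e] at this
    simp at this
    linarith
  · intro h φ hφ t x ht hm
    have := h (fun z => -φ z) hφ.neg t x ht (by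
      have := hm.neg
      refine this.congr (Eventually.of_forall fun z => ?_)
      simp; ring)
    have e : fderiv ℝ (fun z => -φ z) (t, x) = -fderiv ℝ φ (t, x) := fderiv_fun_neg
    rw [e] at this
    simp at this
    simp only
    linarith

theorem fderiv_separable {α β : ℝ → ℝ} {a b t x : ℝ} (ha : HasDerivAt α a t)
    (hb : HasDerivAt β b x) :
    fderiv ℝ (fun z : ℝ × ℝ => α z.1 + β z.2) (t, x) (1, 0) = a ∧
    fderiv ℝ (fun z : ℝ × ℝ => α z.1 + β z.2) (t, x) (0, 1) = b := by
  have h1 : HasFDerivAt (fun z : ℝ × ℝ => α z.1) _ (t, x) :=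
    ha.hasFDerivAt.comp (t, x) (hasFDerivAt_fst (p := (t, x)))
  have h2 : HasFDerivAt (fun z : ℝ × ℝ => β z.2) _ (t, x) :=
    hb.hasFDerivAt.comp (t, x) (hasFDerivAt_snd (p := (t, x)))
  have h := (h1.fun_add h2).fderiv
  rw [h]
  simp

theorem IsSubsol.test_separable {G W : ℝ → ℝ} {u : ℝ × ℝ → ℝ} (hu : IsSubsol G W u)
    {α β : ℝ → ℝ} (hα : ContDiff ℝ 1 α) (hβ : ContDiff ℝ 1 β) {a b t x : ℝ} (ht : 0 < t)
    (ha : HasDerivAt α a t) (hb : HasDerivAt β b x)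
    (hm : IsLocalMax (fun z => u z - (α z.1 + β z.2)) (t, x)) : a + (G b + W x) ≤ 0 := by
  have := hu (fun z => α z.1 + β z.2)
    ((hα.comp contDiff_fst).add (hβ.comp contDiff_snd)) t x ht hm
  rwa [(fderiv_separable ha hb).1, (fderiv_separable ha hb).2] at this

theorem IsSupersol.test_separable {G W : ℝ → ℝ} {u : ℝ × ℝ → ℝ} (hu : IsSupersol G W u)
    {α β : ℝ → ℝ} (hα : ContDiff ℝ 1 α) (hβ : ContDiff ℝ 1 β) {a b t x : ℝ} (ht : 0 < t)
    (ha : HasDerivAt α a t) (hb : HasDerivAt β b x)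
    (hm : IsLocalMin (fun z => u z - (α z.1 + β z.2)) (t, x)) : 0 ≤ a + (G b + W x) := by
  have := hu (fun z => α z.1 + β z.2)
    ((hα.comp contDiff_fst).add (hβ.comp contDiff_snd)) t x ht hm
  rwa [(fderiv_separable ha hb).1, (fderiv_separable ha hb).2] at this

/-! ### Linear growth and the comparison principle -/

/-- Uniformly continuous functions on convex sets grow at most linearly. -/
theorem UniformContinuousOn.exists_linear_growth {E : Type*} [NormedAddCommGroup E]
    [NormedSpace ℝ E] {s : Set E} (hs : Convex ℝ s) {f : E → ℝ} (hf : UniformContinuousOn f s) :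
    ∃ A, 0 < A ∧ ∀ z ∈ s, ∀ w ∈ s, |f z - f w| ≤ A * (1 + dist z w) := by
  obtain ⟨δ, hδ, h⟩ := Metric.uniformContinuousOn_iff.1 hf 1 one_pos
  have key : ∀ n : ℕ, ∀ z ∈ s, ∀ w ∈ s, dist z w ≤ n * (δ / 2) → |f z - f w| ≤ n := by
    intro n
    induction n with
    | zero =>
      intro z _ w _ hd
      have : z = w := by
        have h0 := dist_nonneg (x := z) (y := w)
        exact dist_le_zero.1 (by simpa using hd)
      simp [this]
    | succ n ih =>
      intro z hz w hw hd
      have hn : (0 : ℝ) < n + 1 := by positivity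
      -- Chaining: the point v at the fraction 1/(n+1) of the segment costs one step of length at
      -- most δ/2 and leaves n such steps.
      set c : ℝ := 1 / (n + 1) with hc
      have hc0 : 0 ≤ c := by positivity
      have hc1 : c ≤ 1 := by rw [hc, div_le_one hn]; linarith [(Nat.cast_nonneg n : (0 : ℝ) ≤ n)]
      set v := AffineMap.lineMap z w c with hv
      have hvs : v ∈ s := hs.lineMap_mem hz hw ⟨hc0, hc1⟩
      have d1 : dist z v = c * dist z w := by
        rw [hv, dist_left_lineMap]; simp [abs_of_nonneg hc0]
      have d2 : dist v w = (1 - c) * dist z w := by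
        rw [hv, dist_lineMap_right]; simp [abs_of_nonneg (sub_nonneg.2 hc1)]
      push_cast at hd ⊢
      have e1 : dist z v ≤ δ / 2 := by
        rw [d1, hc, div_mul_eq_mul_div, one_mul, div_le_iff₀ hn]; linarith
      have e2 : dist v w ≤ n * (δ / 2) := by
        have : 1 - c = n / (n + 1) := by rw [hc]; field_simp; ring
        rw [d2, this, div_mul_eq_mul_div, div_le_iff₀ hn]
        nlinarith [(Nat.cast_nonneg n : (0 : ℝ) ≤ n)]
      have f1 := ih v hvs w hw e2
      have f2 := h z hz v hvs (by linarith)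
      rw [Real.dist_eq] at f2
      have := abs_sub_le (f z) (f v) (f w)
      linarith
  refine ⟨2 / δ + 1, by positivity, fun z hz w hw => ?_⟩
  have hd0 := dist_nonneg (x := z) (y := w)
  have h1 := key ⌈dist z w / (δ / 2)⌉₊ z hz w hw (by
    have := Nat.le_ceil (dist z w / (δ / 2))
    rwa [div_le_iff₀ (by positivity)] at this)
  have h2 := (Nat.ceil_lt_add_one (a := dist z w / (δ / 2)) (by positivity)).le
  have h3 : dist z w / (δ / 2) = 2 / δ * dist z w := by field_simp
  have h4 : 0 < 2 / δ := by positivity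
  nlinarith

theorem convex_Ici_prod_univ : Convex ℝ (Ici (0 : ℝ) ×ˢ (univ : Set ℝ)) :=
  (convex_Ici 0).prod convex_univ

theorem abs_le_one_add_of_sq_le {a b : ℝ} (h : a ^ 2 ≤ b) : |a| ≤ 1 + b := by
  rw [← sq_abs] at h
  nlinarith [sq_nonneg (|a| - 1)]

theorem abs_le_of_mul_sq_le {a b k : ℝ} (hk : 0 < k) (h : k * a ^ 2 ≤ b) : |a| ≤ 1 + b / k := by
  apply abs_le_one_add_of_sq_le
  rw [le_div_iff₀ hk]; linarith

theorem eventually_pos_fst {t x : ℝ} (ht : 0 < t) : ∀ᶠ z : ℝ × ℝ in 𝓝 (t, x), 0 < z.1 :=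
  continuous_fst.continuousAt.eventually (lt_mem_nhds ht)

set_option maxHeartbeats 1000000 in
/-- Existence of maximum points in the doubling of variables. -/
theorem exists_isMax_doubling {u v : ℝ × ℝ → ℝ} {A1 A2 γ σ κ T X : ℝ}
    (hu : ContinuousOn u (Ici 0 ×ˢ univ)) (hv : ContinuousOn v (Ici 0 ×ˢ univ))
    (h0 : ∀ x, u (0, x) ≤ v (0, x)) (hA1 : 0 < A1) (hA2 : 0 < A2)
    (hgu : ∀ z ∈ Ici (0 : ℝ) ×ˢ (univ : Set ℝ), ∀ w ∈ Ici (0 : ℝ) ×ˢ (univ : Set ℝ),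
      |u z - u w| ≤ A1 * (1 + dist z w))
    (hgv : ∀ z ∈ Ici (0 : ℝ) ×ˢ (univ : Set ℝ), ∀ w ∈ Ici (0 : ℝ) ×ˢ (univ : Set ℝ),
      |v z - v w| ≤ A2 * (1 + dist z w))
    (hγ : 0 < γ) (hσ : 0 < σ) (hσ1 : σ ≤ 1) (hκ : 0 < κ) (hT : 0 ≤ T)
    {Φ : (ℝ × ℝ) × (ℝ × ℝ) → ℝ}
    (hΦ : ∀ z, Φ z = u z.1 - v z.2 -
    ((z.1.2 - z.2.2) ^ 2 + (z.1.1 - z.2.1) ^ 2) / σ - γ * z.1.1 ^ 2 - κ * z.1.2 ^ 2)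
    (hP0 : 0 ≤ Φ ((T, X), (T, X))) :
    ∃ t1 x1 s1 y1, 0 ≤ t1 ∧ 0 ≤ s1 ∧
      (∀ t x s y, 0 ≤ t → 0 ≤ s → Φ ((t, x), (s, y)) ≤ Φ ((t1, x1), (s1, y1))) ∧
      (x1 - y1) ^ 2 + (t1 - s1) ^ 2 ≤
        2 * σ * (3 * (A1 + A2) + (A1 + A2) ^ 2 + 2 * (A1 + A2) ^ 2 / γ) ∧
      κ * x1 ^ 2 ≤ 3 * (A1 + A2) + (A1 + A2) ^ 2 + 2 * (A1 + A2) ^ 2 / γ := by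
  obtain ⟨A, hA⟩ : ∃ A, A = A1 + A2 := ⟨_, rfl⟩
  rw [← hA]
  have hApos : 0 < A := by rw [hA]; positivity
  obtain ⟨C0, hC0⟩ : ∃ C0, C0 = 3 * A + A ^ 2 + 2 * A ^ 2 / γ := ⟨_, rfl⟩
  rw [← hC0]
  have hC0pos : 0 < C0 := by rw [hC0]; positivity
  -- Half of the σ-penalty absorbs the growth in d and half of the γ-penalty the growth in t. The
  -- constant C0 depends neither on σ nor on κ, which can therefore be chosen after it.
  have hbound : ∀ t x s y, 0 ≤ t → 0 ≤ s → Φ ((t, x), (s, y)) ≤ C0 -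
      ((x - y) ^ 2 + (t - s) ^ 2) / (2 * σ) - γ * t ^ 2 / 2 - κ * x ^ 2 := by
    intro t x s y ht hs
    have k1 := hgu (t, x) ⟨ht, trivial⟩ (0, x) ⟨self_mem_Ici, trivial⟩
    have k2 := hgv (0, x) ⟨self_mem_Ici, trivial⟩ (t, x) ⟨ht, trivial⟩
    have k3 := hgv (t, x) ⟨ht, trivial⟩ (s, y) ⟨hs, trivial⟩
    have e1 : dist ((t, x) : ℝ × ℝ) (0, x) = t := by
      simp [Prod.dist_eq, ht]
    have e2 : dist ((0, x) : ℝ × ℝ) (t, x) = t := by rw [dist_comm, e1]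
    rw [e1] at k1; rw [e2] at k2
    set d := dist ((t, x) : ℝ × ℝ) (s, y) with hd
    have hdd : d ^ 2 ≤ (x - y) ^ 2 + (t - s) ^ 2 := by
      rw [hd, Prod.dist_eq, Real.dist_eq, Real.dist_eq]
      rcases max_choice |t - s| |x - y| with h | h <;> simp only [h, sq_abs] <;> linarith [sq_nonneg (t - s), sq_nonneg (x - y)]
    have hAd : A * d ≤ d ^ 2 / (2 * σ) + A ^ 2 * σ / 2 := by
      have : d ^ 2 / (2 * σ) + A ^ 2 * σ / 2 - A * d = (d - A * σ) ^ 2 / (2 * σ) := by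
        field_simp; ring
      have : 0 ≤ (d - A * σ) ^ 2 / (2 * σ) := by positivity
      linarith
    have hAs : A ^ 2 * σ / 2 ≤ A ^ 2 := by nlinarith [sq_nonneg A]
    have hAt : 2 * A * t ≤ γ * t ^ 2 / 2 + 2 * A ^ 2 / γ := by
      have : γ * t ^ 2 / 2 + 2 * A ^ 2 / γ - 2 * A * t = (γ * t - 2 * A) ^ 2 / (2 * γ) := by
        field_simp; ring
      have : 0 ≤ (γ * t - 2 * A) ^ 2 / (2 * γ) := by positivity
      linarith
    have hdσ : d ^ 2 / (2 * σ) ≤ ((x - y) ^ 2 + (t - s) ^ 2) / (2 * σ) := by gcongr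
    have hsplit : ((x - y) ^ 2 + (t - s) ^ 2) / σ =
      ((x - y) ^ 2 + (t - s) ^ 2) / (2 * σ) + ((x - y) ^ 2 + (t - s) ^ 2) / (2 * σ) := by
      field_simp; ring
    have hd0' : 0 ≤ d := dist_nonneg
    have b1 := (abs_le.1 k1).2
    have b2 := (abs_le.1 k2).2
    have b3 := (abs_le.1 k3).2
    have b0 := h0 x
    simp only [hΦ]
    rw [hsplit]
    have : A1 * (1 + t) ≤ A * (1 + t) := by gcongr; linarith
    have : A2 * (1 + d) ≤ A * (1 + d) := by gcongr; linarith
    have hA1t : A1 * (1 + t) + A2 * (1 + t) = A * (1 + t) := by rw [hA]; ring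
    have : 0 ≤ A * t := by positivity
    linarith
  obtain ⟨R, hR⟩ : ∃ R, R = 2 + 2 * C0 / γ + C0 / κ + 2 * σ * C0 := ⟨_, rfl⟩
  have hRpos : 0 < R := by rw [hR]; positivity
  set K : Set ((ℝ × ℝ) × (ℝ × ℝ)) := (Icc 0 (2 * R) ×ˢ Icc (-(2 * R)) (2 * R)) ×ˢ
    (Icc 0 (2 * R) ×ˢ Icc (-(2 * R)) (2 * R)) with hK
  have hKc : IsCompact K :=
    (isCompact_Icc.prod isCompact_Icc).prod (isCompact_Icc.prod isCompact_Icc)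
  have hin : ∀ t x s y, 0 ≤ t → 0 ≤ s → 0 ≤ Φ ((t, x), (s, y)) →
      (((x - y) ^ 2 + (t - s) ^ 2 ≤ 2 * σ * C0 ∧ κ * x ^ 2 ≤ C0) ∧ ((t, x), (s, y)) ∈ K) := by
    intro t x s y ht hs hp
    have hb := hbound t x s y ht hs
    have hq1 : 0 ≤ ((x - y) ^ 2 + (t - s) ^ 2) / (2 * σ) := by positivity
    have hq2 : 0 ≤ γ * t ^ 2 := by positivity
    have hq3 : 0 ≤ κ * x ^ 2 := by positivity
    have c1 : (x - y) ^ 2 + (t - s) ^ 2 ≤ 2 * σ * C0 := by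
      have : ((x - y) ^ 2 + (t - s) ^ 2) / (2 * σ) ≤ C0 := by linarith
      rw [div_le_iff₀ (by positivity)] at this; linarith
    have c2 : κ * x ^ 2 ≤ C0 := by linarith
    have c3 : γ * t ^ 2 ≤ 2 * C0 := by linarith
    have a1 := abs_le_of_mul_sq_le hκ c2
    have a2 := abs_le_of_mul_sq_le hγ c3
    have a3 : |x - y| ≤ 1 + 2 * σ * C0 :=
      abs_le_one_add_of_sq_le (by linarith [sq_nonneg (t - s)])
    have a4 : |t - s| ≤ 1 + 2 * σ * C0 :=
      abs_le_one_add_of_sq_le (by linarith [sq_nonneg (x - y)])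
    have p1 : 0 < 2 * C0 / γ := by positivity
    have p2 : 0 < C0 / κ := by positivity
    have p3 : 0 < 2 * σ * C0 := by positivity
    rw [abs_le] at a1 a2 a3 a4
    refine ⟨⟨c1, c2⟩, ⟨⟨ht, ?_⟩, ?_, ?_⟩, ⟨hs, ?_⟩, ?_, ?_⟩ <;> simp only [hR] <;> linarith
  have hcont : ContinuousOn Φ K := by
    have h1 : ContinuousOn (fun z : (ℝ × ℝ) × (ℝ × ℝ) => u z.1) K :=
      hu.comp continuous_fst.continuousOn (fun z hz => ⟨hz.1.1.1, trivial⟩)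
    have h2 : ContinuousOn (fun z : (ℝ × ℝ) × (ℝ × ℝ) => v z.2) K :=
      hv.comp continuous_snd.continuousOn (fun z hz => ⟨hz.2.1.1, trivial⟩)
    have h3 : Continuous (fun z : (ℝ × ℝ) × (ℝ × ℝ) =>
      ((z.1.2 - z.2.2) ^ 2 + (z.1.1 - z.2.1) ^ 2) / σ + γ * z.1.1 ^ 2 + κ * z.1.2 ^ 2) := by
      fun_prop
    have := (h1.sub h2).sub h3.continuousOn
    refine this.congr (fun z _ => ?_)
    simp only [hΦ, Pi.sub_apply]; ring
  obtain ⟨⟨⟨t1, x1⟩, ⟨s1, y1⟩⟩, hz1, hmax⟩ := hKc.exists_isMaxOn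
    ⟨_, (hin T X T X hT hT hP0).2⟩ hcont
  have hmax0 : 0 ≤ Φ ((t1, x1), (s1, y1)) :=
    hP0.trans (isMaxOn_iff.1 hmax _ (hin T X T X hT hT hP0).2)
  have hglob : ∀ t x s y, 0 ≤ t → 0 ≤ s → Φ ((t, x), (s, y)) ≤ Φ ((t1, x1), (s1, y1)) := by
    intro t x s y ht hs
    by_cases hp : 0 ≤ Φ ((t, x), (s, y))
    · exact isMaxOn_iff.1 hmax _ (hin t x s y ht hs hp).2
    · linarith
  have ht1 : 0 ≤ t1 := hz1.1.1.1
  have hs1 : 0 ≤ s1 := hz1.2.1.1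
  obtain ⟨⟨hD, hκx⟩, -⟩ := hin t1 x1 s1 y1 ht1 hs1 hmax0
  exact ⟨t1, x1, s1, y1, ht1, hs1, hglob, hD, hκx⟩

set_option maxHeartbeats 1000000 in
/-- Comparison principle for uniformly continuous sub- and supersolutions. -/
theorem IsSubsol.le_of_initial_le {G W : ℝ → ℝ} (hG : Continuous G) (hW : UniformContinuous W)
    {u v : ℝ × ℝ → ℝ} (hu : UniformContinuousOn u (Ici 0 ×ˢ univ))
    (hv : UniformContinuousOn v (Ici 0 ×ˢ univ)) (hsub : IsSubsol G W u)
    (hsup : IsSupersol G W v) (h0 : ∀ x, u (0, x) ≤ v (0, x)) :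
    ∀ t x, 0 ≤ t → u (t, x) ≤ v (t, x) := by
  intro T X hT
  by_contra hcon
  push Not at hcon
  obtain ⟨α, hα, hα4⟩ : ∃ α, 0 < α ∧ u (T, X) - v (T, X) = 4 * α :=
    ⟨(u (T, X) - v (T, X)) / 4, by linarith, by ring⟩
  obtain ⟨A1, hA1, hgu⟩ := hu.exists_linear_growth convex_Ici_prod_univ
  obtain ⟨A2, hA2, hgv⟩ := hv.exists_linear_growth convex_Ici_prod_univ
  obtain ⟨A, hA⟩ : ∃ A, A = A1 + A2 := ⟨_, rfl⟩
  have hApos : 0 < A := by rw [hA]; positivity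
  obtain ⟨ρ1, hρ1, hu1⟩ := Metric.uniformContinuousOn_iff.1 hu (α / 2) (by positivity)
  obtain ⟨ρ2, hρ2, hv1⟩ := Metric.uniformContinuousOn_iff.1 hv (α / 2) (by positivity)
  obtain ⟨ρ, hρ, hρa, hρb⟩ : ∃ ρ, 0 < ρ ∧ ρ < ρ1 ∧ ρ < ρ2 :=
    ⟨min ρ1 ρ2 / 2, by positivity, by
      have := min_le_left ρ1 ρ2; have : 0 < min ρ1 ρ2 := by positivity
      linarith, by
      have := min_le_right ρ1 ρ2; have : 0 < min ρ1 ρ2 := by positivity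
      linarith⟩
  -- The term γt² confines the maximum point in time, and its derivative 2γt supplies the strict
  -- inequality once t ≥ ρ is known.
  obtain ⟨γ, hγ, hγT⟩ : ∃ γ, 0 < γ ∧ γ * T ^ 2 ≤ α :=
    ⟨α / (1 + T ^ 2), by positivity, by
      rw [div_mul_eq_mul_div, div_le_iff₀ (by positivity)]; nlinarith [sq_nonneg T]⟩
  obtain ⟨C0, hC0⟩ : ∃ C0, C0 = 3 * A + A ^ 2 + 2 * A ^ 2 / γ := ⟨_, rfl⟩
  have hC0pos : 0 < C0 := by rw [hC0]; positivity
  obtain ⟨d0, hd0, hW1⟩ := Metric.uniformContinuous_iff.1 hW (γ * ρ / 2) (by positivity)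
  -- choice of `σ`
  obtain ⟨σ, hσ, hσ1, hσd, hσρ⟩ : ∃ σ, 0 < σ ∧ σ ≤ 1 ∧ 2 * σ * C0 < d0 ^ 2 ∧
      2 * σ * C0 < (ρ / 2) ^ 2 := by
    refine ⟨min 1 (min (d0 ^ 2) ((ρ / 2) ^ 2) / (4 * C0)), by positivity, min_le_left _ _, ?_, ?_⟩
    · have h1 := min_le_right 1 (min (d0 ^ 2) ((ρ / 2) ^ 2) / (4 * C0))
      have h2 := min_le_left (d0 ^ 2) ((ρ / 2) ^ 2)
      rw [le_div_iff₀ (by positivity)] at h1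
      have : 0 < d0 ^ 2 := by positivity
      nlinarith
    · have h1 := min_le_right 1 (min (d0 ^ 2) ((ρ / 2) ^ 2) / (4 * C0))
      have h2 := min_le_right (d0 ^ 2) ((ρ / 2) ^ 2)
      rw [le_div_iff₀ (by positivity)] at h1
      have : 0 < (ρ / 2) ^ 2 := by positivity
      nlinarith
  -- P bounds the momentum 2(x - y)/σ at the maximum. Uniform continuity of G is available on
  -- bounded sets only, so κ has to be chosen after σ.
  obtain ⟨P, hP⟩ : ∃ P, P = 2 * d0 / σ := ⟨_, rfl⟩
  have hPpos : 0 < P := by rw [hP]; positivity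
  have hGu := (isCompact_Icc (a := -(P + 1)) (b := P + 1)).uniformContinuousOn_of_continuous
    hG.continuousOn
  obtain ⟨d1, hd1, hG1⟩ := Metric.uniformContinuousOn_iff.1 hGu (γ * ρ / 2) (by positivity)
  -- choice of `κ`
  obtain ⟨κ, hκ, hκX, hκ1⟩ : ∃ κ, 0 < κ ∧ κ * X ^ 2 ≤ α ∧ 4 * κ * C0 < (min d1 1) ^ 2 := by
    refine ⟨min (α / (1 + X ^ 2)) ((min d1 1) ^ 2 / (8 * C0)), by positivity, ?_, ?_⟩
    · have := min_le_left (α / (1 + X ^ 2)) ((min d1 1) ^ 2 / (8 * C0))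
      rw [le_div_iff₀ (by positivity)] at this
      have h3 : 0 < min (α / (1 + X ^ 2)) ((min d1 1) ^ 2 / (8 * C0)) := by positivity
      nlinarith
    · have := min_le_right (α / (1 + X ^ 2)) ((min d1 1) ^ 2 / (8 * C0))
      rw [le_div_iff₀ (by positivity)] at this
      have h3 : 0 < (min d1 1) ^ 2 := by positivity
      nlinarith
  obtain ⟨Φ, hΦ⟩ : ∃ Φ : (ℝ × ℝ) × (ℝ × ℝ) → ℝ, ∀ z, Φ z = u z.1 - v z.2 -
    ((z.1.2 - z.2.2) ^ 2 + (z.1.1 - z.2.1) ^ 2) / σ - γ * z.1.1 ^ 2 - κ * z.1.2 ^ 2 :=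
    ⟨_, fun _ => rfl⟩
  have hP0 : 2 * α ≤ Φ ((T, X), (T, X)) := by
    simp only [hΦ]
    simp
    linarith
  obtain ⟨t1, x1, s1, y1, ht1, hs1, hglob, hD, hκx⟩ := exists_isMax_doubling
    hu.continuousOn hv.continuousOn h0 hA1 hA2 hgu hgv hγ hσ hσ1 hκ hT hΦ (X := X) (by linarith)
  rw [← hA, ← hC0] at hD hκx
  have hmax0 : 2 * α ≤ Φ ((t1, x1), (s1, y1)) := hP0.trans (hglob T X T X hT hT)
  have hxy : |x1 - y1| < ρ / 2 := abs_lt_of_sq_lt_sq (by linarith [sq_nonneg (t1 - s1)]) (by positivity)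
  have hts : |t1 - s1| < ρ / 2 := abs_lt_of_sq_lt_sq (by linarith [sq_nonneg (x1 - y1)]) (by positivity)
  have hxy' : |x1 - y1| < d0 := abs_lt_of_sq_lt_sq (by linarith [sq_nonneg (t1 - s1)]) (by positivity)
  have hΦu : Φ ((t1, x1), (s1, y1)) ≤ u (t1, x1) - v (s1, y1) := by
    simp only [hΦ]
    have : 0 ≤ ((x1 - y1) ^ 2 + (t1 - s1) ^ 2) / σ := by positivity
    have : 0 ≤ γ * t1 ^ 2 := by positivity
    have : 0 ≤ κ * x1 ^ 2 := by positivity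
    linarith
  -- Near t = 0 the ordering of the initial data keeps the difference below 3α/2, while the maximum
  -- is at least 2α.
  have ht1ρ : ρ ≤ t1 := by
    by_contra hlt
    push Not at hlt
    have k1 := hu1 (t1, x1) ⟨ht1, trivial⟩ (0, x1) ⟨self_mem_Ici, trivial⟩ (by
      simp [Prod.dist_eq, abs_of_nonneg ht1]; exact ⟨by linarith, hρ1⟩)
    have k2 := hv1 (t1, x1) ⟨ht1, trivial⟩ (0, x1) ⟨self_mem_Ici, trivial⟩ (by
      simp [Prod.dist_eq, abs_of_nonneg ht1]; exact ⟨by linarith, hρ2⟩)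
    have k3 := hv1 (t1, x1) ⟨ht1, trivial⟩ (s1, y1) ⟨hs1, trivial⟩ (by
      simp [Prod.dist_eq, Real.dist_eq]; constructor <;> linarith)
    rw [Real.dist_eq, abs_lt] at k1 k2 k3
    have := h0 x1
    linarith
  have ht1' : 0 < t1 := by linarith
  have hs1' : 0 < s1 := by linarith [(abs_lt.1 hts).2]
  obtain ⟨p, hp⟩ : ∃ p, p = 2 * (x1 - y1) / σ := ⟨_, rfl⟩
  obtain ⟨q, hq⟩ : ∃ q, q = 2 * (t1 - s1) / σ := ⟨_, rfl⟩
  have hdx : HasDerivAt (fun x => (x - y1) ^ 2 / σ + κ * x ^ 2) (p + 2 * κ * x1) x1 := by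
    have := ((((hasDerivAt_id x1).sub_const y1).pow 2).div_const σ).add
      (((hasDerivAt_id x1).pow 2).const_mul κ)
    refine this.congr_deriv ?_
    simp [hp]; ring
  have S1 := hsub.test_separable (α := fun t => (t - s1) ^ 2 / σ + γ * t ^ 2)
    (β := fun x => (x - y1) ^ 2 / σ + κ * x ^ 2) (by fun_prop) (by fun_prop) ht1'
    (a := q + 2 * γ * t1) (b := p + 2 * κ * x1) (x := x1) (by
      have := ((((hasDerivAt_id t1).sub_const s1).pow 2).div_const σ).add
        (((hasDerivAt_id t1).pow 2).const_mul γ)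
      refine this.congr_deriv ?_
      simp [hq]; ring) hdx (by
      filter_upwards [eventually_pos_fst (x := x1) ht1'] with z hz
      have := hglob z.1 z.2 s1 y1 hz.le hs1
      simp only [hΦ] at this
      have e1 : ∀ a b : ℝ, (a ^ 2 + b ^ 2) / σ = a ^ 2 / σ + b ^ 2 / σ := fun a b => add_div _ _ _
      rw [e1, e1] at this
      linarith)
  have S2 := hsup.test_separable (α := fun s => -((t1 - s) ^ 2 / σ))
    (β := fun y => -((x1 - y) ^ 2 / σ)) (by fun_prop) (by fun_prop) hs1'
    (a := q) (b := p) (x := y1) (by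
      have := ((((hasDerivAt_id s1).const_sub t1).pow 2).div_const σ).neg
      refine this.congr_deriv ?_
      simp [hq]; ring) (by
      have := ((((hasDerivAt_id y1).const_sub x1).pow 2).div_const σ).neg
      refine this.congr_deriv ?_
      simp [hp]; ring) (by
      filter_upwards [eventually_pos_fst (x := y1) hs1'] with z hz
      have := hglob t1 x1 z.1 z.2 ht1 hz.le
      simp only [hΦ] at this
      have e1 : ∀ a b : ℝ, (a ^ 2 + b ^ 2) / σ = a ^ 2 / σ + b ^ 2 / σ := fun a b => add_div _ _ _
      rw [e1, e1] at this
      linarith)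
  have hp_le : |p| ≤ P := by
    rw [hp, hP, abs_div, abs_mul, abs_of_pos hσ, abs_two]; gcongr
  have hκx1 : |2 * κ * x1| < min d1 1 := by
    apply abs_lt_of_sq_lt_sq _ (by positivity)
    have : 4 * κ * (κ * x1 ^ 2) ≤ 4 * κ * C0 := by gcongr
    calc (2 * κ * x1) ^ 2 = 4 * κ * (κ * x1 ^ 2) := by ring
      _ < _ := by linarith
  have hlt1 : |2 * κ * x1| < d1 := hκx1.trans_le (min_le_left _ _)
  have hlt2 : |2 * κ * x1| < 1 := hκx1.trans_le (min_le_right _ _)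
  have hGd := hG1 p (by rw [abs_le] at hp_le; constructor <;> linarith) (p + 2 * κ * x1) (by
    rw [abs_le] at hp_le; rw [abs_lt] at hlt2; constructor <;> linarith) (by
    rw [Real.dist_eq]; simpa [abs_sub_comm] using hlt1)
  have hWd := hW1 (a := x1) (b := y1) (by rw [Real.dist_eq]; exact hxy')
  rw [Real.dist_eq, abs_lt] at hGd hWd
  -- Subtracting the two viscosity inequalities gives 2γt1 < γρ, against ρ ≤ t1.
  have : γ * ρ ≤ γ * t1 := by gcongr
  have : 0 < γ * ρ := by positivity
  linarith

/-! ### One-sided derivative tests -/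

theorem le_deriv_of_eventually_right {ψ : ℝ → ℝ} {b c x : ℝ}
    (hψ : HasDerivWithinAt ψ b (Ioi x) x) (h : ∀ᶠ y in 𝓝[>] x, ψ x + c * (y - x) ≤ ψ y) :
    c ≤ b := by
  have h1 := (hasDerivWithinAt_iff_tendsto_slope' self_notMem_Ioi).1 hψ
  refine ge_of_tendsto h1 ?_
  filter_upwards [h, self_mem_nhdsWithin] with y hy hxy
  have : 0 < y - x := sub_pos.2 hxy
  rw [slope_def_field, le_div_iff₀ this]
  linarith

theorem deriv_le_of_eventually_left {ψ : ℝ → ℝ} {b c x : ℝ}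
    (hψ : HasDerivWithinAt ψ b (Iio x) x) (h : ∀ᶠ y in 𝓝[<] x, ψ x + c * (y - x) ≤ ψ y) :
    b ≤ c := by
  have h1 := (hasDerivWithinAt_iff_tendsto_slope' self_notMem_Iio).1 hψ
  refine le_of_tendsto h1 ?_
  filter_upwards [h, self_mem_nhdsWithin] with y hy hxy
  have : y - x < 0 := sub_neg.2 hxy
  rw [slope_def_field, div_le_iff_of_neg this]
  linarith

/-- A test function touching from above a function with slopes in `[b - κ, b + κ]`. -/
theorem abs_deriv_sub_le_of_isLocalMax {h ψ : ℝ → ℝ} {b c κ x : ℝ} (hψ : HasDerivAt ψ c x)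
    (hh : ∀ᶠ y in 𝓝 x, |h y - h x - b * (y - x)| ≤ κ * |y - x|)
    (hm : IsLocalMax (fun y => h y - ψ y) x) : |c - b| ≤ κ := by
  rw [abs_le]
  constructor
  · have : b - κ ≤ c := by
      refine le_deriv_of_eventually_right (hψ.hasDerivWithinAt) ?_
      filter_upwards [nhdsWithin_le_nhds hh, nhdsWithin_le_nhds hm, self_mem_nhdsWithin]
        with y h1 h2 h3
      rw [abs_of_pos (sub_pos.2 (mem_Ioi.1 h3) : 0 < y - x), abs_le] at h1
      linarith [h1.1]
    linarith
  · have : c ≤ b + κ := by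
      refine deriv_le_of_eventually_left (hψ.hasDerivWithinAt) ?_
      filter_upwards [nhdsWithin_le_nhds hh, nhdsWithin_le_nhds hm, self_mem_nhdsWithin]
        with y h1 h2 h3
      rw [abs_of_neg (sub_neg.2 (mem_Iio.1 h3) : y - x < 0), abs_le] at h1
      linarith [h1.1]
    linarith

theorem abs_deriv_sub_le_of_isLocalMin {h ψ : ℝ → ℝ} {b c κ x : ℝ} (hψ : HasDerivAt ψ c x)
    (hh : ∀ᶠ y in 𝓝 x, |h y - h x - b * (y - x)| ≤ κ * |y - x|)
    (hm : IsLocalMin (fun y => h y - ψ y) x) : |c - b| ≤ κ := by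
  have := abs_deriv_sub_le_of_isLocalMax (h := fun y => -h y) (ψ := fun y => -ψ y) (b := -b)
    (c := -c) (κ := κ) (x := x) hψ.neg (by
      filter_upwards [hh] with y hy
      rw [← abs_neg]; convert hy using 2; ring) (by
      refine hm.neg.congr (Eventually.of_forall fun y => ?_)
      simp; ring)
  rw [← abs_neg]; convert this using 2; ring

theorem ContDiff.hasDerivAt_fst_slice {φ : ℝ × ℝ → ℝ} (hφ : ContDiff ℝ 1 φ) (t x : ℝ) :
    HasDerivAt (fun s => φ (s, x)) (fderiv ℝ φ (t, x) (1, 0)) t := by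
  have h := ((hφ.differentiable one_ne_zero).differentiableAt (x := (t, x))).hasFDerivAt
  have h2 : HasDerivAt (fun s : ℝ => (s, x)) ((1 : ℝ), (0 : ℝ)) t :=
    (hasDerivAt_id t).prodMk (hasDerivAt_const t x)
  exact h.comp_hasDerivAt t h2

theorem ContDiff.hasDerivAt_snd_slice {φ : ℝ × ℝ → ℝ} (hφ : ContDiff ℝ 1 φ) (t x : ℝ) :
    HasDerivAt (fun y => φ (t, y)) (fderiv ℝ φ (t, x) (0, 1)) x := by
  have h := ((hφ.differentiable one_ne_zero).differentiableAt (x := (t, x))).hasFDerivAt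
  have h2 : HasDerivAt (fun y : ℝ => (t, y)) ((0 : ℝ), (1 : ℝ)) x :=
    (hasDerivAt_const x t).prodMk (hasDerivAt_id x)
  exact h.comp_hasDerivAt x h2

theorem IsLocalMax.fst_slice {f : ℝ × ℝ → ℝ} {t x : ℝ} (h : IsLocalMax f (t, x)) :
    IsLocalMax (fun s => f (s, x)) t :=
  (show Continuous fun s : ℝ => (s, x) by fun_prop).continuousAt.eventually h

theorem IsLocalMax.snd_slice {f : ℝ × ℝ → ℝ} {t x : ℝ} (h : IsLocalMax f (t, x)) :
    IsLocalMax (fun y => f (t, y)) x :=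
  (show Continuous fun y : ℝ => (t, y) by fun_prop).continuousAt.eventually h

theorem IsLocalMin.fst_slice {f : ℝ × ℝ → ℝ} {t x : ℝ} (h : IsLocalMin f (t, x)) :
    IsLocalMin (fun s => f (s, x)) t :=
  (show Continuous fun s : ℝ => (s, x) by fun_prop).continuousAt.eventually h

theorem IsLocalMin.snd_slice {f : ℝ × ℝ → ℝ} {t x : ℝ} (h : IsLocalMin f (t, x)) :
    IsLocalMin (fun y => f (t, y)) x :=
  (show Continuous fun y : ℝ => (t, y) by fun_prop).continuousAt.eventually h

/-! ### Elementary operations on subsolutions -/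

/-- The test inequality is inherited by a function touching from below. -/
theorem IsSubsol.of_touching {G W : ℝ → ℝ} {u : ℝ × ℝ → ℝ}
    (h : ∀ t x : ℝ, 0 < t → ∃ v, IsSubsol G W v ∧ v (t, x) = u (t, x) ∧
      ∀ᶠ z in 𝓝 (t, x), v z ≤ u z) : IsSubsol G W u := by
  intro φ hφ t x ht hm
  obtain ⟨v, hv, he, hle⟩ := h t x ht
  refine hv φ hφ t x ht ?_
  filter_upwards [hm, hle] with z h1 h2
  linarith

theorem IsSubsol.max {G W : ℝ → ℝ} {u v : ℝ × ℝ → ℝ} (hu : IsSubsol G W u)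
    (hv : IsSubsol G W v) : IsSubsol G W (fun z => max (u z) (v z)) := by
  refine IsSubsol.of_touching fun t x _ => ?_
  rcases le_total (u (t, x)) (v (t, x)) with h | h
  · exact ⟨v, hv, by simp [h], Eventually.of_forall fun z => le_max_right _ _⟩
  · exact ⟨u, hu, by simp [h], Eventually.of_forall fun z => le_max_left _ _⟩

theorem IsSupersol.add_const {G W : ℝ → ℝ} {u : ℝ × ℝ → ℝ} (hu : IsSupersol G W u) (c : ℝ) :
    IsSupersol G W (fun z => u z + c) := by
  intro φ hφ t x ht hm
  refine hu φ hφ t x ht ?_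
  filter_upwards [hm] with z h1
  linarith

theorem fderiv_comp_add_fst {φ : ℝ × ℝ → ℝ} (h t x : ℝ) :
    fderiv ℝ (fun z : ℝ × ℝ => φ (z.1 + h, z.2)) (t, x) = fderiv ℝ φ (t + h, x) := by
  have : (fun z : ℝ × ℝ => φ (z.1 + h, z.2)) = fun z => φ (z + (h, 0)) := by
    funext z; congr 1; ext <;> simp
  rw [this, fderiv_comp_add_right]
  simp

/-- Time translates of subsolutions, with a constant subtracted, touch. -/
theorem IsSubsol.test_time_shift {G W : ℝ → ℝ} {u : ℝ × ℝ → ℝ} (hu : IsSubsol G W u) {h c : ℝ}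
    {φ : ℝ × ℝ → ℝ} (hφ : ContDiff ℝ 1 φ) {t x : ℝ} (ht : 0 < t + h)
    (hm : IsLocalMax (fun z => (u (z.1 + h, z.2) + c) - φ z) (t, x)) :
    fderiv ℝ φ (t, x) (1, 0) + (G (fderiv ℝ φ (t, x) (0, 1)) + W x) ≤ 0 := by
  have h1 := hu (fun z => φ (z.1 + (-h), z.2)) (by fun_prop) (t + h) x ht (by
    have hc : ContinuousAt (fun z : ℝ × ℝ => (z.1 + (-h), z.2)) (t + h, x) := by fun_prop
    have he : (fun z : ℝ × ℝ => (z.1 + (-h), z.2)) (t + h, x) = (t, x) := by simp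
    have := hc.eventually (he ▸ hm)
    filter_upwards [this] with z hz
    simp at hz ⊢
    linarith)
  rw [fderiv_comp_add_fst] at h1
  simpa using h1

/-- Functions `h(x) + a t` with `h` having slopes in `[b - κ, b + κ]`: test gradients. -/
theorem test_gradient_of_isLocalMax {v φ : ℝ × ℝ → ℝ} {t x a b κ : ℝ} (hφ : ContDiff ℝ 1 φ)
    (h1 : ∀ᶠ s in 𝓝 t, |v (s, x) - v (t, x) - a * (s - t)| ≤ κ * |s - t|)
    (h2 : ∀ᶠ y in 𝓝 x, |v (t, y) - v (t, x) - b * (y - x)| ≤ κ * |y - x|)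
    (hm : IsLocalMax (fun z => v z - φ z) (t, x)) :
    |fderiv ℝ φ (t, x) (1, 0) - a| ≤ κ ∧ |fderiv ℝ φ (t, x) (0, 1) - b| ≤ κ :=
  ⟨abs_deriv_sub_le_of_isLocalMax (hφ.hasDerivAt_fst_slice t x) h1 hm.fst_slice,
    abs_deriv_sub_le_of_isLocalMax (hφ.hasDerivAt_snd_slice t x) h2 hm.snd_slice⟩

/-- A test function touching g(x) - Ct from above has time derivative exactly -C and space
derivative at most L in modulus, where |G + W| ≤ C. -/
theorem IsSubsol.barrier {G W g : ℝ → ℝ} {L C : ℝ} (hg : ∀ x y, |g x - g y| ≤ L * |x - y|)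
    (hC : ∀ p x, |p| ≤ L → |G p + W x| ≤ C) : IsSubsol G W (fun z => g z.2 - C * z.1) := by
  intro φ hφ t x ht hm
  have h1 : |fderiv ℝ φ (t, x) (1, 0) - (-C)| ≤ 0 :=
    abs_deriv_sub_le_of_isLocalMax (hφ.hasDerivAt_fst_slice t x)
      (h := fun s => g x - C * s) (Eventually.of_forall fun s => by
        have : g x - C * s - (g x - C * t) - -C * (s - t) = 0 := by ring
        rw [this]; simp) hm.fst_slice
  have h2 : |fderiv ℝ φ (t, x) (0, 1) - 0| ≤ L :=
    abs_deriv_sub_le_of_isLocalMax (hφ.hasDerivAt_snd_slice t x)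
      (h := fun y => g y - C * t) (Eventually.of_forall fun y => by
        simpa using hg y x) hm.snd_slice
  have h3 := abs_eq_zero.1 (le_antisymm h1 (abs_nonneg _))
  rw [sub_zero] at h2
  have := (abs_le.1 (hC _ x h2)).2
  linarith

theorem IsSupersol.barrier_test {G W g : ℝ → ℝ} {L C : ℝ}
    (hg : ∀ x y, |g x - g y| ≤ L * |x - y|)
    (hC : ∀ p x, |p| ≤ L → |G p + W x| ≤ C) : IsSupersol G W (fun z => g z.2 + C * z.1) := by
  intro φ hφ t x ht hm
  have h1 : |fderiv ℝ φ (t, x) (1, 0) - C| ≤ 0 :=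
    abs_deriv_sub_le_of_isLocalMin (hφ.hasDerivAt_fst_slice t x)
      (h := fun s => g x + C * s) (Eventually.of_forall fun s => by
        have : g x + C * s - (g x + C * t) - C * (s - t) = 0 := by ring
        rw [this]; simp) hm.fst_slice
  have h2 : |fderiv ℝ φ (t, x) (0, 1) - 0| ≤ L :=
    abs_deriv_sub_le_of_isLocalMin (hφ.hasDerivAt_snd_slice t x)
      (h := fun y => g y + C * t) (Eventually.of_forall fun y => by
        simpa using hg y x) hm.snd_slice
  have h3 := abs_eq_zero.1 (le_antisymm h1 (abs_nonneg _))
  rw [sub_zero] at h2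
  have := (abs_le.1 (hC _ x h2)).1
  linarith

theorem hasDerivAt_sub_sq (a x : ℝ) : HasDerivAt (fun s : ℝ => (s - a) ^ 2) (2 * (x - a)) x :=
  (((hasDerivAt_id x).sub_const a).pow 2).congr_deriv (by simp)

theorem closedBall_subset_of_lt {t x r : ℝ} (hr : r ≤ t) :
    Metric.closedBall ((t, x) : ℝ × ℝ) r ⊆ Ici 0 ×ˢ univ := by
  intro z hz
  rw [Metric.mem_closedBall, Prod.dist_eq, max_le_iff, Real.dist_eq, abs_le] at hz
  refine ⟨?_, trivial⟩
  have := hz.1.1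
  simp only [mem_Ici]
  linarith

/-- Stability of subsolutions under relaxed limits. -/
theorem IsSubsol.of_approx {G W : ℝ → ℝ} (hG : Continuous G) (hW : Continuous W)
    {u : ℝ × ℝ → ℝ}
    (h : ∀ t x : ℝ, 0 < t → ∃ r > 0, ∀ η > 0, ∃ v, IsSubsol G W v ∧
      ContinuousOn v (Ici 0 ×ˢ univ) ∧ (∀ z ∈ Metric.closedBall (t, x) r, v z ≤ u z + η) ∧
      u (t, x) - η ≤ v (t, x)) : IsSubsol G W u := by
  intro φ hφ t x ht hm
  obtain ⟨r1, hr1, h⟩ := h t x ht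
  obtain ⟨r2, hr2, hm2⟩ := Metric.eventually_nhds_iff_ball.1 hm
  obtain ⟨r, hr, hra, hrb, hrc⟩ : ∃ r, 0 < r ∧ r ≤ r1 ∧ r < r2 ∧ r ≤ t :=
    ⟨min (min r1 (r2 / 2)) t, by positivity, by simp, by
      have : min (min r1 (r2 / 2)) t ≤ r2 / 2 := by simp
      linarith, by simp⟩
  have hcont : Continuous fun z : ℝ × ℝ => (fderiv ℝ φ z (1, 0) + 2 * (z.1 - t)) +
      (G (fderiv ℝ φ z (0, 1) + 2 * (z.2 - x)) + W z.2) := by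
    have hf := hφ.continuous_fderiv one_ne_zero
    have h1 : Continuous fun z => fderiv ℝ φ z (1, 0) := hf.clm_apply continuous_const
    have h2 : Continuous fun z => fderiv ℝ φ z (0, 1) := hf.clm_apply continuous_const
    fun_prop
  by_contra hpos
  push Not at hpos
  have hev := (hcont.continuousAt (x := (t, x))).eventually (lt_mem_nhds (a := 0) (by simpa using hpos))
  obtain ⟨r3, hr3, hev⟩ := Metric.eventually_nhds_iff_ball.1 hev
  set ρ := min r r3 / 2 with hρ
  have hρ0 : 0 < ρ := by positivity
  have hρr : ρ < r := by
    have := min_le_left r r3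
    have : 0 < min r r3 := by positivity
    linarith
  have hρr3 : ρ < r3 := by
    have := min_le_right r r3
    have : 0 < min r r3 := by positivity
    linarith
  -- The added quadratic makes the maximum strict: with an error of ρ²/4 on either side, the maximum
  -- point of v is at distance less than ρ.
  obtain ⟨v, hv, hvc, hvu, hvz⟩ := h (ρ ^ 2 / 4) (by positivity)
  have hcomp : IsCompact (Metric.closedBall ((t, x) : ℝ × ℝ) r) := isCompact_closedBall _ _
  have hvc' : ContinuousOn (fun z : ℝ × ℝ => v z - (φ z + ((z.1 - t) ^ 2 + (z.2 - x) ^ 2)))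
      (Metric.closedBall (t, x) r) := by
    refine (hvc.mono (closedBall_subset_of_lt hrc)).sub (Continuous.continuousOn ?_)
    have := hφ.continuous
    fun_prop
  obtain ⟨⟨t1, x1⟩, hz1, hmax⟩ := hcomp.exists_isMaxOn ⟨(t, x), by simp [hr.le]⟩ hvc'
  rw [isMaxOn_iff] at hmax
  have hb := hmax (t, x) (by simp [hr.le])
  have hin2 : (t1, x1) ∈ Metric.ball (t, x) r2 := Metric.closedBall_subset_ball hrb hz1
  have hu1 := hm2 _ hin2
  have hv1 := hvu _ (Metric.closedBall_subset_closedBall hra hz1)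
  simp only [sub_self] at hb hu1
  have hq : (t1 - t) ^ 2 + (x1 - x) ^ 2 < ρ ^ 2 := by
    have : 0 < ρ ^ 2 := by positivity
    linarith
  have hd : dist ((t1, x1) : ℝ × ℝ) (t, x) < ρ := by
    rw [Prod.dist_eq, max_lt_iff, Real.dist_eq, Real.dist_eq]
    exact ⟨abs_lt_of_sq_lt_sq (by linarith [sq_nonneg (x1 - x)]) hρ0.le,
      abs_lt_of_sq_lt_sq (by linarith [sq_nonneg (t1 - t)]) hρ0.le⟩
  have ht1 : 0 < t1 := by
    rw [Prod.dist_eq, max_lt_iff, Real.dist_eq, abs_lt] at hd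
    have := hd.1.1
    simp only at this
    linarith
  have hloc : IsLocalMax (fun z : ℝ × ℝ => v z - (φ z + ((z.1 - t) ^ 2 + (z.2 - x) ^ 2)))
      (t1, x1) := by
    have : Metric.ball ((t, x) : ℝ × ℝ) r ∈ 𝓝 (t1, x1) :=
      Metric.isOpen_ball.mem_nhds (by rw [Metric.mem_ball]; linarith)
    filter_upwards [this] with z hz
    exact hmax z (Metric.ball_subset_closedBall hz)
  have hS := hv (fun z => φ z + ((z.1 - t) ^ 2 + (z.2 - x) ^ 2)) (by fun_prop) t1 x1 ht1 hloc
  have hdα : HasDerivAt (fun s : ℝ => (s - t) ^ 2) (2 * (t1 - t)) t1 :=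
    hasDerivAt_sub_sq t t1
  have hdβ : HasDerivAt (fun s : ℝ => (s - x) ^ 2) (2 * (x1 - x)) x1 :=
    hasDerivAt_sub_sq x x1
  have hfd : fderiv ℝ (fun z : ℝ × ℝ => φ z + ((z.1 - t) ^ 2 + (z.2 - x) ^ 2)) (t1, x1) =
      fderiv ℝ φ (t1, x1) + fderiv ℝ (fun z : ℝ × ℝ => (z.1 - t) ^ 2 + (z.2 - x) ^ 2) (t1, x1) :=
    fderiv_fun_add (hφ.differentiable one_ne_zero).differentiableAt
      (by fun_prop)
  have hf := fderiv_separable hdα hdβ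
  rw [hfd, add_apply, add_apply, hf.1, hf.2] at hS
  have := hev (t1, x1) (by rw [Metric.mem_ball]; linarith)
  simp only at this
  linarith

/-! ### Perron's method -/

/-- The Perron class of subsolutions which are `K`-Lipschitz in space, Lipschitz in time, and
lie between the barriers `g(x) ± C t`. -/
structure PerronClass (G W g : ℝ → ℝ) (C K : ℝ) (v : ℝ × ℝ → ℝ) : Prop where
  subsol : IsSubsol G W v
  lip_space : ∀ t x y, 0 ≤ t → |v (t, x) - v (t, y)| ≤ K * |x - y|
  lip_time : ∃ L, 0 ≤ L ∧ ∀ t s x, 0 ≤ t → 0 ≤ s → |v (t, x) - v (s, x)| ≤ L * |t - s|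
  lower : ∀ t x, 0 ≤ t → g x - C * t ≤ v (t, x)
  upper : ∀ t x, 0 ≤ t → v (t, x) ≤ g x + C * t

theorem PerronClass.initial {G W g : ℝ → ℝ} {C K : ℝ} {v : ℝ × ℝ → ℝ}
    (hv : PerronClass G W g C K v) (x : ℝ) : v (0, x) = g x :=
  le_antisymm (by simpa using hv.upper 0 x le_rfl) (by simpa using hv.lower 0 x le_rfl)

theorem lipschitz_pair {v : ℝ × ℝ → ℝ} {K L : ℝ}
    (h1 : ∀ t x y, 0 ≤ t → |v (t, x) - v (t, y)| ≤ K * |x - y|)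
    (h2 : ∀ t s x, 0 ≤ t → 0 ≤ s → |v (t, x) - v (s, x)| ≤ L * |t - s|) :
    ∀ t s x y, 0 ≤ t → 0 ≤ s → |v (t, x) - v (s, y)| ≤ L * |t - s| + K * |x - y| := by
  intro t s x y ht hs
  have := abs_sub_le (v (t, x)) (v (s, x)) (v (s, y))
  linarith [h1 s x y hs, h2 t s x ht hs]

theorem uniformContinuousOn_of_lipschitz_pair {v : ℝ × ℝ → ℝ} {K L : ℝ} (hK : 0 ≤ K) (hL : 0 ≤ L)
    (h : ∀ t s x y, 0 ≤ t → 0 ≤ s → |v (t, x) - v (s, y)| ≤ L * |t - s| + K * |x - y|) :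
    UniformContinuousOn v (Ici 0 ×ˢ univ) := by
  have : LipschitzOnWith (L + K).toNNReal v (Ici 0 ×ˢ univ) := by
    refine LipschitzOnWith.of_dist_le_mul fun z hz w hw => ?_
    rw [Real.coe_toNNReal _ (by positivity), Real.dist_eq]
    have := h z.1 w.1 z.2 w.2 hz.1 hw.1
    have h1 : |z.1 - w.1| ≤ dist z w := by rw [← Real.dist_eq]; exact le_max_left _ _
    have h2 : |z.2 - w.2| ≤ dist z w := by rw [← Real.dist_eq]; exact le_max_right _ _
    calc |v z - v w| ≤ L * |z.1 - w.1| + K * |z.2 - w.2| := this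
      _ ≤ L * dist z w + K * dist z w := by gcongr
      _ = _ := by ring
  exact this.uniformContinuousOn

theorem PerronClass.uniformContinuousOn {G W g : ℝ → ℝ} {C K : ℝ} {v : ℝ × ℝ → ℝ} (hK : 0 ≤ K)
    (hv : PerronClass G W g C K v) : UniformContinuousOn v (Ici 0 ×ˢ univ) := by
  obtain ⟨L, hL, h⟩ := hv.lip_time
  exact uniformContinuousOn_of_lipschitz_pair hK hL (lipschitz_pair hv.lip_space h)

theorem abs_max_sub_max_le {a b c d e : ℝ} (h1 : |a - c| ≤ e) (h2 : |b - d| ≤ e) :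
    |max a b - max c d| ≤ e :=
  (abs_max_sub_max_le_max a b c d).trans (max_le h1 h2)

theorem perronClass_barrier {G W g : ℝ → ℝ} {L C K : ℝ} (hLK : L ≤ K) (hC0 : 0 ≤ C)
    (hg : ∀ x y, |g x - g y| ≤ L * |x - y|) (hC : ∀ p x, |p| ≤ L → |G p + W x| ≤ C) :
    PerronClass G W g C K (fun z => g z.2 - C * z.1) where
  subsol := IsSubsol.barrier hg hC
  lip_space t x y _ := by
    have := hg x y
    have : L * |x - y| ≤ K * |x - y| := by gcongr
    simpa using (by linarith : |g x - g y| ≤ K * |x - y|)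
  lip_time := ⟨C, hC0, fun t s x _ _ => by
    have : g x - C * t - (g x - C * s) = -(C * (t - s)) := by ring
    simp only [this, abs_neg, abs_mul, abs_of_nonneg hC0, le_refl]⟩
  lower t x _ := le_rfl
  upper t x ht := by
    have : 0 ≤ C * t := by positivity
    simp only
    linarith

/-- Time-delayed subsolution, started along the lower barrier. -/
theorem PerronClass.delay {G W g : ℝ → ℝ} {L C K : ℝ} (hC0 : 0 ≤ C)
    (hg : ∀ x y, |g x - g y| ≤ L * |x - y|) (hC : ∀ p x, |p| ≤ L → |G p + W x| ≤ C)
    {v : ℝ × ℝ → ℝ} (hv : PerronClass G W g C K v) {h : ℝ} (hh : 0 ≤ h) :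
    PerronClass G W g C K (fun z => v (max (z.1 - h) 0, z.2) - C * min z.1 h) := by
  have hlow : ∀ t x, 0 ≤ t → g x - C * t ≤ v (max (t - h) 0, x) - C * min t h := by
    intro t x ht
    have := hv.lower (max (t - h) 0) x (le_max_right _ _)
    rcases le_total t h with hth | hth
    · rw [max_eq_right (by linarith)] at this ⊢
      rw [min_eq_left hth]; linarith
    · rw [max_eq_left (by linarith)] at this ⊢
      rw [min_eq_right hth]; linarith
  refine ⟨?_, ?_, ?_, hlow, ?_⟩
  · intro φ hφ t x ht hm
    rcases le_or_gt t h with hth | hth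
    -- Up to time h the delayed function is the lower barrier, and it dominates the barrier
    -- everywhere; so a maximum at time t ≤ h is also one for the barrier.
    · refine (IsSubsol.barrier hg hC) φ hφ t x ht ?_
      filter_upwards [hm, eventually_pos_fst (x := x) ht] with z h1 h2
      have h3 := hlow z.1 z.2 h2.le
      simp only [max_eq_right (by linarith : t - h ≤ 0), min_eq_left hth, hv.initial] at h1
      linarith
    · refine hv.subsol.test_time_shift (h := -h) (c := -(C * h)) hφ (by linarith) ?_
      have : ∀ᶠ z : ℝ × ℝ in 𝓝 (t, x), h < z.1 :=
        continuous_fst.continuousAt.eventually (lt_mem_nhds hth)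
      filter_upwards [hm, this] with z h1 h2
      simp only [max_eq_left (by linarith : (0 : ℝ) ≤ t - h), min_eq_right hth.le,
        max_eq_left (by linarith : (0 : ℝ) ≤ z.1 - h), min_eq_right h2.le] at h1
      simp only [← sub_eq_add_neg]
      linarith
  · intro t x y _
    have := hv.lip_space (max (t - h) 0) x y (le_max_right _ _)
    simpa using this
  · obtain ⟨Lt, hLt, h1⟩ := hv.lip_time
    refine ⟨Lt + C, by positivity, fun t s x _ _ => ?_⟩
    have e1 := h1 (max (t - h) 0) (max (s - h) 0) x (le_max_right _ _) (le_max_right _ _)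
    have e2 : |max (t - h) 0 - max (s - h) 0| ≤ |t - s| :=
      abs_max_sub_max_le (by ring_nf; simp) (by simp)
    have e3 : |min t h - min s h| ≤ |t - s| :=
      (abs_min_sub_min_le_max t h s h).trans (by simp)
    have e4 : |C * min s h - C * min t h| ≤ C * |t - s| := by
      rw [← mul_sub, abs_mul, abs_of_nonneg hC0, abs_sub_comm]; gcongr
    have e5 : Lt * |max (t - h) 0 - max (s - h) 0| ≤ Lt * |t - s| := by gcongr
    have e6 := abs_add_le (v (max (t - h) 0, x) - v (max (s - h) 0, x))
      (C * min s h - C * min t h)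
    have e7 : v (max (t - h) 0, x) - C * min t h - (v (max (s - h) 0, x) - C * min s h) =
      v (max (t - h) 0, x) - v (max (s - h) 0, x) + (C * min s h - C * min t h) := by ring
    simp only [e7]
    linarith
  · intro t x ht
    have := hv.upper (max (t - h) 0) x (le_max_right _ _)
    have h2 : 0 ≤ C * h := by positivity
    have h3 : 0 ≤ C * t := by positivity
    simp only
    rcases le_total t h with hth | hth
    · rw [max_eq_right (by linarith)] at this ⊢
      rw [min_eq_left hth]; linarith
    · rw [max_eq_left (by linarith)] at this ⊢
      rw [min_eq_right hth]; linarith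

/-- Time-advanced subsolution, kept above the lower barrier. -/
theorem PerronClass.advance {G W g : ℝ → ℝ} {L C K : ℝ} (hC0 : 0 ≤ C) (hLK : L ≤ K)
    (hg : ∀ x y, |g x - g y| ≤ L * |x - y|) (hC : ∀ p x, |p| ≤ L → |G p + W x| ≤ C)
    {v : ℝ × ℝ → ℝ} (hv : PerronClass G W g C K v) {h : ℝ} (hh : 0 ≤ h) :
    PerronClass G W g C K (fun z => max (v (z.1 + h, z.2) + -(C * h)) (g z.2 - C * z.1)) := by
  have hb := perronClass_barrier (G := G) (W := W) hLK hC0 hg hC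
  obtain ⟨L1, hL1, h1⟩ := hv.lip_time
  obtain ⟨L2, hL2, h2⟩ := hb.lip_time
  refine ⟨IsSubsol.max (fun φ hφ t x ht hm => hv.subsol.test_time_shift hφ (by linarith) hm)
      hb.subsol,
    fun t x y ht => abs_max_sub_max_le (by simpa using hv.lip_space (t + h) x y (by linarith))
      (hb.lip_space t x y ht),
    ⟨max L1 L2, by positivity, fun t s x ht hs => abs_max_sub_max_le
      ?_ ((h2 t s x ht hs).trans (by gcongr; exact le_max_right _ _))⟩,
    fun t x ht => le_max_right _ _,
    fun t x ht => max_le ?_ (hb.upper t x ht)⟩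
  · have := h1 (t + h) (s + h) x (by linarith) (by linarith)
    simp only [add_sub_add_right_eq_sub] at this ⊢
    exact this.trans (by gcongr; exact le_max_left _ _)
  · have := hv.upper (t + h) x (by linarith)
    simp only
    linarith

/-- Gluing a modification on a ball to a `K`-Lipschitz function. -/
theorem lipschitz_glue {s : Set ℝ} (hs : Convex ℝ s) {u w : ℝ → ℝ} {K x0 r ρ : ℝ} (hρr : ρ < r)
    (hu : ∀ x ∈ s, ∀ y ∈ s, |u x - u y| ≤ K * |x - y|)
    (hw : ∀ x ∈ s, ∀ y ∈ s, |x - x0| < r → |y - x0| < r → |w x - w y| ≤ K * |x - y|)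
    (hout : ∀ x ∈ s, ρ ≤ |x - x0| → w x = u x) :
    ∀ x ∈ s, ∀ y ∈ s, |w x - w y| ≤ K * |x - y| := by
  have key : ∀ x ∈ s, ∀ y ∈ s, |x - x0| < ρ → r ≤ |y - x0| → |w x - w y| ≤ K * |x - y| := by
    intro x hx y hy h1 h2
    have hρ : 0 < ρ := (abs_nonneg _).trans_lt h1
    -- The segment from x to y crosses the sphere of radius ρ at c, where w = u: the local estimate
    -- applies on one side of c and that of u on the other.
    obtain ⟨c, hc, hcx, hcy⟩ : ∃ c, |c - x0| = ρ ∧ |x - y| = |x - c| + |c - y| ∧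
        c ∈ uIcc x y := by
      rw [abs_lt] at h1
      rcases le_abs.1 h2 with h2 | h2
      · refine ⟨x0 + ρ, by simp [hρ.le], ?_, ?_⟩
        · rw [abs_of_nonpos (by linarith), abs_of_nonpos (by linarith), abs_of_nonpos (by linarith)]
          ring
        · rw [uIcc_of_le (by linarith)]; constructor <;> linarith
      · refine ⟨x0 - ρ, by simp [hρ.le], ?_, ?_⟩
        · rw [abs_of_nonneg (by linarith), abs_of_nonneg (by linarith), abs_of_nonneg (by linarith)]
          ring
        · rw [uIcc_of_ge (by linarith)]; constructor <;> linarith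
    have hcs : c ∈ s := (segment_eq_uIcc x y ▸ hs.segment_subset hx hy) hcy
    have e1 := hw x hx c hcs (by linarith) (by linarith)
    have e2 := hu c hcs y hy
    rw [← hout c hcs hc.ge, ← hout y hy (by linarith)] at e2
    have := abs_sub_le (w x) (w c) (w y)
    rw [hcx]
    linarith
  intro x hx y hy
  rcases lt_or_ge |x - x0| r with hxr | hxr <;> rcases lt_or_ge |y - x0| r with hyr | hyr
  · exact hw x hx y hy hxr hyr
  · rcases lt_or_ge |x - x0| ρ with h | h
    · exact key x hx y hy h hyr
    · rw [hout x hx h, hout y hy (by linarith)]; exact hu x hx y hy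
  · rcases lt_or_ge |y - x0| ρ with h | h
    · rw [abs_sub_comm, abs_sub_comm x]; exact key y hy x hx h hxr
    · rw [hout y hy h, hout x hx (by linarith)]; exact hu x hx y hy
  · rw [hout y hy (by linarith), hout x hx (by linarith)]; exact hu x hx y hy

/-- The supremum of the Perron class. -/
noncomputable def perronSup (G W g : ℝ → ℝ) (C K : ℝ) (z : ℝ × ℝ) : ℝ :=
  ⨆ v : {v // PerronClass G W g C K v}, v.1 z

section Perron

variable {G W g : ℝ → ℝ} {L C K : ℝ}

theorem PerronClass.le_perronSup {v : ℝ × ℝ → ℝ} (hv : PerronClass G W g C K v) {t x : ℝ}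
    (ht : 0 ≤ t) : v (t, x) ≤ perronSup G W g C K (t, x) :=
  le_ciSup (f := fun v : {v // PerronClass G W g C K v} => v.1 (t, x))
    ⟨g x + C * t, by rintro _ ⟨v, rfl⟩; exact v.2.upper t x ht⟩ ⟨v, hv⟩

theorem perronSup_le {v₀ : ℝ × ℝ → ℝ} (hv₀ : PerronClass G W g C K v₀) {z : ℝ × ℝ} {c : ℝ}
    (h : ∀ v, PerronClass G W g C K v → v z ≤ c) : perronSup G W g C K z ≤ c := by
  have : Nonempty {v // PerronClass G W g C K v} := ⟨⟨v₀, hv₀⟩⟩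
  exact ciSup_le fun v => h v.1 v.2

/-- Delayed and advanced copies of members, lowered by C times the time shift, stay in the class, so
the supremum is C-Lipschitz in time even though each member may have its own time constant. This
freedom is needed for the bump in `isSupersol_perronSup`, which enlarges that constant. -/
theorem perronClass_perronSup (hG : Continuous G) (hW : Continuous W) (hL : 0 ≤ L)
    (hLK : L ≤ K) (hC0 : 0 ≤ C)
    (hg : ∀ x y, |g x - g y| ≤ L * |x - y|) (hC : ∀ p x, |p| ≤ L → |G p + W x| ≤ C) :
    PerronClass G W g C K (perronSup G W g C K) ∧
    ∀ t s x, 0 ≤ t → 0 ≤ s →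
      |perronSup G W g C K (t, x) - perronSup G W g C K (s, x)| ≤ C * |t - s| := by
  have hb := perronClass_barrier (G := G) (W := W) hLK hC0 hg hC
  have hmono : ∀ t s x, 0 ≤ t → t ≤ s →
      |perronSup G W g C K (t, x) - perronSup G W g C K (s, x)| ≤ C * |t - s| := by
    intro t s x ht hts
    have h0 : 0 ≤ s - t := by linarith
    have e : |t - s| = s - t := by rw [abs_of_nonpos (by linarith)]; ring
    rw [e, abs_le]
    constructor
    · have : perronSup G W g C K (s, x) ≤ perronSup G W g C K (t, x) + C * (s - t) := by
        refine perronSup_le hb fun v hv => ?_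
        have h1 := (hv.advance hC0 hLK hg hC h0).le_perronSup ht (x := x)
        have h2 := (le_max_left _ _).trans h1
        simp only [add_sub_cancel] at h2
        linarith
      linarith
    · have : perronSup G W g C K (t, x) ≤ perronSup G W g C K (s, x) + C * (s - t) := by
        refine perronSup_le hb fun v hv => ?_
        have h1 := (hv.delay hC0 hg hC h0).le_perronSup (ht.trans hts) (x := x)
        simp only [sub_sub_cancel, max_eq_left ht, min_eq_right (by linarith : s - t ≤ s)] at h1
        linarith
      linarith
  have htime : ∀ t s x, 0 ≤ t → 0 ≤ s →
      |perronSup G W g C K (t, x) - perronSup G W g C K (s, x)| ≤ C * |t - s| := by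
    intro t s x ht hs
    rcases le_total t s with h | h
    · exact hmono t s x ht h
    · rw [abs_sub_comm, abs_sub_comm t]; exact hmono s t x hs h
  refine ⟨⟨?_, ?_, ⟨C, hC0, htime⟩, fun t x ht => hb.le_perronSup ht, fun t x ht =>
    perronSup_le hb fun v hv => hv.upper t x ht⟩, htime⟩
  · refine IsSubsol.of_approx hG hW fun t x ht => ⟨t, ht, fun η hη => ?_⟩
    have : Nonempty {v // PerronClass G W g C K v} := ⟨⟨_, hb⟩⟩
    obtain ⟨⟨v, hv⟩, hlt⟩ := exists_lt_of_lt_ciSup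
      (show perronSup G W g C K (t, x) - η < ⨆ v : {v // PerronClass G W g C K v}, v.1 (t, x) by
        rw [← perronSup]; linarith)
    refine ⟨v, hv.subsol, (hv.uniformContinuousOn (hL.trans hLK)).continuousOn, fun z hz => ?_,
      hlt.le⟩
    have := hv.le_perronSup (closedBall_subset_of_lt le_rfl hz).1 (x := z.2)
    simp only [Prod.mk.eta] at this
    linarith
  · have hle : ∀ t x y, 0 ≤ t →
        perronSup G W g C K (t, x) ≤ perronSup G W g C K (t, y) + K * |x - y| := by
      intro t x y ht
      refine perronSup_le hb fun v hv => ?_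
      have h1 := hv.le_perronSup ht (x := y)
      have h2 := (abs_le.1 (hv.lip_space t x y ht)).2
      linarith
    intro t x y ht
    have h1 := hle t x y ht
    have h2 := hle t y x ht
    rw [abs_sub_comm] at h2
    rw [abs_le]
    constructor <;> linarith

/-- Linear lower bound at a point touched from below by a smooth function. -/
theorem eventually_linear_le_of_isLocalMin {u φ : ℝ × ℝ → ℝ} {t x κ : ℝ} (hφ : ContDiff ℝ 1 φ)
    (hm : IsLocalMin (fun z => u z - φ z) (t, x)) (hκ : 0 < κ) :
    ∀ᶠ z : ℝ × ℝ in 𝓝 (t, x), u (t, x) + fderiv ℝ φ (t, x) (1, 0) * (z.1 - t) +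
      fderiv ℝ φ (t, x) (0, 1) * (z.2 - x) - κ * (|z.1 - t| + |z.2 - x|) ≤ u z := by
  have hd := ((hφ.differentiable one_ne_zero).differentiableAt (x := (t, x))).hasFDerivAt
  have ho := hd.isLittleO.def hκ
  filter_upwards [hm, ho] with z h1 h2
  have e1 : fderiv ℝ φ (t, x) (z - (t, x)) = fderiv ℝ φ (t, x) (1, 0) * (z.1 - t) +
      fderiv ℝ φ (t, x) (0, 1) * (z.2 - x) := by
    have : z - (t, x) = (z.1 - t) • ((1 : ℝ), (0 : ℝ)) + (z.2 - x) • ((0 : ℝ), (1 : ℝ)) := by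
      ext <;> simp
    rw [this, map_add, map_smul, map_smul]
    simp only [smul_eq_mul]; ring
  rw [e1, Real.norm_eq_abs, abs_le] at h2
  have h3 : ‖z - (t, x)‖ ≤ |z.1 - t| + |z.2 - x| := by
    rw [Prod.norm_def]
    simp only [Prod.fst_sub, Prod.snd_sub, Real.norm_eq_abs]
    exact max_le (by linarith [abs_nonneg (z.2 - x)]) (by linarith [abs_nonneg (z.1 - t)])
  have h4 : κ * ‖z - (t, x)‖ ≤ κ * (|z.1 - t| + |z.2 - x|) := by gcongr
  linarith [h2.1]

/-- Perron's bump argument inside a Lipschitz class. Where the supersolution test fails, the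
function is raised by a small cone. The condition at ±K makes the test slope strictly smaller than K
in modulus, so the cone respects the spatial bound, and strict separation from the upper barrier
keeps it admissible. The raised function is a member exceeding the supremum. -/
theorem isSupersol_perronSup (hG : Continuous G) (hW : Continuous W) (hL : 0 ≤ L)
    (hLK : L ≤ K) (hC0 : 0 ≤ C)
    (hg : ∀ x y, |g x - g y| ≤ L * |x - y|) (hC : ∀ p x, |p| ≤ L → |G p + W x| ≤ C)
    (hK : ∀ x, C < G K + W x ∧ C < G (-K) + W x) :
    IsSupersol G W (perronSup G W g C K) := by
  obtain ⟨hu, htime⟩ := perronClass_perronSup hG hW hL hLK hC0 hg hC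
  obtain ⟨u, hu_def⟩ : ∃ u, u = perronSup G W g C K := ⟨_, rfl⟩
  have hmaxl : ∀ v, PerronClass G W g C K v → ∀ t x, 0 ≤ t → v (t, x) ≤ u (t, x) := by
    intro v hv t x ht; rw [hu_def]; exact hv.le_perronSup ht
  rw [← hu_def] at hu htime ⊢
  have hK0 : 0 ≤ K := hL.trans hLK
  intro φ hφ t0 x0 ht0 hm
  by_contra hneg
  push Not at hneg
  obtain ⟨a, ha⟩ : ∃ a, a = fderiv ℝ φ (t0, x0) (1, 0) := ⟨_, rfl⟩
  obtain ⟨b, hb⟩ : ∃ b, b = fderiv ℝ φ (t0, x0) (0, 1) := ⟨_, rfl⟩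
  rw [← ha, ← hb] at hneg
  have hgc : Continuous g := by
    have : LipschitzWith L.toNNReal g := LipschitzWith.of_dist_le_mul fun x y => by
      rw [Real.coe_toNNReal _ hL, Real.dist_eq, Real.dist_eq]; exact hg x y
    exact this.continuous
  have hgap : u (t0, x0) < g x0 + C * t0 := by
    refine lt_of_le_of_ne (hu.upper t0 x0 ht0.le) fun heq => ?_
    have := IsSupersol.barrier_test hg hC φ hφ t0 x0 ht0 (by
      filter_upwards [hm, eventually_pos_fst ht0] with z h1 h2
      have := hu.upper z.1 z.2 h2.le
      simp only [Prod.mk.eta] at this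
      linarith)
    rw [← ha, ← hb] at this
    linarith
  have hbK : |b - 0| ≤ K := by
    rw [hb]
    exact abs_deriv_sub_le_of_isLocalMin (hφ.hasDerivAt_snd_slice t0 x0)
      (h := fun y => u (t0, y)) (Eventually.of_forall fun y => by
        simpa using hu.lip_space t0 y x0 ht0.le) hm.snd_slice
  have haC : |a - 0| ≤ C := by
    rw [ha]
    refine abs_deriv_sub_le_of_isLocalMin (hφ.hasDerivAt_fst_slice t0 x0)
      (h := fun s => u (s, x0)) ?_ hm.fst_slice
    filter_upwards [lt_mem_nhds ht0] with s hs
    simpa using htime s t0 x0 hs.le ht0.le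
  rw [sub_zero] at hbK haC
  -- At slope ±K the tested expression would be at least -C + G(±K) + W > 0, since the time slope is
  -- at least -C.
  have hbK' : |b| < K := by
    refine lt_of_le_of_ne hbK fun heq => ?_
    have h1 := (abs_le.1 haC).1
    rcases abs_choice b with h | h
    · have := (hK x0).1
      rw [← heq, h] at this; linarith
    · have := (hK x0).2
      rw [← heq, h, neg_neg] at this; linarith
  -- room for the gradients
  have hcont : Continuous fun q : (ℝ × ℝ) × ℝ => q.1.1 + (G q.1.2 + W q.2) := by fun_prop
  have hev := (hcont.continuousAt (x := ((a, b), x0))).eventually (gt_mem_nhds hneg)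
  obtain ⟨κ0, hκ0, hev⟩ := Metric.eventually_nhds_iff_ball.1 hev
  obtain ⟨κ, hκ, hκ1, hκ2⟩ : ∃ κ, 0 < κ ∧ κ < κ0 ∧ |b| + κ ≤ K :=
    ⟨min (κ0 / 2) (K - |b|), lt_min (by positivity) (by linarith), by
      have := min_le_left (κ0 / 2) (K - |b|); linarith, by
      have := min_le_right (κ0 / 2) (K - |b|); linarith⟩
  have hgrad : ∀ a' b' x, |a' - a| ≤ κ → |b' - b| ≤ κ → |x - x0| < κ0 →
      a' + (G b' + W x) ≤ 0 := by
    intro a' b' x h1 h2 h3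
    have := hev ((a', b'), x) (by
      rw [Metric.mem_ball, Prod.dist_eq, Prod.dist_eq]
      simp only [max_lt_iff, Real.dist_eq]
      exact ⟨⟨by linarith, by linarith⟩, h3⟩)
    exact this.le
  -- the neighbourhood
  obtain ⟨η1, hη1⟩ : ∃ η1, η1 = (g x0 + C * t0 - u (t0, x0)) / 2 := ⟨_, rfl⟩
  have hη1pos : 0 < η1 := by rw [hη1]; linarith
  have hc2 : Continuous fun z : ℝ × ℝ => g z.2 + C * z.1 - (a * (z.1 - t0) + b * (z.2 - x0)) := by
    fun_prop
  have hev2 := (hc2.continuousAt (x := (t0, x0))).eventually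
    (lt_mem_nhds (a := u (t0, x0) + η1) (by simp only [sub_self]; linarith))
  have hev3 := eventually_linear_le_of_isLocalMin hφ hm (half_pos hκ)
  rw [← ha, ← hb] at hev3
  obtain ⟨r1, hr1, hnear⟩ := Metric.eventually_nhds_iff_ball.1
    ((hev2.and hev3).and (eventually_pos_fst ht0))
  obtain ⟨r, hr, hrr1, hrκ⟩ : ∃ r, 0 < r ∧ r ≤ r1 ∧ r ≤ κ0 :=
    ⟨min r1 κ0, by positivity, min_le_left _ _, min_le_right _ _⟩
  have hbox : ∀ t x, |t - t0| < r → |x - x0| < r →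
      u (t0, x0) + η1 < g x + C * t - (a * (t - t0) + b * (x - x0)) ∧
      u (t0, x0) + a * (t - t0) + b * (x - x0) - κ / 2 * (|t - t0| + |x - x0|) ≤ u (t, x) ∧
      0 < t := by
    intro t x h1 h2
    have := hnear (t, x) (by
      rw [Metric.mem_ball, Prod.dist_eq]
      simp only [max_lt_iff, Real.dist_eq]
      exact ⟨by linarith, by linarith⟩)
    exact ⟨this.1.1, this.1.2, this.2⟩
  -- The bound η ≤ η1 keeps the cone below the upper barrier. The bound η ≤ (κ/2)(r/2) puts it below
  -- u once |t - t0| + |x - x0| ≥ r/2, because u loses only κ/2 per unit against its linear part and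
  -- the cone loses κ.
  obtain ⟨η, hη, hη2, hη3⟩ : ∃ η, 0 < η ∧ η ≤ η1 ∧ η ≤ κ / 2 * (r / 2) :=
    ⟨min η1 (κ / 2 * (r / 2)), by positivity, min_le_left _ _, min_le_right _ _⟩
  obtain ⟨ψ, hψ⟩ : ∃ ψ : ℝ × ℝ → ℝ, ∀ t x, ψ (t, x) = u (t0, x0) + η + a * (t - t0) +
      b * (x - x0) - κ * (|t - t0| + |x - x0|) :=
    ⟨fun z => u (t0, x0) + η + a * (z.1 - t0) + b * (z.2 - x0) -
      κ * (|z.1 - t0| + |z.2 - x0|), fun _ _ => rfl⟩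
  have hψu : ∀ t x, |t - t0| < r → |x - x0| < r → r / 2 ≤ |t - t0| + |x - x0| →
      ψ (t, x) ≤ u (t, x) := by
    intro t x h1 h2 h3
    have := (hbox t x h1 h2).2.1
    rw [hψ]
    have : κ / 2 * (r / 2) ≤ κ / 2 * (|t - t0| + |x - x0|) := by gcongr
    linarith
  have hψt : ∀ t s x, |ψ (s, x) - ψ (t, x) - a * (s - t)| ≤ κ * |s - t| := by
    intro t s x
    rw [hψ, hψ]
    have e : u (t0, x0) + η + a * (s - t0) + b * (x - x0) - κ * (|s - t0| + |x - x0|) -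
      (u (t0, x0) + η + a * (t - t0) + b * (x - x0) - κ * (|t - t0| + |x - x0|)) -
      a * (s - t) = κ * (|t - t0| - |s - t0|) := by ring
    rw [e, abs_mul, abs_of_pos hκ]
    refine mul_le_mul_of_nonneg_left ?_ hκ.le
    refine (abs_abs_sub_abs_le _ _).trans ?_
    rw [abs_sub_comm]; simp
  have hψx : ∀ t x y, |ψ (t, y) - ψ (t, x) - b * (y - x)| ≤ κ * |y - x| := by
    intro t x y
    rw [hψ, hψ]
    have e : u (t0, x0) + η + a * (t - t0) + b * (y - x0) - κ * (|t - t0| + |y - x0|) -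
      (u (t0, x0) + η + a * (t - t0) + b * (x - x0) - κ * (|t - t0| + |x - x0|)) -
      b * (y - x) = κ * (|x - x0| - |y - x0|) := by ring
    rw [e, abs_mul, abs_of_pos hκ]
    refine mul_le_mul_of_nonneg_left ?_ hκ.le
    refine (abs_abs_sub_abs_le _ _).trans ?_
    rw [abs_sub_comm]; simp
  classical
  obtain ⟨w, hw⟩ : ∃ w : ℝ × ℝ → ℝ, ∀ t x, w (t, x) =
      if |t - t0| < r ∧ |x - x0| < r then max (u (t, x)) (ψ (t, x)) else u (t, x) :=
    ⟨fun z => if |z.1 - t0| < r ∧ |z.2 - x0| < r then max (u z) (ψ z) else u z, fun _ _ => rfl⟩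
  have huw : ∀ t x, u (t, x) ≤ w (t, x) := by
    intro t x; rw [hw]; split_ifs
    · exact le_max_left _ _
    · exact le_rfl
  have hwu : ∀ t x, r / 2 ≤ |t - t0| + |x - x0| → w (t, x) = u (t, x) := by
    intro t x h; rw [hw]; split_ifs with h'
    · exact max_eq_left (hψu t x h'.1 h'.2 h)
    · rfl
  have hbox_open : ∀ t x, |t - t0| < r → |x - x0| < r → ∀ᶠ z : ℝ × ℝ in 𝓝 (t, x),
      |z.1 - t0| < r ∧ |z.2 - x0| < r := by
    intro t x h1 h2
    have c1 : Continuous fun z : ℝ × ℝ => |z.1 - t0| := by fun_prop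
    have c2 : Continuous fun z : ℝ × ℝ => |z.2 - x0| := by fun_prop
    exact (c1.continuousAt.eventually (gt_mem_nhds h1)).and
      (c2.continuousAt.eventually (gt_mem_nhds h2))
  have hwclass : PerronClass G W g C K w := by
    refine ⟨?_, ?_, ⟨C + |a| + κ, by positivity, ?_⟩, fun t x ht => (hu.lower t x ht).trans
      (huw t x), ?_⟩
    · intro χ hχ t x ht hmx
      by_cases hcase : (|t - t0| < r ∧ |x - x0| < r) ∧ u (t, x) < ψ (t, x)
      · obtain ⟨⟨h1, h2⟩, h3⟩ := hcase
        have hwψ : w (t, x) = ψ (t, x) := by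
          rw [hw, if_pos ⟨h1, h2⟩, max_eq_right h3.le]
        have hloc : IsLocalMax (fun z => ψ z - χ z) (t, x) := by
          filter_upwards [hmx, hbox_open t x h1 h2] with z hz1 hz2
          have : ψ z ≤ w z := by
            have := hw z.1 z.2
            rw [if_pos hz2] at this
            rw [← Prod.mk.eta (p := z), this]; exact le_max_right _ _
          rw [hwψ] at hz1
          linarith
        obtain ⟨g1, g2⟩ := test_gradient_of_isLocalMax hχ
          (Eventually.of_forall fun s => hψt t s x) (Eventually.of_forall fun y => hψx t x y) hloc
        exact hgrad _ _ _ g1 g2 (by linarith)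
      · have hwu' : w (t, x) = u (t, x) := by
          rw [hw]
          split_ifs with h
          · exact max_eq_left (not_lt.1 fun h' => hcase ⟨h, h'⟩)
          · rfl
        refine hu.subsol χ hχ t x ht ?_
        filter_upwards [hmx] with z hz
        have := huw z.1 z.2
        simp only [Prod.mk.eta] at this
        rw [hwu'] at hz
        linarith
    · intro t x y ht
      rcases lt_or_ge |t - t0| r with htr | htr
      · refine lipschitz_glue convex_univ (u := fun x => u (t, x)) (w := fun x => w (t, x))
          (K := K) (x0 := x0) (r := r) (ρ := r / 2) (by linarith)
          (fun x _ y _ => hu.lip_space t x y ht) ?_ (fun x _ h => hwu t x ?_) x trivial y trivial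
        · intro x _ y _ h1 h2
          simp only [hw, htr, h1, h2, and_self, if_true]
          refine abs_max_sub_max_le (hu.lip_space t x y ht) ?_
          have e1 := hψx t y x
          have e2 := abs_add_le (ψ (t, x) - ψ (t, y) - b * (x - y)) (b * (x - y))
          rw [sub_add_cancel, abs_mul] at e2
          have : (|b| + κ) * |x - y| ≤ K * |x - y| := by gcongr
          linarith
        · have := abs_nonneg (t - t0); linarith
      · have : ∀ x, w (t, x) = u (t, x) := fun x => by
          rw [hw, if_neg]; exact fun h => absurd h.1 (not_lt.2 htr)
        rw [this, this]; exact hu.lip_space t x y ht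
    · intro t s x ht hs
      have hCle : ∀ t s : ℝ, C * |t - s| ≤ (C + |a| + κ) * |t - s| := fun t s => by
        gcongr; linarith [abs_nonneg a]
      rcases lt_or_ge |x - x0| r with hxr | hxr
      · refine lipschitz_glue (convex_Ici 0) (u := fun t => u (t, x)) (w := fun t => w (t, x))
          (K := C + |a| + κ) (x0 := t0) (r := r) (ρ := r / 2) (by linarith)
          (fun t ht s hs => (htime t s x ht hs).trans (hCle t s)) ?_ (fun t _ h => hwu t x ?_)
          t ht s hs
        · intro t ht s hs h1 h2
          simp only [hw, hxr, h1, h2, and_self, if_true]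
          refine abs_max_sub_max_le ((htime t s x ht hs).trans (hCle t s)) ?_
          have e1 := hψt s t x
          have e2 := abs_add_le (ψ (t, x) - ψ (s, x) - a * (t - s)) (a * (t - s))
          rw [sub_add_cancel, abs_mul] at e2
          have : 0 ≤ C * |t - s| := by positivity
          linarith
        · have := abs_nonneg (x - x0); linarith
      · have : ∀ t, w (t, x) = u (t, x) := fun t => by
          rw [hw, if_neg]; exact fun h => absurd h.2 (not_lt.2 hxr)
        rw [this, this]; exact (htime t s x ht hs).trans (hCle t s)
    · intro t x ht
      rw [hw]
      split_ifs with h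
      · refine max_le (hu.upper t x ht) ?_
        have h1 := (hbox t x h.1 h.2).1
        have : 0 ≤ κ * (|t - t0| + |x - x0|) := by positivity
        rw [hψ]
        linarith
      · exact hu.upper t x ht
  have h1 := hmaxl w hwclass t0 x0 ht0.le
  rw [hw, if_pos (by simp [hr]), max_le_iff, hψ] at h1
  have := h1.2
  simp only [sub_self, abs_zero, add_zero, mul_zero, sub_zero] at this
  linarith

end Perron

/-! ### Well-posedness for uniformly continuous initial data -/

/-- Moving averages over an interval of length d < δ: their derivative (g(x+d) - g(x))/d is at most
η/d in modulus, and each average is a value of g at a point within d of x. -/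
theorem exists_lipschitz_approx {g : ℝ → ℝ} (hg : UniformContinuous g) {η : ℝ} (hη : 0 < η) :
    ∃ (g' : ℝ → ℝ) (L : ℝ), 0 ≤ L ∧ (∀ x y, |g' x - g' y| ≤ L * |x - y|) ∧
      ∀ x, |g' x - g x| ≤ η := by
  obtain ⟨δ, hδ, h⟩ := Metric.uniformContinuous_iff.1 hg η hη
  have hc := hg.continuous
  obtain ⟨I, hI⟩ : ∃ I : ℝ → ℝ, ∀ x, HasDerivAt I (g x) x :=
    ⟨fun x => ∫ t in (0 : ℝ)..x, g t, fun x =>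
      intervalIntegral.integral_hasDerivAt_right (hc.intervalIntegrable _ _)
        (hc.stronglyMeasurableAtFilter _ _) hc.continuousAt⟩
  have hδ2 : 0 < δ / 2 := by positivity
  obtain ⟨d, hd, hd2, hd3⟩ : ∃ d, 0 < d ∧ d < δ ∧ d = δ / 2 := ⟨δ / 2, by positivity, by linarith, rfl⟩
  have hder : ∀ x, HasDerivAt (fun x => (I (x + d) - I x) / d) ((g (x + d) - g x) / d) x := by
    intro x
    exact (((hI (x + d)).comp_add_const x d).sub (hI x)).div_const d
  refine ⟨fun x => (I (x + d) - I x) / d, η / d, by positivity, ?_, ?_⟩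
  · intro x y
    have := Convex.norm_image_sub_le_of_norm_hasDerivWithin_le (s := univ) (x := y) (y := x)
      (C := η / d) (fun x _ => (hder x).hasDerivWithinAt) (fun x _ => ?_) convex_univ trivial trivial
    · simpa using this
    · rw [Real.norm_eq_abs, abs_div, abs_of_pos hd]
      gcongr
      have := h (a := x + d) (b := x) (by simp [abs_of_pos hd, hd2])
      rw [Real.dist_eq] at this
      exact this.le
  · intro x
    obtain ⟨c, hc1, hc2⟩ := exists_hasDerivAt_eq_slope I g (a := x) (b := x + d) (by linarith)
      (fun y _ => (hI y).continuousAt.continuousWithinAt) (fun y _ => hI y)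
    rw [add_sub_cancel_left] at hc2
    simp only
    rw [← hc2]
    have := h (a := c) (b := x) (by
      rw [Real.dist_eq, abs_lt]; constructor <;> linarith [hc1.1, hc1.2])
    rw [Real.dist_eq] at this
    exact this.le

theorem IsContinuousCoercive.exists_large {G : ℝ → ℝ} (hG : IsContinuousCoercive G) (L c : ℝ) :
    ∃ K, L ≤ K ∧ c < G K ∧ c < G (-K) := by
  have h1 := hG.tendsto_atTop.eventually (eventually_gt_atTop c)
  have h2 := (hG.tendsto_atBot.comp tendsto_neg_atTop_atBot).eventually (eventually_gt_atTop c)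
  obtain ⟨K, hK⟩ := ((h1.and h2).and (eventually_ge_atTop L)).exists
  exact ⟨K, hK.2, hK.1.1, hK.1.2⟩

/-- Equi-Lipschitz solutions for Lipschitz initial data. -/
theorem exists_lipschitz_solution {G g : ℝ → ℝ} (hG : IsContinuousCoercive G) {L : ℝ} (hL : 0 ≤ L)
    (hg : ∀ x y, |g x - g y| ≤ L * |x - y|) {B : ℝ} (hB : 0 ≤ B) :
    ∃ C K, 0 ≤ C ∧ 0 ≤ K ∧ ∀ W : ℝ → ℝ, UniformContinuous W → (∀ x, |W x| ≤ B) →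
      ∃ u, IsViscositySolution (fun p x => G p + W x) g u ∧
        (∀ t s x y, 0 ≤ t → 0 ≤ s → |u (t, x) - u (s, y)| ≤ C * |t - s| + K * |x - y|) := by
  obtain ⟨A, hA⟩ := (isCompact_Icc (a := -L) (b := L)).exists_bound_of_continuousOn
    hG.continuous.continuousOn
  have hA0 : 0 ≤ A := (norm_nonneg _).trans (hA 0 (by simp [hL]))
  -- A + B bounds |G + W| for slopes up to L; the second B makes G(±K) + W exceed this for every
  -- potential bounded by B. Hence C and K do not depend on W.
  obtain ⟨K, hLK, hK1, hK2⟩ := hG.exists_large L (A + B + B)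
  refine ⟨A + B, K, by positivity, hL.trans hLK, fun W hW hWB => ?_⟩
  have hC : ∀ p x, |p| ≤ L → |G p + W x| ≤ A + B := fun p x hp =>
    (abs_add_le _ _).trans (add_le_add (hA p (abs_le.1 hp)) (hWB x))
  have hK : ∀ x, A + B < G K + W x ∧ A + B < G (-K) + W x := fun x => by
    have := (abs_le.1 (hWB x)).1
    constructor <;> linarith
  obtain ⟨h1, h2⟩ := perronClass_perronSup hG.continuous hW.continuous hL hLK (by positivity) hg hC
  exact ⟨_, ⟨h1.uniformContinuousOn (hL.trans hLK), h1.initial, h1.subsol,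
    isSupersol_perronSup hG.continuous hW.continuous hL hLK (by positivity) hg hC hK⟩,
    lipschitz_pair h1.lip_space h2⟩

theorem IsViscositySolution.le_add {G W g g' : ℝ → ℝ} (hG : Continuous G)
    (hW : UniformContinuous W) {u v : ℝ × ℝ → ℝ}
    (hu : IsViscositySolution (fun p x => G p + W x) g u)
    (hv : IsViscositySolution (fun p x => G p + W x) g' v) {c : ℝ} (h : ∀ x, g x ≤ g' x + c) :
    ∀ z ∈ Ici (0 : ℝ) ×ˢ (univ : Set ℝ), u z ≤ v z + c := by
  intro z hz
  have hsup : IsSupersol G W v := hv.supersolution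
  exact IsSubsol.le_of_initial_le hG hW (v := fun z => v z + c) hu.uniformContinuousOn
    ((uniformContinuous_id.add uniformContinuous_const).comp_uniformContinuousOn
      hv.uniformContinuousOn) hu.subsolution
    (hsup.add_const c)
    (fun x => by rw [hu.initial, hv.initial]; exact h x) z.1 z.2 hz.1

theorem IsViscositySolution.abs_sub_le {G W g g' : ℝ → ℝ} (hG : Continuous G)
    (hW : UniformContinuous W) {u v : ℝ × ℝ → ℝ}
    (hu : IsViscositySolution (fun p x => G p + W x) g u)
    (hv : IsViscositySolution (fun p x => G p + W x) g' v) {c : ℝ} (h : ∀ x, |g x - g' x| ≤ c) :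
    ∀ z ∈ Ici (0 : ℝ) ×ˢ (univ : Set ℝ), |u z - v z| ≤ c := by
  intro z hz
  have h1 := hu.le_add hG hW hv (c := c) (fun x => by linarith [(abs_le.1 (h x)).2]) z hz
  have h2 := hv.le_add hG hW hu (c := c) (fun x => by linarith [(abs_le.1 (h x)).1]) z hz
  rw [abs_le]; constructor <;> linarith

theorem uniformContinuousOn_of_uniform_approx {s : Set (ℝ × ℝ)} {u : ℝ × ℝ → ℝ}
    (h : ∀ η > 0, ∃ w : ℝ × ℝ → ℝ, UniformContinuousOn w s ∧ ∀ z ∈ s, |u z - w z| ≤ η) :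
    UniformContinuousOn u s := by
  rw [Metric.uniformContinuousOn_iff]
  intro ε hε
  obtain ⟨w, hw, hwu⟩ := h (ε / 4) (by positivity)
  obtain ⟨δ, hδ, hd⟩ := Metric.uniformContinuousOn_iff.1 hw (ε / 4) (by positivity)
  refine ⟨δ, hδ, fun z hz y hy hzy => ?_⟩
  have h1 := hd z hz y hy hzy
  have h2 := hwu z hz
  have h3 := hwu y hy
  rw [Real.dist_eq, abs_lt] at *
  rw [abs_le] at h2 h3
  constructor <;> linarith [h1.1, h1.2, h2.1, h2.2, h3.1, h3.2]

theorem IsSubsol.of_uniform_approx {G W : ℝ → ℝ} (hG : Continuous G) (hW : Continuous W)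
    {u : ℝ × ℝ → ℝ}
    (h : ∀ η > 0, ∃ w : ℝ × ℝ → ℝ, IsSubsol G W w ∧ ContinuousOn w (Ici 0 ×ˢ univ) ∧
      ∀ z ∈ Ici (0 : ℝ) ×ˢ (univ : Set ℝ), |u z - w z| ≤ η) : IsSubsol G W u := by
  refine IsSubsol.of_approx hG hW fun t x ht => ⟨t, ht, fun η hη => ?_⟩
  obtain ⟨w, hw, hwc, hwu⟩ := h η hη
  refine ⟨w, hw, hwc, fun z hz => ?_, ?_⟩
  · have := (abs_le.1 (hwu z (closedBall_subset_of_lt le_rfl hz))).1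
    linarith
  · have := (abs_le.1 (hwu (t, x) ⟨ht.le, trivial⟩)).2
    linarith

theorem IsSupersol.of_uniform_approx {G W : ℝ → ℝ} (hG : Continuous G) (hW : Continuous W)
    {u : ℝ × ℝ → ℝ}
    (h : ∀ η > 0, ∃ w : ℝ × ℝ → ℝ, IsSupersol G W w ∧ ContinuousOn w (Ici 0 ×ˢ univ) ∧
      ∀ z ∈ Ici (0 : ℝ) ×ˢ (univ : Set ℝ), |u z - w z| ≤ η) : IsSupersol G W u := by
  refine isSubsol_neg_iff.1 (IsSubsol.of_uniform_approx (by fun_prop) (by fun_prop) fun η hη => ?_)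
  obtain ⟨w, hw, hwc, hwu⟩ := h η hη
  refine ⟨fun z => -w z, isSubsol_neg_iff.2 hw, hwc.neg, fun z hz => ?_⟩
  rw [← abs_neg]; convert hwu z hz using 2; ring

/-- Well-posedness of the Cauchy problem in the class of uniformly continuous functions. -/
theorem exists_isUniqueViscositySolution {G W g : ℝ → ℝ} (hG : IsContinuousCoercive G)
    (hW : UniformContinuous W) {B : ℝ} (hWB : ∀ x, |W x| ≤ B) (hg : UniformContinuous g) :
    ∃ u, IsUniqueViscositySolution (fun p x => G p + W x) g u := by
  have hB : 0 ≤ B := (abs_nonneg _).trans (hWB 0)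
  have hη : ∀ n : ℕ, (0 : ℝ) < 1 / (n + 1) := fun n => Nat.one_div_pos_of_nat
  have hex : ∀ n : ℕ, ∃ (g' : ℝ → ℝ) (u : ℝ × ℝ → ℝ), (∀ x, |g' x - g x| ≤ 1 / (n + 1)) ∧
      IsViscositySolution (fun p x => G p + W x) g' u := by
    intro n
    obtain ⟨g', L, hL, hg', hgg⟩ := exists_lipschitz_approx hg (hη n)
    obtain ⟨C, K, -, -, h⟩ := exists_lipschitz_solution hG hL hg' hB
    obtain ⟨u, hu, -⟩ := h W hW hWB
    exact ⟨g', u, hgg, hu⟩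
  choose g' u' hgg hu' using hex
  have hcmp : ∀ m n z, z ∈ Ici (0 : ℝ) ×ˢ (univ : Set ℝ) →
      u' m z - 1 / (m + 1) ≤ u' n z + 1 / (n + 1) := by
    intro m n z hz
    have := (hu' m).le_add hG.continuous hW (hu' n) (c := 1 / (m + 1) + 1 / (n + 1)) (fun x => by
      have h1 := (abs_le.1 (hgg m x)).2
      have h2 := (abs_le.1 (hgg n x)).1
      linarith) z hz
    linarith
  -- By comparison two approximations differ by at most 1/(m+1) + 1/(n+1), so this supremum is their
  -- uniform limit.
  obtain ⟨u, hu⟩ : ∃ u : ℝ × ℝ → ℝ, ∀ z, u z = ⨆ n : ℕ, (u' n z - 1 / ((n : ℝ) + 1)) :=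
    ⟨_, fun _ => rfl⟩
  have happ : ∀ n, ∀ z ∈ Ici (0 : ℝ) ×ˢ (univ : Set ℝ), |u z - u' n z| ≤ 1 / ((n : ℝ) + 1) := by
    intro n z hz
    have h1 : u z ≤ u' n z + 1 / ((n : ℝ) + 1) := by
      rw [hu]; exact ciSup_le fun m => hcmp m n z hz
    have h2 : u' n z - 1 / ((n : ℝ) + 1) ≤ u z := by
      rw [hu]
      exact le_ciSup (f := fun n : ℕ => u' n z - 1 / ((n : ℝ) + 1))
        ⟨u' 0 z + 1 / ((0 : ℕ) + 1), by rintro _ ⟨m, rfl⟩; exact hcmp m 0 z hz⟩ n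
    rw [abs_le]; constructor <;> linarith
  have hsol : IsViscositySolution (fun p x => G p + W x) g u := by
    refine ⟨uniformContinuousOn_of_uniform_approx fun η hη => ?_, fun x => ?_,
      IsSubsol.of_uniform_approx hG.continuous hW.continuous fun η hη => ?_,
      IsSupersol.of_uniform_approx hG.continuous hW.continuous fun η hη => ?_⟩
    · obtain ⟨n, hn⟩ := exists_nat_one_div_lt hη
      exact ⟨u' n, (hu' n).uniformContinuousOn, fun z hz => (happ n z hz).trans hn.le⟩
    · refine tendsto_nhds_unique (f := fun n : ℕ => u' n (0, x)) (l := atTop) ?_ ?_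
      · rw [tendsto_iff_dist_tendsto_zero]
        refine squeeze_zero (fun _ => dist_nonneg) (fun n => ?_) tendsto_one_div_add_atTop_nhds_zero_nat
        rw [dist_comm, Real.dist_eq]; exact happ n (0, x) ⟨self_mem_Ici, trivial⟩
      · rw [tendsto_iff_dist_tendsto_zero]
        refine squeeze_zero (fun _ => dist_nonneg) (fun n => ?_) tendsto_one_div_add_atTop_nhds_zero_nat
        rw [Real.dist_eq, (hu' n).initial]; exact hgg n x
    · obtain ⟨n, hn⟩ := exists_nat_one_div_lt hη
      exact ⟨u' n, (hu' n).subsolution, (hu' n).uniformContinuousOn.continuousOn,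
        fun z hz => (happ n z hz).trans hn.le⟩
    · obtain ⟨n, hn⟩ := exists_nat_one_div_lt hη
      exact ⟨u' n, (hu' n).supersolution, (hu' n).uniformContinuousOn.continuousOn,
        fun z hz => (happ n z hz).trans hn.le⟩
  refine ⟨u, hsol, fun v hv z hz => ?_⟩
  have := hv.abs_sub_le hG.continuous hW hsol (c := 0) (by simp) z hz
  linarith [abs_eq_zero.1 (le_antisymm this (abs_nonneg _))]

/-- Solutions with the same initial condition are equicontinuous and locally bounded, uniformly
over bounded potentials. -/
theorem exists_equicontinuity {G g : ℝ → ℝ} (hG : IsContinuousCoercive G)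
    (hg : UniformContinuous g) {B : ℝ} (hB : 0 ≤ B) {η : ℝ} (hη : 0 < η) :
    ∃ C K, 0 ≤ C ∧ 0 ≤ K ∧ ∀ W : ℝ → ℝ, UniformContinuous W → (∀ x, |W x| ≤ B) →
      ∀ u, IsViscositySolution (fun p x => G p + W x) g u →
      ∀ t s x y, 0 ≤ t → 0 ≤ s → |u (t, x) - u (s, y)| ≤ C * |t - s| + K * |x - y| + η := by
  obtain ⟨g', L, hL, hg', hgg⟩ := exists_lipschitz_approx hg (half_pos hη)
  obtain ⟨C, K, hC, hK, h⟩ := exists_lipschitz_solution hG hL hg' hB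
  refine ⟨C, K, hC, hK, fun W hW hWB u hu t s x y ht hs => ?_⟩
  obtain ⟨w, hw, hwl⟩ := h W hW hWB
  have h1 := hu.abs_sub_le hG.continuous hW hw (fun x => by rw [abs_sub_comm]; exact hgg x)
  have e1 := abs_le.1 (h1 (t, x) ⟨ht, trivial⟩)
  have e2 := abs_le.1 (h1 (s, y) ⟨hs, trivial⟩)
  have e3 := abs_le.1 (hwl t s x y ht hs)
  rw [abs_le]
  constructor <;> linarith [e1.1, e1.2, e2.1, e2.2, e3.1, e3.2]

/-! ### Super- and subcorrectors -/

/-- `K`-Lipschitz functions with one-sided derivatives which are supersolutions of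
`G(F') + W = c`. -/
structure IsSupercorrector (G W F : ℝ → ℝ) (K c : ℝ) : Prop where
  lip : ∀ x y, |F x - F y| ≤ K * |x - y|
  super : ∀ y, ∃ l r, HasDerivWithinAt F l (Iio y) y ∧ HasDerivWithinAt F r (Ioi y) y ∧
    ∀ q, l ≤ q → q ≤ r → c ≤ G q + W y

/-- `K`-Lipschitz functions with one-sided derivatives which are subsolutions of
`G(F') + W = c`. -/
structure IsSubcorrector (G W F : ℝ → ℝ) (K c : ℝ) : Prop where
  lip : ∀ x y, |F x - F y| ≤ K * |x - y|
  sub : ∀ y, ∃ l r, HasDerivWithinAt F l (Iio y) y ∧ HasDerivWithinAt F r (Ioi y) y ∧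
    ∀ q, r ≤ q → q ≤ l → G q + W y ≤ c

theorem IsSubcorrector.neg {G W F : ℝ → ℝ} {K c : ℝ} (h : IsSubcorrector G W F K c) :
    IsSupercorrector (fun p => -G (-p)) (fun x => -W x) (fun x => -F x) K (-c) where
  lip x y := by rw [← abs_neg]; convert h.lip x y using 2; ring
  super y := by
    obtain ⟨l, r, hl, hr, hq⟩ := h.sub y
    refine ⟨-l, -r, hl.neg, hr.neg, fun q h1 h2 => ?_⟩
    have := hq (-q) (by linarith) (by linarith)
    linarith

/-- Comparison of a subsolution with a moving supercorrector near a point. -/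
theorem IsSubsol.speed_le_of_supercorrector {G W : ℝ → ℝ} (hW : Continuous W)
    {u : ℝ × ℝ → ℝ} (hsub : IsSubsol G W u) (hu : ContinuousOn u (Ici 0 ×ˢ univ)) {F : ℝ → ℝ}
    {K c : ℝ} (hK : 0 ≤ K) (hF : IsSupercorrector G W F K c) {t0 x0 r a κ μ η : ℝ} (hr : 0 < r)
    (hrt : r ≤ t0) (hκ : 0 ≤ κ) (hμ : 0 < μ)
    (hbd : ∀ t x, |t - t0| ≤ r → |x - x0| ≤ r → (r ≤ |t - t0| ∨ r ≤ |x - x0|) →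
      u (t, x) - a * (t - t0) - (F x - F x0) - κ / r * ((t - t0) ^ 2 + (x - x0) ^ 2) ≤
        u (t0, x0) - μ)
    (hη : ∀ p d, |p| ≤ 2 * K → |d| ≤ 2 * κ → |G (p + d) - G p| ≤ η) : a + c ≤ 2 * κ + η := by
  refine le_of_forall_pos_le_add fun ω hω => ?_
  have hWu := (isCompact_Icc (a := x0 - 2 * r) (b := x0 + 2 * r)).uniformContinuousOn_of_continuous
    hW.continuousOn
  obtain ⟨d0, hd0, hWd⟩ := Metric.uniformContinuousOn_iff.1 hWu ω hω
  -- The doubled points will be at distance at most Kσ. The conditions keep y inside the larger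
  -- interval, make K²σ smaller than the boundary drop μ, and make the variation of W smaller than
  -- ω.
  obtain ⟨σ, hσ, hσ1, hσ2, hσ3⟩ : ∃ σ, 0 < σ ∧ (K + 1) * σ < r ∧ (K + 1) ^ 2 * σ < μ ∧
      (K + 1) * σ < d0 := by
    have hpos : 0 < min r (min μ d0) := by positivity
    have h1 : min r (min μ d0) ≤ r := min_le_left _ _
    have h2 : min r (min μ d0) ≤ μ := (min_le_right _ _).trans (min_le_left _ _)
    have h3 : min r (min μ d0) ≤ d0 := (min_le_right _ _).trans (min_le_right _ _)
    have hq : (K + 1) ^ 2 * (min r (min μ d0) / (2 * (K + 1) ^ 2)) = min r (min μ d0) / 2 := by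
      field_simp
    have hσ0 : 0 < min r (min μ d0) / (2 * (K + 1) ^ 2) := by positivity
    have hle : (K + 1) * (min r (min μ d0) / (2 * (K + 1) ^ 2)) ≤
        (K + 1) ^ 2 * (min r (min μ d0) / (2 * (K + 1) ^ 2)) := by
      gcongr; nlinarith
    refine ⟨_, hσ0, ?_, ?_, ?_⟩ <;> linarith
  obtain ⟨Ψ, hΨ⟩ : ∃ Ψ : ℝ × ℝ × ℝ → ℝ, ∀ t x y, Ψ (t, x, y) = u (t, x) - a * (t - t0) -
      (F y - F x0) - κ / r * ((t - t0) ^ 2 + (x - x0) ^ 2) - (x - y) ^ 2 / σ :=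
    ⟨fun z => u (z.1, z.2.1) - a * (z.1 - t0) - (F z.2.2 - F x0) -
      κ / r * ((z.1 - t0) ^ 2 + (z.2.1 - x0) ^ 2) - (z.2.1 - z.2.2) ^ 2 / σ, fun _ _ _ => rfl⟩
  have hFc : Continuous F := by
    have : LipschitzWith K.toNNReal F := LipschitzWith.of_dist_le_mul fun x y => by
      rw [Real.coe_toNNReal _ hK, Real.dist_eq, Real.dist_eq]; exact hF.lip x y
    exact this.continuous
  have hcomp : IsCompact (Icc (t0 - r) (t0 + r) ×ˢ Icc (x0 - r) (x0 + r) ×ˢ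
      Icc (x0 - 2 * r) (x0 + 2 * r)) :=
    isCompact_Icc.prod (isCompact_Icc.prod isCompact_Icc)
  have hcont : ContinuousOn Ψ (Icc (t0 - r) (t0 + r) ×ˢ Icc (x0 - r) (x0 + r) ×ˢ
      Icc (x0 - 2 * r) (x0 + 2 * r)) := by
    have h1 : ContinuousOn (fun z : ℝ × ℝ × ℝ => u (z.1, z.2.1))
        (Icc (t0 - r) (t0 + r) ×ˢ Icc (x0 - r) (x0 + r) ×ˢ Icc (x0 - 2 * r) (x0 + 2 * r)) :=
      hu.comp (by fun_prop) (fun z hz => ⟨by have := hz.1.1; simp only [mem_Ici]; linarith, trivial⟩)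
    have h2 : Continuous fun z : ℝ × ℝ × ℝ => a * (z.1 - t0) + (F z.2.2 - F x0) +
      κ / r * ((z.1 - t0) ^ 2 + (z.2.1 - x0) ^ 2) + (z.2.1 - z.2.2) ^ 2 / σ := by fun_prop
    refine (h1.sub h2.continuousOn).congr fun z _ => ?_
    rw [← Prod.mk.eta (p := z), ← Prod.mk.eta (p := z.2), hΨ]
    simp only [Pi.sub_apply]; ring
  have hmem : ∀ t x y, |t - t0| ≤ r → |x - x0| ≤ r → |y - x0| ≤ 2 * r →
      (t, x, y) ∈ Icc (t0 - r) (t0 + r) ×ˢ Icc (x0 - r) (x0 + r) ×ˢ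
      Icc (x0 - 2 * r) (x0 + 2 * r) := by
    intro t x y h1 h2 h3
    rw [abs_le] at h1 h2 h3
    refine ⟨⟨?_, ?_⟩, ⟨?_, ?_⟩, ?_, ?_⟩ <;> simp only <;> linarith
  obtain ⟨⟨t1, x1, y1⟩, hz1, hmax⟩ := hcomp.exists_isMaxOn
    ⟨_, hmem t0 x0 x0 (by simp [hr.le]) (by simp [hr.le]) (by simp [hr.le])⟩ hcont
  have hglob : ∀ t x y, |t - t0| ≤ r → |x - x0| ≤ r → |y - x0| ≤ 2 * r →
      Ψ (t, x, y) ≤ Ψ (t1, x1, y1) := fun t x y h1 h2 h3 =>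
    isMaxOn_iff.1 hmax _ (hmem t x y h1 h2 h3)
  have ht1 : |t1 - t0| ≤ r := by
    rw [abs_le]; have := hz1.1; constructor <;> linarith [this.1, this.2]
  have hx1 : |x1 - x0| ≤ r := by
    rw [abs_le]; have := hz1.2.1; constructor <;> linarith [this.1, this.2]
  -- Comparison with the competitor y = x1. It yields |p| ≤ 2K whatever the value of σ.
  have hxy : |x1 - y1| ≤ K * σ := by
    have h := hglob t1 x1 x1 ht1 hx1 (by linarith)
    rw [hΨ, hΨ] at h
    have h2 := (abs_le.1 (hF.lip x1 y1)).2
    have h3 : (x1 - y1) ^ 2 / σ ≤ K * |x1 - y1| := by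
      simp only [sub_self, ne_eq, OfNat.ofNat_ne_zero, not_false_eq_true, zero_pow, zero_div] at h
      linarith
    rw [div_le_iff₀ hσ, ← sq_abs] at h3
    rcases (abs_nonneg (x1 - y1)).eq_or_lt with h0 | h0
    · rw [← h0]; positivity
    · by_contra hlt
      push Not at hlt
      nlinarith
  have hKσ : K * σ < r := by nlinarith
  have hint : |t1 - t0| < r ∧ |x1 - x0| < r := by
    by_contra hcon
    have hor : r ≤ |t1 - t0| ∨ r ≤ |x1 - x0| := by
      by_contra h'
      push Not at h'
      exact hcon h'
    have h1 := hbd t1 x1 ht1 hx1 hor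
    have h2 := hglob t0 x0 x0 (by simp [hr.le]) (by simp [hr.le]) (by simp [hr.le])
    rw [hΨ, hΨ] at h2
    simp only [sub_self, ne_eq, OfNat.ofNat_ne_zero, not_false_eq_true, zero_pow, zero_div,
      mul_zero, add_zero, sub_zero] at h2
    have h3 := (abs_le.1 (hF.lip x1 y1)).2
    have h4 : K * |x1 - y1| ≤ K * (K * σ) := by gcongr
    have h5 : 0 ≤ (x1 - y1) ^ 2 / σ := by positivity
    have h6 : K * (K * σ) < μ := by nlinarith
    linarith
  have hy1 : |y1 - x0| < 2 * r := by
    have := abs_sub_le y1 x1 x0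
    rw [abs_sub_comm y1 x1] at this
    linarith [hint.2]
  have ht1pos : 0 < t1 := by linarith [(abs_lt.1 hint.1).1]
  obtain ⟨p, hp⟩ : ∃ p, p = 2 * (x1 - y1) / σ := ⟨_, rfl⟩
  have hpK : |p| ≤ 2 * K := by
    rw [hp, abs_div, abs_mul, abs_two, abs_of_pos hσ, div_le_iff₀ hσ]; linarith
  -- supercorrector test
  obtain ⟨l, r', hl, hr', hq⟩ := hF.super y1
  have hsq : HasDerivAt (fun y => (x1 - y) ^ 2 / σ) (-p) y1 :=
    ((((hasDerivAt_id y1).const_sub x1).pow 2).div_const σ).congr_deriv (by simp [hp]; ring)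
  have hymin : ∀ᶠ y in 𝓝 y1, F y1 + (x1 - y1) ^ 2 / σ + 0 * (y - y1) ≤
      F y + (x1 - y) ^ 2 / σ := by
    have hc : Continuous fun y => |y - x0| := by fun_prop
    filter_upwards [hc.continuousAt.eventually (gt_mem_nhds hy1)] with y hy
    have := hglob t1 x1 y ht1 hx1 hy.le
    rw [hΨ, hΨ] at this
    linarith
  -- Minimality in y places p between the left and right derivatives of F at y1, the range covered
  -- by the supercorrector property.
  have hlp : l + -p ≤ 0 := deriv_le_of_eventually_left
    (hl.fun_add hsq.hasDerivWithinAt) (nhdsWithin_le_nhds hymin)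
  have hrp : 0 ≤ r' + -p := le_deriv_of_eventually_right
    (hr'.fun_add hsq.hasDerivWithinAt) (nhdsWithin_le_nhds hymin)
  have hc := hq p (by linarith) (by linarith)
  -- subsolution test
  have hdt : HasDerivAt (fun t => a * (t - t0) + κ / r * (t - t0) ^ 2)
      (a + κ / r * (2 * (t1 - t0))) t1 :=
    ((((hasDerivAt_id t1).sub_const t0).const_mul a).add
      ((hasDerivAt_sub_sq t0 t1).const_mul (κ / r))).congr_deriv (by simp)
  have hdx : HasDerivAt (fun x => κ / r * (x - x0) ^ 2 + (x - y1) ^ 2 / σ)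
      (p + κ / r * (2 * (x1 - x0))) x1 :=
    (((hasDerivAt_sub_sq x0 x1).const_mul (κ / r)).add
      ((hasDerivAt_sub_sq y1 x1).div_const σ)).congr_deriv (by rw [hp]; ring)
  have hS := hsub.test_separable (α := fun t => a * (t - t0) + κ / r * (t - t0) ^ 2)
    (β := fun x => κ / r * (x - x0) ^ 2 + (x - y1) ^ 2 / σ) (by fun_prop) (by fun_prop) ht1pos
    hdt hdx (by
      have c1 : Continuous fun z : ℝ × ℝ => |z.1 - t0| := by fun_prop
      have c2 : Continuous fun z : ℝ × ℝ => |z.2 - x0| := by fun_prop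
      filter_upwards [(c1.continuousAt (x := (t1, x1))).eventually (gt_mem_nhds hint.1),
        (c2.continuousAt (x := (t1, x1))).eventually (gt_mem_nhds hint.2)] with z h1 h2
      have := hglob z.1 z.2 y1 h1.le h2.le hy1.le
      rw [hΨ, hΨ] at this
      simp only [Prod.mk.eta] at this
      linarith)
  have hbound : ∀ s, |s| ≤ r → |κ / r * (2 * s)| ≤ 2 * κ := by
    intro s hs
    rw [abs_mul, abs_mul, abs_two, abs_of_nonneg (by positivity)]
    calc κ / r * (2 * |s|) ≤ κ / r * (2 * r) := by gcongr
      _ = 2 * κ := by field_simp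
  have hg := (abs_le.1 (hη p _ hpK (hbound _ hx1))).1
  have ha := (abs_le.1 (hbound _ ht1)).1
  have hx1' := abs_le.1 hx1
  have hy1' := abs_lt.1 hy1
  have hWxy := hWd y1 ⟨by linarith, by linarith⟩ x1 ⟨by linarith, by linarith⟩ (by
    rw [Real.dist_eq, abs_sub_comm]
    nlinarith)
  rw [Real.dist_eq, abs_lt] at hWxy
  linarith [hWxy.2]

/-- Approximate supercorrectors above the line of slope `θ` through `x₀`, at levels close to `c`,
for the family of potentials `W ε` as `ε → 0+`. -/
def HasSupercorrectors (G : ℝ → ℝ) (W : ℝ → ℝ → ℝ) (x₀ θ c : ℝ) : Prop :=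
  ∀ δ > 0, ∃ K, 0 ≤ K ∧ ∀ η > 0, ∀ᶠ ε in 𝓝[>] (0 : ℝ), ∃ F, IsSupercorrector G (W ε) F K (c - δ) ∧
    ∀ x, |x - x₀| ≤ 1 → θ * (x - x₀) - η ≤ F x - F x₀

/-- Approximate subcorrectors below the line of slope `θ` through `x₀`, at levels close to `c`,
for the family of potentials `W ε` as `ε → 0+`. -/
def HasSubcorrectors (G : ℝ → ℝ) (W : ℝ → ℝ → ℝ) (x₀ θ c : ℝ) : Prop :=
  ∀ δ > 0, ∃ K, 0 ≤ K ∧ ∀ η > 0, ∀ᶠ ε in 𝓝[>] (0 : ℝ), ∃ F, IsSubcorrector G (W ε) F K (c + δ) ∧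
    ∀ x, |x - x₀| ≤ 1 → F x - F x₀ ≤ θ * (x - x₀) + η

theorem HasSubcorrectors.neg {G : ℝ → ℝ} {W : ℝ → ℝ → ℝ} {x₀ θ c : ℝ}
    (h : HasSubcorrectors G W x₀ θ c) :
    HasSupercorrectors (fun p => -G (-p)) (fun ε x => -W ε x) x₀ (-θ) (-c) := by
  intro δ hδ
  obtain ⟨K, hK, h⟩ := h δ hδ
  refine ⟨K, hK, fun η hη => ?_⟩
  filter_upwards [h η hη] with ε hε
  obtain ⟨F, hF, hlow⟩ := hε
  refine ⟨fun x => -F x, ?_, fun x hx => ?_⟩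
  · have := hF.neg
    rwa [neg_add'] at this
  · have := hlow x hx
    linarith

/-! ### Half-relaxed limits and the perturbed test function method -/

/-- Equicontinuity of a family `u ε`, `ε > 0`, on `[0,∞) × ℝ`. -/
def IsEquicontinuousFamily (u : ℝ → ℝ × ℝ → ℝ) : Prop :=
  ∀ η > 0, ∃ C K, 0 ≤ C ∧ 0 ≤ K ∧ ∀ ε > 0, ∀ t s x y : ℝ, 0 ≤ t → 0 ≤ s →
    |u ε (t, x) - u ε (s, y)| ≤ C * |t - s| + K * |x - y| + η

/-- `U` is the pointwise upper limit of `u ε` as `ε → 0+`. -/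
structure IsUpperLimit (u : ℝ → ℝ × ℝ → ℝ) (U : ℝ × ℝ → ℝ) : Prop where
  eventually : ∀ z ∈ Ici (0 : ℝ) ×ˢ (univ : Set ℝ), ∀ η > 0, ∀ᶠ ε in 𝓝[>] (0 : ℝ), u ε z < U z + η
  frequently : ∀ z ∈ Ici (0 : ℝ) ×ˢ (univ : Set ℝ), ∀ η > 0, ∃ᶠ ε in 𝓝[>] (0 : ℝ), U z - η < u ε z

section UpperLimit

variable {u : ℝ → ℝ × ℝ → ℝ} {U : ℝ × ℝ → ℝ}

theorem isUpperLimit_limsup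
    (hb : ∀ z ∈ Ici (0 : ℝ) ×ˢ (univ : Set ℝ), ∃ c, ∀ ε > 0, |u ε z| ≤ c) :
    IsUpperLimit u (fun z => limsup (fun ε => u ε z) (𝓝[>] 0)) := by
  have hbd : ∀ z ∈ Ici (0 : ℝ) ×ˢ (univ : Set ℝ),
      IsBoundedUnder (· ≤ ·) (𝓝[>] 0) (fun ε => u ε z) ∧
      IsBoundedUnder (· ≥ ·) (𝓝[>] 0) (fun ε => u ε z) := by
    intro z hz
    obtain ⟨c, hc⟩ := hb z hz
    constructor
    · refine ⟨c, ?_⟩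
      rw [eventually_map]
      filter_upwards [self_mem_nhdsWithin] with ε hε
      exact (abs_le.1 (hc ε hε)).2
    · refine ⟨-c, ?_⟩
      rw [eventually_map]
      filter_upwards [self_mem_nhdsWithin] with ε hε
      exact (abs_le.1 (hc ε hε)).1
  refine ⟨fun z hz η hη => ?_, fun z hz η hη => ?_⟩
  · exact eventually_lt_of_limsup_lt (by linarith) (hbd z hz).1
  · exact frequently_lt_of_lt_limsup (hbd z hz).2.isCoboundedUnder_le (by linarith)

/-- The upper limit is almost attained for frequent ε at one point and almost not exceeded for all
small ε at the other, so a common ε compares the two values. -/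
theorem IsUpperLimit.abs_sub_le (hU : IsUpperLimit u U) {C K η : ℝ}
    (h : ∀ ε > 0, ∀ t s x y : ℝ, 0 ≤ t → 0 ≤ s →
      |u ε (t, x) - u ε (s, y)| ≤ C * |t - s| + K * |x - y| + η) :
    ∀ t s x y : ℝ, 0 ≤ t → 0 ≤ s → |U (t, x) - U (s, y)| ≤ C * |t - s| + K * |x - y| + η := by
  have key : ∀ t s x y : ℝ, 0 ≤ t → 0 ≤ s →
      U (t, x) ≤ U (s, y) + (C * |t - s| + K * |x - y| + η) := by
    intro t s x y ht hs
    refine le_of_forall_pos_le_add fun ω hω => ?_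
    obtain ⟨ε, hε1, hε2, hε3⟩ := ((hU.frequently (t, x) ⟨ht, trivial⟩ (ω / 2) (by positivity)).and_eventually
      ((hU.eventually (s, y) ⟨hs, trivial⟩ (ω / 2) (by positivity)).and self_mem_nhdsWithin)).exists
    have := (abs_le.1 (h ε hε3 t s x y ht hs)).2
    linarith
  intro t s x y ht hs
  have h1 := key t s x y ht hs
  have h2 := key s t y x hs ht
  rw [abs_sub_comm s, abs_sub_comm y] at h2
  rw [abs_le]
  constructor <;> linarith

theorem uniformContinuousOn_of_modulus {v : ℝ × ℝ → ℝ}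
    (h : ∀ η > 0, ∃ C K, 0 ≤ C ∧ 0 ≤ K ∧ ∀ t s x y : ℝ, 0 ≤ t → 0 ≤ s →
      |v (t, x) - v (s, y)| ≤ C * |t - s| + K * |x - y| + η) :
    UniformContinuousOn v (Ici 0 ×ˢ univ) := by
  rw [Metric.uniformContinuousOn_iff]
  intro ε hε
  obtain ⟨C, K, hC, hK, h⟩ := h (ε / 2) (by positivity)
  refine ⟨ε / 2 / (C + K + 1), by positivity, fun z hz w hw hd => ?_⟩
  rw [lt_div_iff₀ (by positivity)] at hd
  have h0 := h z.1 w.1 z.2 w.2 hz.1 hw.1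
  have h1 : |z.1 - w.1| ≤ dist z w := by rw [← Real.dist_eq]; exact le_max_left _ _
  have h2 : |z.2 - w.2| ≤ dist z w := by rw [← Real.dist_eq]; exact le_max_right _ _
  have h3 : C * |z.1 - w.1| ≤ C * dist z w := by gcongr
  have h4 : K * |z.2 - w.2| ≤ K * dist z w := by gcongr
  have h5 : 0 ≤ dist z w := dist_nonneg
  rw [Real.dist_eq]
  calc |v z - v w| ≤ C * |z.1 - w.1| + K * |z.2 - w.2| + ε / 2 := h0
    _ < ε := by linarith

/-- Modulus of continuity near a point, common to the family and to its limits. -/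
theorem exists_nhds_modulus (C K : ℝ) {η : ℝ} (hη : 0 < η) (z : ℝ × ℝ) :
    ∃ t ∈ 𝓝 z, ∀ w ∈ t, C * |w.1 - z.1| + K * |w.2 - z.2| < η := by
  have hc : Continuous fun w : ℝ × ℝ => C * |w.1 - z.1| + K * |w.2 - z.2| := by fun_prop
  exact ⟨{w | C * |w.1 - z.1| + K * |w.2 - z.2| < η},
    hc.continuousAt.eventually (gt_mem_nhds (by simpa using hη)), fun w hw => hw⟩

theorem IsUpperLimit.eventually_nhds (hU : IsUpperLimit u U) (hu : IsEquicontinuousFamily u)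
    {η : ℝ} (hη : 0 < η) {z : ℝ × ℝ} (hz : z ∈ Ici (0 : ℝ) ×ˢ (univ : Set ℝ)) :
    ∃ t ∈ 𝓝 z, ∀ᶠ ε in 𝓝[>] (0 : ℝ), ∀ w ∈ t, w ∈ Ici (0 : ℝ) ×ˢ (univ : Set ℝ) →
      u ε w ≤ U w + η := by
  obtain ⟨C, K, hC, hK, h⟩ := hu (η / 5) (by positivity)
  obtain ⟨t, ht, hmod⟩ := exists_nhds_modulus C K (show 0 < η / 5 by positivity) z
  refine ⟨t, ht, ?_⟩
  filter_upwards [hU.eventually z hz (η / 5) (by positivity), self_mem_nhdsWithin]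
    with ε h1 hε w hw hwd
  have h2 := (abs_le.1 (h ε hε w.1 z.1 w.2 z.2 hwd.1 hz.1)).2
  have h3 := (abs_le.1 (hU.abs_sub_le h w.1 z.1 w.2 z.2 hwd.1 hz.1)).1
  have h4 := hmod w hw
  simp only [Prod.mk.eta] at h2 h3
  linarith

theorem IsUpperLimit.eventually_compact (hU : IsUpperLimit u U) (hu : IsEquicontinuousFamily u)
    {η : ℝ} (hη : 0 < η) {S : Set (ℝ × ℝ)} (hS : IsCompact S) :
    ∀ᶠ ε in 𝓝[>] (0 : ℝ), ∀ w ∈ S, w ∈ Ici (0 : ℝ) ×ˢ (univ : Set ℝ) → u ε w ≤ U w + η := by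
  refine hS.induction_on (p := fun S => ∀ᶠ ε in 𝓝[>] (0 : ℝ), ∀ w ∈ S,
    w ∈ Ici (0 : ℝ) ×ˢ (univ : Set ℝ) → u ε w ≤ U w + η) (by simp) ?_ ?_ ?_
  · intro s t hst h
    filter_upwards [h] with ε hε w hw using hε w (hst hw)
  · intro s t h1 h2
    filter_upwards [h1, h2] with ε hε1 hε2 w hw
    rcases hw with hw | hw
    · exact hε1 w hw
    · exact hε2 w hw
  · intro z _
    by_cases hz : z ∈ Ici (0 : ℝ) ×ˢ (univ : Set ℝ)
    · obtain ⟨t, ht, h⟩ := hU.eventually_nhds hu hη hz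
      exact ⟨t, mem_nhdsWithin_of_mem_nhds ht, h⟩
    · have hcl : IsClosed (Ici (0 : ℝ) ×ˢ (univ : Set ℝ)) := isClosed_Ici.prod isClosed_univ
      exact ⟨_, mem_nhdsWithin_of_mem_nhds (hcl.isOpen_compl.mem_nhds hz),
        Eventually.of_forall fun ε w hw hw' => absurd hw' hw⟩

/-- Perturbed test function method: the upper limit is a subsolution of the effective equation. -/
theorem IsUpperLimit.isSubsol {G H : ℝ → ℝ} {W : ℝ → ℝ → ℝ} (hG : Continuous G)
    (hW : ∀ ε > 0, Continuous (W ε)) (hU : IsUpperLimit u U) (hu : IsEquicontinuousFamily u)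
    (hsub : ∀ ε > 0, IsSubsol G (W ε) (u ε))
    (hcorr : ∀ x₀ θ, HasSupercorrectors G W x₀ θ (H θ)) : IsSubsol H (fun _ => 0) U := by
  intro φ hφ t0 x0 ht0 hm
  obtain ⟨a, ha⟩ : ∃ a, a = fderiv ℝ φ (t0, x0) (1, 0) := ⟨_, rfl⟩
  obtain ⟨θ, hθ⟩ : ∃ θ, θ = fderiv ℝ φ (t0, x0) (0, 1) := ⟨_, rfl⟩
  rw [← ha, ← hθ]
  by_contra hcon
  push Not at hcon
  obtain ⟨γ, hγ⟩ : ∃ γ, γ = a + (H θ + 0) := ⟨_, rfl⟩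
  rw [← hγ] at hcon
  -- The Lipschitz constant K is fixed before the error η of the correctors; so κ, and then r, can
  -- be chosen in terms of K.
  obtain ⟨K, hK, hcorr⟩ := hcorr x0 θ (γ / 4) (by positivity)
  have hGu := (isCompact_Icc (a := -(2 * K + 1)) (b := 2 * K + 1)).uniformContinuousOn_of_continuous
    hG.continuousOn
  obtain ⟨d, hd, hGd⟩ := Metric.uniformContinuousOn_iff.1 hGu (γ / 8) (by positivity)
  obtain ⟨κ, hκ, hκd, hκ1, hκγ⟩ : ∃ κ, 0 < κ ∧ 2 * κ < d ∧ 2 * κ ≤ 1 ∧ 2 * κ ≤ γ / 8 := by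
    have hpos : 0 < min (d / 2) (min 1 (γ / 8)) := by positivity
    have h1 : min (d / 2) (min 1 (γ / 8)) ≤ d / 2 := min_le_left _ _
    have h2 : min (d / 2) (min 1 (γ / 8)) ≤ 1 := (min_le_right _ _).trans (min_le_left _ _)
    have h3 : min (d / 2) (min 1 (γ / 8)) ≤ γ / 8 := (min_le_right _ _).trans (min_le_right _ _)
    refine ⟨min (d / 2) (min 1 (γ / 8)) / 2, half_pos hpos, ?_, ?_, ?_⟩ <;> linarith
  have hη : ∀ p q : ℝ, |p| ≤ 2 * K → |q| ≤ 2 * κ → |G (p + q) - G p| ≤ γ / 8 := by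
    intro p q hp hq
    have hp' := abs_le.1 hp
    have hq' := abs_le.1 hq
    have := hGd (p + q) ⟨by linarith, by linarith⟩ p ⟨by linarith, by linarith⟩
      (by rw [Real.dist_eq, add_sub_cancel_left]; linarith)
    rw [Real.dist_eq] at this
    exact this.le
  have hlin := eventually_linear_le_of_isLocalMin (u := fun z => -U z) (φ := fun z => -φ z)
    hφ.neg (by
      refine hm.neg.congr (Eventually.of_forall fun z => ?_)
      simp; ring) (κ := κ / 8) (by positivity)
  have hfn : fderiv ℝ (fun z => -φ z) (t0, x0) = -fderiv ℝ φ (t0, x0) := fderiv_fun_neg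
  rw [hfn, neg_apply, neg_apply, ← ha, ← hθ] at hlin
  obtain ⟨r1, hr1, hlin⟩ := Metric.eventually_nhds_iff_ball.1 hlin
  obtain ⟨r, hr, hrr, hr1', hrt⟩ : ∃ r, 0 < r ∧ r < r1 ∧ r ≤ 1 ∧ r ≤ t0 := by
    have hpos : 0 < min (r1 / 2) (min 1 t0) := by positivity
    refine ⟨_, hpos, ?_, (min_le_right _ _).trans (min_le_left _ _),
      (min_le_right _ _).trans (min_le_right _ _)⟩
    have := min_le_left (r1 / 2) (min 1 t0)
    linarith
  have hcompact := hU.eventually_compact hu (η := κ * r / 8) (by positivity)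
    (isCompact_closedBall ((t0, x0) : ℝ × ℝ) r)
  have hfreq := hU.frequently (t0, x0) ⟨ht0.le, trivial⟩ (κ * r / 8) (by positivity)
  obtain ⟨ε, hε1, hε2, hε3, hε4⟩ := (hfreq.and_eventually (hcompact.and
    ((hcorr (κ * r / 8) (by positivity)).and self_mem_nhdsWithin))).exists
  obtain ⟨F, hF, hFlow⟩ := hε3
  have hcontu : ContinuousOn (u ε) (Ici 0 ×ˢ univ) := by
    refine (uniformContinuousOn_of_modulus fun η hη => ?_).continuousOn
    obtain ⟨C, K, hC, hK, h⟩ := hu η hη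
    exact ⟨C, K, hC, hK, h ε hε4⟩
  -- On the boundary the penalty κr beats the losses: κr/4 from differentiability, and κr/8 each
  -- from the upper limit on the ball, the upper limit at the centre and the corrector. The
  -- remaining 3κr/8 exceeds μ = κr/4.
  have hres := (hsub ε hε4).speed_le_of_supercorrector (hW ε hε4) hcontu hK hF (t0 := t0)
    (x0 := x0) (r := r) (a := a) (κ := κ) (μ := κ * r / 4) (η := γ / 8) hr hrt hκ.le (by positivity)
    (by
      intro t x ht hx hor
      have hball : (t, x) ∈ Metric.closedBall ((t0, x0) : ℝ × ℝ) r := by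
        rw [Metric.mem_closedBall, Prod.dist_eq]
        exact max_le ht hx
      have e1 := hε2 (t, x) hball (closedBall_subset_of_lt hrt hball)
      have e2 := hlin (t, x) (Metric.closedBall_subset_ball hrr hball)
      have e3 := hFlow x (hx.trans hr1')
      have e4 : κ / 8 * (|t - t0| + |x - x0|) ≤ κ / 8 * (r + r) := by gcongr
      have e5 : κ * r ≤ κ / r * ((t - t0) ^ 2 + (x - x0) ^ 2) := by
        have : r ^ 2 ≤ (t - t0) ^ 2 + (x - x0) ^ 2 := by
          rcases hor with h | h
          · have : r ^ 2 ≤ |t - t0| ^ 2 := by gcongr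
            rw [sq_abs] at this
            linarith [sq_nonneg (x - x0)]
          · have : r ^ 2 ≤ |x - x0| ^ 2 := by gcongr
            rw [sq_abs] at this
            linarith [sq_nonneg (t - t0)]
        calc κ * r = κ / r * r ^ 2 := by field_simp
          _ ≤ _ := by gcongr
      have e6 : 0 < κ * r := by positivity
      simp only at e2
      linarith) hη
  linarith

end UpperLimit

theorem IsUpperLimit.isSupersol_of_neg {G H : ℝ → ℝ} {W : ℝ → ℝ → ℝ} {u : ℝ → ℝ × ℝ → ℝ}
    {U : ℝ × ℝ → ℝ} (hG : Continuous G)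
    (hW : ∀ ε > 0, Continuous (W ε)) (hU : IsUpperLimit (fun ε z => -u ε z) (fun z => -U z))
    (hu : IsEquicontinuousFamily u) (hsup : ∀ ε > 0, IsSupersol G (W ε) (u ε))
    (hcorr : ∀ x₀ θ, HasSubcorrectors G W x₀ θ (H θ)) : IsSupersol H (fun _ => 0) U := by
  refine isSubsol_neg_iff.1 ?_
  have := hU.isSubsol (G := fun p => -G (-p)) (H := fun p => -H (-p)) (W := fun ε x => -W ε x)
    (by fun_prop) (fun ε hε => (hW ε hε).neg) ?_ (fun ε hε => isSubsol_neg_iff.2 (hsup ε hε))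
    fun x₀ θ => ?_
  · simpa using this
  · intro η hη
    obtain ⟨C, K, hC, hK, h⟩ := hu η hη
    refine ⟨C, K, hC, hK, fun ε hε t s x y ht hs => ?_⟩
    rw [← abs_neg]; convert h ε hε t s x y ht hs using 2; ring
  · have := (hcorr x₀ (-θ)).neg
    rwa [neg_neg] at this

/-- Homogenization of the Cauchy problem, given approximate correctors for every slope. -/
theorem homogenization_of_correctors {G H : ℝ → ℝ} {W : ℝ → ℝ → ℝ} (hG : IsContinuousCoercive G)
    (hH : IsContinuousCoercive H) (hW : ∀ ε > 0, UniformContinuous (W ε)) {B : ℝ}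
    (hWB : ∀ ε > 0, ∀ x, |W ε x| ≤ B)
    (hsup : ∀ x₀ θ, HasSupercorrectors G W x₀ θ (H θ))
    (hsub : ∀ x₀ θ, HasSubcorrectors G W x₀ θ (H θ)) {g : ℝ → ℝ} (hg : UniformContinuous g) :
    ∃ (u : ℝ → ℝ × ℝ → ℝ) (ubar : ℝ × ℝ → ℝ),
      (∀ ε, 0 < ε → IsUniqueViscositySolution (fun p x => G p + W ε x) g (u ε)) ∧
      IsUniqueViscositySolution (fun p _ => H p) g ubar ∧
      TendstoLocallyUniformlyOn u ubar (𝓝[>] 0) (Ici 0 ×ˢ univ) := by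
  have hB : 0 ≤ B := (abs_nonneg _).trans (hWB 1 one_pos 0)
  have hex : ∀ ε : ℝ, ∃ u, 0 < ε → IsUniqueViscositySolution (fun p x => G p + W ε x) g u := by
    intro ε
    by_cases hε : 0 < ε
    · obtain ⟨u, hu⟩ := exists_isUniqueViscositySolution hG (hW ε hε) (hWB ε hε) hg
      exact ⟨u, fun _ => hu⟩
    · exact ⟨fun _ => 0, fun h => absurd h hε⟩
  choose u hu using hex
  have hequi : IsEquicontinuousFamily u := by
    intro η hη
    obtain ⟨C, K, hC, hK, h⟩ := exists_equicontinuity hG hg hB hη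
    exact ⟨C, K, hC, hK, fun ε hε => h (W ε) (hW ε hε) (hWB ε hε) (u ε) (hu ε hε).1⟩
  have hbdd : ∀ z ∈ Ici (0 : ℝ) ×ˢ (univ : Set ℝ), ∃ c, ∀ ε > 0, |u ε z| ≤ c := by
    intro z hz
    obtain ⟨C, K, hC, hK, h⟩ := hequi 1 one_pos
    refine ⟨C * |z.1 - 0| + K * |z.2 - z.2| + 1 + |g z.2|, fun ε hε => ?_⟩
    have h1 := h ε hε z.1 0 z.2 z.2 hz.1 le_rfl
    rw [(hu ε hε).1.initial, Prod.mk.eta] at h1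
    have := abs_sub_abs_le_abs_sub (u ε z) (g z.2)
    linarith
  obtain ⟨U, hU⟩ : ∃ U, IsUpperLimit u U := ⟨_, isUpperLimit_limsup hbdd⟩
  obtain ⟨L, hL⟩ : ∃ L : ℝ × ℝ → ℝ, IsUpperLimit (fun ε z => -u ε z) (fun z => -L z) := by
    have := isUpperLimit_limsup (u := fun ε z => -u ε z) (fun z hz => by
      simpa using hbdd z hz)
    exact ⟨fun z => -limsup (fun ε => -u ε z) (𝓝[>] 0), by simpa using this⟩
  have hequi' : IsEquicontinuousFamily (fun ε z => -u ε z) := by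
    intro η hη
    obtain ⟨C, K, hC, hK, h⟩ := hequi η hη
    refine ⟨C, K, hC, hK, fun ε hε t s x y ht hs => ?_⟩
    rw [← abs_neg]; convert h ε hε t s x y ht hs using 2; ring
  have hUsub : IsSubsol H (fun _ => 0) U := hU.isSubsol hG.continuous
    (fun ε hε => (hW ε hε).continuous) hequi (fun ε hε => (hu ε hε).1.subsolution) hsup
  have hLsup : IsSupersol H (fun _ => 0) L := hL.isSupersol_of_neg hG.continuous
    (fun ε hε => (hW ε hε).continuous) hequi (fun ε hε => (hu ε hε).1.supersolution) hsub
  have hUuc : UniformContinuousOn U (Ici 0 ×ˢ univ) := uniformContinuousOn_of_modulus fun η hη => by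
    obtain ⟨C, K, hC, hK, h⟩ := hequi η hη
    exact ⟨C, K, hC, hK, hU.abs_sub_le h⟩
  have hLuc : UniformContinuousOn L (Ici 0 ×ˢ univ) := by
    have : UniformContinuousOn (fun z => -L z) (Ici 0 ×ˢ univ) :=
      uniformContinuousOn_of_modulus fun η hη => by
        obtain ⟨C, K, hC, hK, h⟩ := hequi' η hη
        exact ⟨C, K, hC, hK, hL.abs_sub_le h⟩
    simpa [Function.comp_def] using uniformContinuous_neg.comp_uniformContinuousOn this
  have hLU : ∀ z ∈ Ici (0 : ℝ) ×ˢ (univ : Set ℝ), L z ≤ U z := by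
    intro z hz
    refine le_of_forall_pos_le_add fun η hη => ?_
    obtain ⟨ε, h1, h2⟩ := ((hL.eventually z hz (η / 2) (by positivity)).and
      (hU.eventually z hz (η / 2) (by positivity))).exists
    linarith
  have hinit : ∀ x, U (0, x) = g x ∧ L (0, x) = g x := by
    intro x
    have hz : ((0 : ℝ), x) ∈ Ici (0 : ℝ) ×ˢ (univ : Set ℝ) := ⟨self_mem_Ici, trivial⟩
    have hc : ∀ η > 0, U (0, x) < g x + η ∧ g x < L (0, x) + η := by
      intro η hη
      obtain ⟨ε, h1, hε⟩ := ((hU.frequently _ hz η hη).and_eventually self_mem_nhdsWithin).exists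
      obtain ⟨ε', h1', hε'⟩ := ((hL.frequently _ hz η hη).and_eventually self_mem_nhdsWithin).exists
      rw [(hu ε hε).1.initial] at h1
      rw [(hu ε' hε').1.initial] at h1'
      constructor <;> linarith
    have h1 : U (0, x) ≤ g x := le_of_forall_pos_le_add fun η hη => (hc η hη).1.le
    have h2 : g x ≤ L (0, x) := le_of_forall_pos_le_add fun η hη => (hc η hη).2.le
    have h3 := hLU _ hz
    constructor <;> linarith
  -- Comparison for the effective equation reverses L ≤ U; the two half-relaxed limits coincide,
  -- which is local uniform convergence.
  have hUL : ∀ z ∈ Ici (0 : ℝ) ×ˢ (univ : Set ℝ), U z = L z := fun z hz =>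
    le_antisymm (IsSubsol.le_of_initial_le hH.continuous uniformContinuous_const hUuc hLuc hUsub
      hLsup (fun x => by rw [(hinit x).1, (hinit x).2]) z.1 z.2 hz.1) (hLU z hz)
  have hUsup : IsSupersol H (fun _ => 0) U := by
    intro φ hφ t x ht hm
    refine hLsup φ hφ t x ht ?_
    filter_upwards [hm, eventually_pos_fst ht] with z h1 h2
    rw [← hUL z ⟨h2.le, trivial⟩, ← hUL (t, x) ⟨ht.le, trivial⟩]
    exact h1
  have hsol : IsViscositySolution (fun p x => H p + (fun _ => (0 : ℝ)) x) g U :=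
    ⟨hUuc, fun x => (hinit x).1, hUsub, hUsup⟩
  have heq : (fun (p : ℝ) (_ : ℝ) => H p) = fun p x => H p + (fun _ => (0 : ℝ)) x := by simp
  refine ⟨u, U, hu, ?_, ?_⟩
  · rw [heq]
    refine ⟨hsol, fun v hv z hz => ?_⟩
    have := hv.abs_sub_le hH.continuous uniformContinuous_const hsol (c := 0) (by simp) z hz
    linarith [abs_eq_zero.1 (le_antisymm this (abs_nonneg _))]
  · rw [Metric.tendstoLocallyUniformlyOn_iff]
    intro η hη z hz
    obtain ⟨t1, ht1, h1⟩ := hU.eventually_nhds hequi (half_pos hη) hz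
    obtain ⟨t2, ht2, h2⟩ := hL.eventually_nhds hequi' (half_pos hη) hz
    refine ⟨t1 ∩ t2 ∩ (Ici 0 ×ˢ univ), inter_mem (mem_nhdsWithin_of_mem_nhds (inter_mem ht1 ht2))
      self_mem_nhdsWithin, ?_⟩
    filter_upwards [h1, h2] with ε e1 e2 w hw
    have f1 := e1 w hw.1.1 hw.2
    have f2 := e2 w hw.1.2 hw.2
    rw [← hUL w hw.2] at f2
    rw [Real.dist_eq, abs_lt]
    constructor <;> linarith

/-! ### Inverse branches of the double-well Hamiltonian -/

/-- Continuous strictly monotone extensions to `ℝ` of the inverses of `G` on the three monotone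
branches `(-∞, pm]`, `[pM, 0]` and `[0, ∞)`. -/
structure InverseBranches (G : ℝ → ℝ) (m M pm pM : ℝ) (p₁ p₃ p₄ : ℝ → ℝ) : Prop where
  cont₁ : Continuous p₁
  cont₃ : Continuous p₃
  cont₄ : Continuous p₄
  anti₁ : StrictAnti p₁
  anti₃ : StrictAnti p₃
  mono₄ : StrictMono p₄
  right_inv₁ : ∀ v, m ≤ v → G (p₁ v) = v
  right_inv₃ : ∀ v, 0 ≤ v → v ≤ M → G (p₃ v) = v
  right_inv₄ : ∀ v, 0 ≤ v → G (p₄ v) = v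
  map₁ : p₁ m = pm
  map₃ : p₃ M = pM
  map₃_zero : p₃ 0 = 0
  map₄ : p₄ 0 = 0
  tendsto₁ : Tendsto p₁ atTop atBot
  tendsto₄ : Tendsto p₄ atTop atTop

/-- K is continued to the left of a with slope one. This gives an increasing homeomorphism of ℝ, so
the inverse branch is continuous and strictly monotone without any restriction of its domain. -/
theorem exists_inverse_of_strictMonoOn_Ici {K : ℝ → ℝ} {a : ℝ} (hK : Continuous K)
    (hmono : StrictMonoOn K (Ici a)) (htop : Tendsto K atTop atTop) :
    ∃ p : ℝ → ℝ, Continuous p ∧ StrictMono p ∧ p (K a) = a ∧ (∀ v, K a ≤ v → K (p v) = v) ∧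
      Tendsto p atTop atTop ∧ ∀ q, a ≤ q → p (K q) = q := by
  obtain ⟨E, hE⟩ : ∃ E : ℝ → ℝ, ∀ q, E q = K (max q a) + min (q - a) 0 := ⟨_, fun _ => rfl⟩
  have hEa : ∀ q, a ≤ q → E q = K q := fun q hq => by
    rw [hE, max_eq_left hq, min_eq_right (by linarith), add_zero]
  have hEb : ∀ q, q ≤ a → E q = K a + (q - a) := fun q hq => by
    rw [hE, max_eq_right hq, min_eq_left (by linarith)]
  have hEc : Continuous E := by
    have : E = fun q => K (max q a) + min (q - a) 0 := funext hE
    rw [this]; fun_prop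
  have hEm : StrictMono E := by
    intro x y hxy
    rcases le_or_gt a x with hx | hx
    · rw [hEa x hx, hEa y (hx.trans hxy.le)]
      exact hmono hx (hx.trans hxy.le : a ≤ y) hxy
    · rw [hEb x hx.le]
      rcases le_or_gt a y with hy | hy
      · rw [hEa y hy]
        have := hmono.monotoneOn (self_mem_Ici : a ∈ Ici a) hy hy
        linarith
      · rw [hEb y hy.le]; linarith
  have hEt : Tendsto E atTop atTop := htop.congr' (by
    filter_upwards [eventually_ge_atTop a] with q hq using (hEa q hq).symm)
  have hEbot : Tendsto E atBot atBot := by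
    have : Tendsto (fun q => K a + (q - a)) atBot atBot :=
      tendsto_atBot_add_const_left _ _ (tendsto_atBot_add_const_right _ (-a) tendsto_id)
    exact this.congr' (by
      filter_upwards [eventually_le_atBot a] with q hq using (hEb q hq).symm)
  have hsurj := hEc.surjective hEt hEbot
  obtain ⟨e, he⟩ : ∃ e : ℝ ≃o ℝ, ∀ q, e q = E q := ⟨hEm.orderIsoOfSurjective E hsurj, fun _ => rfl⟩
  refine ⟨e.symm, e.symm.continuous, e.symm.strictMono, ?_, ?_, e.symm.tendsto_atTop, ?_⟩
  · rw [← hEa a le_rfl, ← he, e.symm_apply_apply]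
  · intro v hv
    have h1 : a ≤ e.symm v := by
      rw [e.le_symm_apply, he, hEa a le_rfl]; exact hv
    rw [← hEa _ h1, ← he, e.apply_symm_apply]
  · intro q hq
    rw [← hEa q hq, ← he, e.symm_apply_apply]

theorem IsDoubleWell.exists_inverseBranches {G : ℝ → ℝ} {m M pm pM : ℝ}
    (hG : IsContinuousCoercive G) (hW : IsDoubleWell G m M pm pM) :
    ∃ p₁ p₃ p₄, InverseBranches G m M pm pM p₁ p₃ p₄ := by
  obtain ⟨q₄, c4, m4, a4, r4, t4, -⟩ := exists_inverse_of_strictMonoOn_Ici hG.continuous hW.mono₄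
    hG.tendsto_atTop
  obtain ⟨q₁, c1, m1, a1, r1, t1, -⟩ := exists_inverse_of_strictMonoOn_Ici (K := fun q => G (-q))
    (a := -pm) (hG.continuous.comp continuous_neg)
    (fun x hx y hy hxy => hW.anti₁ (by simp only [mem_Iic, mem_Ici] at *; linarith)
      (by simp only [mem_Iic, mem_Ici] at *; linarith) (by linarith))
    (hG.tendsto_atBot.comp tendsto_neg_atTop_atBot)
  have hGc := hG.continuous
  have hpM := hW.pM_neg
  -- The branch on [pM, 0] is reflected to [0, -pM] and continued past -pM with slope one.
  obtain ⟨q₃, c3, m3, a3, r3, -, l3⟩ := exists_inverse_of_strictMonoOn_Ici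
    (K := fun q => G (-(min q (-pM))) + max (q + pM) 0)
    (a := 0) (by fun_prop) (by
      intro x hx y hy hxy
      simp only [mem_Ici] at hx hy
      simp only
      rcases le_or_gt x (-pM) with h1 | h1
      · rw [min_eq_left h1, max_eq_right (by linarith)]
        rcases le_or_gt y (-pM) with h2 | h2
        · rw [min_eq_left h2, max_eq_right (by linarith)]
          have := hW.anti₃ (a := -y) (b := -x) ⟨by linarith, by linarith⟩
            ⟨by linarith, by linarith⟩ (by linarith)
          linarith
        · rw [min_eq_right h2.le, max_eq_left (by linarith), neg_neg]
          have := hW.anti₃.antitoneOn (a := pM) (b := -x) ⟨by linarith, by linarith⟩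
            ⟨by linarith, by linarith⟩ (by linarith)
          linarith
      · rw [min_eq_right h1.le, max_eq_left (by linarith), min_eq_right (by linarith),
          max_eq_left (by linarith)]
        linarith) (by
      have : Tendsto (fun q : ℝ => q + pM) atTop atTop := tendsto_atTop_add_const_right _ _ tendsto_id
      refine tendsto_atTop_mono (fun q => ?_) this
      have := hW.nonneg (-(min q (-pM)))
      have := le_max_left (q + pM) 0
      linarith)
  have hK0 : G (-(min 0 (-pM))) + max (0 + pM) 0 = 0 := by
    rw [min_eq_left (by linarith), max_eq_right (by linarith), neg_zero, hW.map_zero, add_zero]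
  have hKM : G (-(min (-pM) (-pM))) + max (-pM + pM) 0 = M := by
    simp [hW.map_pM]
  have h3M : q₃ M = -pM := by
    have := l3 (-pM) (by linarith)
    simp only [hKM] at this
    exact this
  refine ⟨fun v => -q₁ v, fun v => -q₃ v, q₄, ⟨c1.neg, c3.neg, c4, m1.neg, m3.neg, m4, ?_, ?_, ?_,
    ?_, ?_, ?_, ?_, ?_, t4⟩⟩
  · intro v hv
    exact r1 v (by rw [neg_neg, hW.map_pm]; exact hv)
  · intro v hv hvM
    have h := r3 v (by rw [hK0]; exact hv)
    have h2 : q₃ v ≤ -pM := by rw [← h3M]; exact m3.monotone hvM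
    rw [min_eq_left h2, max_eq_right (by linarith), add_zero] at h
    exact h
  · intro v hv
    exact r4 v (by rw [hW.map_zero]; exact hv)
  · simp only [neg_neg, hW.map_pm] at a1
    simp [a1]
  · simp [h3M]
  · simp only [hK0] at a3
    simp [a3]
  · rw [hW.map_zero] at a4; exact a4
  · exact tendsto_neg_atTop_atBot.comp t1

section BranchBounds

variable {G : ℝ → ℝ} {m M pm pM : ℝ} {p₁ p₃ p₄ : ℝ → ℝ}

/-- For the concave kink of an upcrossing: the interval from `p₁ M` to pM is the left well filled up
to its rim M. -/
theorem InverseBranches.le_of_mem_kink_down (hB : InverseBranches G m M pm pM p₁ p₃ p₄)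
    (hW : IsDoubleWell G m M pm pM) {q : ℝ} (h1 : p₁ M ≤ q) (h2 : q ≤ p₃ M) : G q ≤ M := by
  rw [hB.map₃] at h2
  rcases le_total q pm with h | h
  · have := hW.anti₁.antitoneOn (h1.trans h : p₁ M ≤ pm) h h1
    rwa [hB.right_inv₁ M hW.m_lt_M.le] at this
  · have := hW.mono₂.monotoneOn ⟨h, h2⟩ ⟨hW.pm_lt_pM.le, le_rfl⟩ h2
    rwa [hW.map_pM] at this

/-- For the convex kink of a downcrossing: the interval from pm to `p₃ m` passes over the hump at pM
and ends where G is back at m. -/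
theorem InverseBranches.le_of_mem_kink_up (hB : InverseBranches G m M pm pM p₁ p₃ p₄)
    (hW : IsDoubleWell G m M pm pM) {q : ℝ} (h1 : p₁ m ≤ q) (h2 : q ≤ p₃ m) : m ≤ G q := by
  rw [hB.map₁] at h1
  rcases le_total q pM with h | h
  · have := hW.mono₂.monotoneOn ⟨le_rfl, hW.pm_lt_pM.le⟩ ⟨h1, h⟩ h1
    rwa [hW.map_pm] at this
  · have h3 : p₃ m ≤ 0 := by rw [← hB.map₃_zero]; exact hB.anti₃.antitone hW.m_nonneg
    have := hW.anti₃.antitoneOn ⟨h, h2.trans h3⟩ ⟨h.trans h2, h3⟩ h2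
    rwa [hB.right_inv₃ m hW.m_nonneg hW.m_lt_M.le] at this

theorem InverseBranches.mem_Icc₁ (hB : InverseBranches G m M pm pM p₁ p₃ p₄)
    (hW : IsDoubleWell G m M pm pM) {q v w : ℝ} (hv : m ≤ v) (h1 : p₁ w ≤ q) (h2 : q ≤ p₁ v)
    : v ≤ G q ∧ G q ≤ w := by
  have hvw : v ≤ w := hB.anti₁.le_iff_ge.1 (h1.trans h2)
  have h3 : p₁ v ≤ pm := by rw [← hB.map₁]; exact hB.anti₁.antitone hv
  constructor
  · have := hW.anti₁.antitoneOn (h2.trans h3 : q ≤ pm) h3 h2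
    rwa [hB.right_inv₁ v hv] at this
  · have := hW.anti₁.antitoneOn ((h1.trans h2).trans h3 : p₁ w ≤ pm) (h2.trans h3 : q ≤ pm) h1
    rwa [hB.right_inv₁ w (hv.trans hvw)] at this

theorem InverseBranches.mem_Icc₃ (hB : InverseBranches G m M pm pM p₁ p₃ p₄)
    (hW : IsDoubleWell G m M pm pM) {q v w : ℝ} (hv : 0 ≤ v) (hw : w ≤ M) (h1 : p₃ w ≤ q)
    (h2 : q ≤ p₃ v) : v ≤ G q ∧ G q ≤ w := by
  have hvw : v ≤ w := hB.anti₃.le_iff_ge.1 (h1.trans h2)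
  have h3 : p₃ v ≤ 0 := by rw [← hB.map₃_zero]; exact hB.anti₃.antitone hv
  have h4 : pM ≤ p₃ w := by rw [← hB.map₃]; exact hB.anti₃.antitone hw
  constructor
  · have := hW.anti₃.antitoneOn ⟨h4.trans h1, h2.trans h3⟩ ⟨h4.trans (h1.trans h2), h3⟩ h2
    rwa [hB.right_inv₃ v hv (hvw.trans hw)] at this
  · have := hW.anti₃.antitoneOn ⟨h4, (h1.trans h2).trans h3⟩ ⟨h4.trans h1, h2.trans h3⟩ h1
    rwa [hB.right_inv₃ w (hv.trans hvw) hw] at this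

theorem InverseBranches.mem_Icc₄ (hB : InverseBranches G m M pm pM p₁ p₃ p₄)
    (hW : IsDoubleWell G m M pm pM) {q v w : ℝ} (hv : 0 ≤ v) (h1 : p₄ v ≤ q)
    (h2 : q ≤ p₄ w) : v ≤ G q ∧ G q ≤ w := by
  have hvw : v ≤ w := hB.mono₄.le_iff_le.1 (h1.trans h2)
  have h3 : 0 ≤ p₄ v := by rw [← hB.map₄]; exact hB.mono₄.monotone hv
  constructor
  · have := hW.mono₄.monotoneOn h3 (h3.trans h1 : 0 ≤ q) h1
    rwa [hB.right_inv₄ v hv] at this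
  · have := hW.mono₄.monotoneOn (h3.trans h1 : 0 ≤ q) ((h3.trans h1).trans h2 : 0 ≤ p₄ w) h2
    rwa [hB.right_inv₄ w (hv.trans hvw)] at this

theorem InverseBranches.le_of_mem_Icc₃₄ (hB : InverseBranches G m M pm pM p₁ p₃ p₄)
    (hW : IsDoubleWell G m M pm pM) {q v : ℝ} (hvM : v ≤ M) (h1 : p₃ v ≤ q)
    (h2 : q ≤ p₄ v) : G q ≤ v := by
  rcases le_total q 0 with h | h
  · exact (hB.mem_Icc₃ hW le_rfl hvM h1 (by rwa [hB.map₃_zero])).2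
  · exact (hB.mem_Icc₄ hW le_rfl (by rwa [hB.map₄]) h2).2

end BranchBounds

/-! ### The high phase of a path -/

/-- The set of times at which the path `f` has exceeded `M` after its last visit to `(-∞, m]`. -/
def highSet (m M : ℝ) (f : ℝ → ℝ) : Set ℝ :=
  {x | ∃ s ≤ x, M < f s ∧ ∀ r ∈ Icc s x, m < f r}

section HighSet

variable {m M : ℝ} {f : ℝ → ℝ}

theorem mem_highSet_of_lt (hmM : m < M) {x : ℝ} (h : M < f x) : x ∈ highSet m M f :=
  ⟨x, le_rfl, h, fun r hr => by rw [le_antisymm hr.2 hr.1]; linarith⟩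

theorem lt_of_mem_highSet {x : ℝ} (h : x ∈ highSet m M f) : m < f x := by
  obtain ⟨s, hs, -, h⟩ := h
  exact h x ⟨hs, le_rfl⟩

theorem mem_highSet_extend {x y : ℝ} (hx : x ∈ highSet m M f) (hxy : x ≤ y)
    (h : ∀ r ∈ Icc x y, m < f r) : y ∈ highSet m M f := by
  obtain ⟨s, hs, hM, hr⟩ := hx
  refine ⟨s, hs.trans hxy, hM, fun r hr' => ?_⟩
  rcases le_total r x with h1 | h1
  · exact hr r ⟨hr'.1, h1⟩
  · exact h r ⟨h1, hr'.2⟩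

theorem mem_highSet_retract {x y : ℝ} (hx : x ∈ highSet m M f) (hyx : y ≤ x)
    (h : ∀ r ∈ Icc y x, f r ≤ M) : y ∈ highSet m M f := by
  obtain ⟨s, hs, hM, hr⟩ := hx
  have hsy : s ≤ y := by
    by_contra hlt
    push Not at hlt
    have := h s ⟨hlt.le, hs⟩
    linarith
  exact ⟨s, hsy, hM, fun r hr' => hr r ⟨hr'.1, hr'.2.trans hyx⟩⟩

theorem highSet_subset_of_le {g : ℝ → ℝ} (h : ∀ x, f x ≤ g x) : highSet m M f ⊆ highSet m M g := by
  rintro x ⟨s, hs, hM, hr⟩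
  exact ⟨s, hs, hM.trans_le (h s), fun r hr' => (hr r hr').trans_le (h r)⟩

theorem exists_Ioo_of_eventually_nhds {p : ℝ → Prop} {x : ℝ} (h : ∀ᶠ y in 𝓝 x, p y) :
    ∃ ρ > 0, ∀ y, |y - x| < ρ → p y := by
  obtain ⟨ρ, hρ, h⟩ := Metric.eventually_nhds_iff.1 h
  exact ⟨ρ, hρ, fun y hy => h (by rwa [Real.dist_eq])⟩

theorem isOpen_highSet (hf : Continuous f) (hmM : m < M) : IsOpen (highSet m M f) := by
  rw [isOpen_iff_mem_nhds]
  intro x hx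
  obtain ⟨ρ, hρ, h⟩ := exists_Ioo_of_eventually_nhds
    (hf.continuousAt.eventually (lt_mem_nhds (lt_of_mem_highSet hx)))
  obtain ⟨s, hs, hM, hr⟩ := hx
  obtain ⟨s', hs', hM', hr'⟩ : ∃ s' < x, M < f s' ∧ ∀ r ∈ Icc s' x, m < f r := by
    rcases hs.eq_or_lt with h0 | h0
    · subst h0
      obtain ⟨ρ', hρ', h'⟩ := exists_Ioo_of_eventually_nhds (hf.continuousAt.eventually (lt_mem_nhds hM))
      refine ⟨s - ρ' / 2, by linarith, h' _ ?_, fun r hr => ?_⟩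
      · rw [abs_lt]; constructor <;> linarith
      · have := h' r (by rw [abs_lt]; constructor <;> linarith [hr.1, hr.2])
        linarith
    · exact ⟨s, h0, hM, hr⟩
  have h1 : ∀ᶠ y in 𝓝 x, |y - x| < ρ ∧ s' < y := by
    have hc : Continuous fun y => |y - x| := by fun_prop
    exact (hc.continuousAt.eventually (gt_mem_nhds (by simpa using hρ))).and (lt_mem_nhds hs')
  filter_upwards [h1] with y hy
  refine ⟨s', hy.2.le, hM', fun r hrr => ?_⟩
  rcases le_total r x with h2 | h2
  · exact hr' r ⟨hrr.1, h2⟩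
  · refine h r ?_
    have := (abs_lt.1 hy.1).2
    rw [abs_lt]; constructor <;> linarith [hrr.2]

/-- The phase does not oscillate at a point, so one-sided limits of the selection exist. If f x > m,
a nearby high phase to the right cannot end; if f x ≤ m, then f stays below M nearby and no high
phase can begin. -/
theorem eventually_right_highSet (hf : Continuous f) (hmM : m < M) (x : ℝ) :
    (∀ᶠ y in 𝓝[>] x, y ∈ highSet m M f) ∨ ∀ᶠ y in 𝓝[>] x, y ∉ highSet m M f := by
  by_cases hx : x ∈ highSet m M f
  · exact Or.inl (nhdsWithin_le_nhds ((isOpen_highSet hf hmM).mem_nhds hx))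
  by_cases hm : m < f x
  · obtain ⟨ρ, hρ, h⟩ := exists_Ioo_of_eventually_nhds (hf.continuousAt.eventually (lt_mem_nhds hm))
    by_cases hex : ∃ z ∈ Ioo x (x + ρ), z ∈ highSet m M f
    · -- the path is above `m` on `(x, x + ρ)`: once high, it stays high
      by_cases hfreq : ∀ᶠ y in 𝓝[>] x, y ∉ highSet m M f
      · exact Or.inr hfreq
      · left
        have hfr : ∃ᶠ y in 𝓝[>] x, y ∈ highSet m M f := hfreq
        filter_upwards [Ioo_mem_nhdsGT (show x < x + ρ by linarith)] with y hy
        obtain ⟨z, hz, hzy⟩ := (hfr.and_eventually (Ioo_mem_nhdsGT hy.1)).exists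
        refine mem_highSet_extend hz hzy.2.le fun r hr => h r ?_
        rw [abs_lt]; constructor <;> linarith [hr.1, hr.2, hzy.1, hy.2]
    · right
      filter_upwards [Ioo_mem_nhdsGT (show x < x + ρ by linarith)] with y hy hyh
      exact hex ⟨y, hy, hyh⟩
  · right
    have hfM : f x < M := by linarith
    obtain ⟨ρ, hρ, h⟩ := exists_Ioo_of_eventually_nhds (hf.continuousAt.eventually (gt_mem_nhds hfM))
    filter_upwards [Ioo_mem_nhdsGT (show x < x + ρ by linarith)] with y hy hyh
    refine hx (mem_highSet_retract hyh hy.1.le fun r hr => (h r ?_).le)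
    rw [abs_lt]; constructor <;> linarith [hr.1, hr.2, hy.2]

theorem eventually_left_highSet (hf : Continuous f) (hmM : m < M) (x : ℝ) :
    (∀ᶠ y in 𝓝[<] x, y ∈ highSet m M f) ∨ ∀ᶠ y in 𝓝[<] x, y ∉ highSet m M f := by
  by_cases hx : x ∈ highSet m M f
  · exact Or.inl (nhdsWithin_le_nhds ((isOpen_highSet hf hmM).mem_nhds hx))
  by_cases hm : m < f x
  · right
    obtain ⟨ρ, hρ, h⟩ := exists_Ioo_of_eventually_nhds (hf.continuousAt.eventually (lt_mem_nhds hm))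
    filter_upwards [Ioo_mem_nhdsLT (show x - ρ < x by linarith)] with y hy hyh
    refine hx (mem_highSet_extend hyh hy.2.le fun r hr => h r ?_)
    rw [abs_lt]; constructor <;> linarith [hr.1, hr.2, hy.1]
  · have hfM : f x < M := by linarith
    obtain ⟨ρ, hρ, h⟩ := exists_Ioo_of_eventually_nhds (hf.continuousAt.eventually (gt_mem_nhds hfM))
    by_cases hfreq : ∀ᶠ y in 𝓝[<] x, y ∉ highSet m M f
    · exact Or.inr hfreq
    · left
      have hfr : ∃ᶠ y in 𝓝[<] x, y ∈ highSet m M f := hfreq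
      filter_upwards [Ioo_mem_nhdsLT (show x - ρ < x by linarith)] with y hy
      obtain ⟨z, hz, hzy⟩ := (hfr.and_eventually (Ioo_mem_nhdsLT hy.2)).exists
      refine mem_highSet_retract hz hzy.1.le fun r hr => (h r ?_).le
      rw [abs_lt]; constructor <;> linarith [hr.1, hr.2, hzy.2, hy.1]

/-- Above M the path would already be high just before x; below M it could not become high just
after x. -/
theorem eq_of_upcrossing (hf : Continuous f) (hmM : m < M) {x : ℝ}
    (hl : ∀ᶠ y in 𝓝[<] x, y ∉ highSet m M f) (hr : ∀ᶠ y in 𝓝[>] x, y ∈ highSet m M f) :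
    f x = M := by
  refine le_antisymm ?_ ?_
  · refine le_of_tendsto (hf.continuousAt.tendsto.mono_left (nhdsWithin_le_nhds (s := Iio x))) ?_
    filter_upwards [hl] with y hy
    by_contra hlt
    exact hy (mem_highSet_of_lt hmM (not_le.1 hlt))
  · by_contra hlt
    push Not at hlt
    obtain ⟨ρ, hρ, h⟩ := exists_Ioo_of_eventually_nhds (hf.continuousAt.eventually (gt_mem_nhds hlt))
    obtain ⟨y, hy, hyx⟩ := (hl.and (Ioo_mem_nhdsLT (show x - ρ < x by linarith))).exists
    obtain ⟨z, hz, hzx⟩ := (hr.and (Ioo_mem_nhdsGT (show x < x + ρ by linarith))).exists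
    refine hy (mem_highSet_retract hz (hyx.2.trans hzx.1).le fun r hr => (h r ?_).le)
    rw [abs_lt]; constructor <;> linarith [hr.1, hr.2, hyx.1, hzx.2]

theorem eq_of_downcrossing (hf : Continuous f) {x : ℝ}
    (hl : ∀ᶠ y in 𝓝[<] x, y ∈ highSet m M f) (hr : ∀ᶠ y in 𝓝[>] x, y ∉ highSet m M f) :
    f x = m := by
  refine le_antisymm ?_ ?_
  · by_contra hlt
    push Not at hlt
    obtain ⟨ρ, hρ, h⟩ := exists_Ioo_of_eventually_nhds (hf.continuousAt.eventually (lt_mem_nhds hlt))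
    obtain ⟨y, hy, hyx⟩ := (hl.and (Ioo_mem_nhdsLT (show x - ρ < x by linarith))).exists
    obtain ⟨z, hz, hzx⟩ := (hr.and (Ioo_mem_nhdsGT (show x < x + ρ by linarith))).exists
    refine hz (mem_highSet_extend hy (hyx.2.trans hzx.1).le fun r hr => h r ?_)
    rw [abs_lt]; constructor <;> linarith [hr.1, hr.2, hyx.1, hzx.2]
  · refine ge_of_tendsto (hf.continuousAt.tendsto.mono_left (nhdsWithin_le_nhds (s := Iio x))) ?_
    filter_upwards [hl] with y hy using (lt_of_mem_highSet hy).le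

theorem le_of_eventually_notMem_highSet (hf : Continuous f) (hmM : m < M) {x : ℝ} {l : Filter ℝ}
    [l.NeBot] (hl : l ≤ 𝓝 x) (h : ∀ᶠ y in l, y ∉ highSet m M f) : f x ≤ M := by
  refine le_of_tendsto (hf.continuousAt.tendsto.mono_left hl) ?_
  filter_upwards [h] with y hy
  by_contra hlt
  exact hy (mem_highSet_of_lt hmM (not_le.1 hlt))

theorem le_of_eventually_mem_highSet (hf : Continuous f) {x : ℝ} {l : Filter ℝ}
    [l.NeBot] (hl : l ≤ 𝓝 x) (h : ∀ᶠ y in l, y ∈ highSet m M f) : m ≤ f x := by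
  refine ge_of_tendsto (hf.continuousAt.tendsto.mono_left hl) ?_
  filter_upwards [h] with y hy using (lt_of_mem_highSet hy).le

end HighSet

/-! ### Gradient selections and their primitives -/

open scoped Classical in
/-- The gradient selection on the negative branches: `p₁` in the high phase of `f`, else `p₃`. -/
noncomputable def negSelection (p₁ p₃ : ℝ → ℝ) (m M : ℝ) (f : ℝ → ℝ) (x : ℝ) : ℝ :=
  if x ∈ highSet m M f then p₁ (f x) else p₃ (f x)

/-- The primitive vanishing at `0`. -/
noncomputable def primitive (s : ℝ → ℝ) (x : ℝ) : ℝ := ∫ t in (0 : ℝ)..x, s t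

section Primitive

variable {s : ℝ → ℝ} {K : ℝ}

theorem intervalIntegrable_of_bounded (hs : Measurable s) (hK : ∀ x, |s x| ≤ K) (a b : ℝ) :
    IntervalIntegrable s volume a b :=
  (intervalIntegrable_const (c := K)).mono_fun hs.aestronglyMeasurable
    (ae_of_all _ fun x => by
      simp only [Real.norm_eq_abs]; exact (hK x).trans (le_abs_self K))

theorem primitive_sub (hs : Measurable s) (hK : ∀ x, |s x| ≤ K) (a b : ℝ) :
    primitive s b - primitive s a = ∫ t in a..b, s t :=
  intervalIntegral.integral_interval_sub_left (intervalIntegrable_of_bounded hs hK _ _)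
    (intervalIntegrable_of_bounded hs hK _ _)

theorem primitive_lip (hs : Measurable s) (hK : ∀ x, |s x| ≤ K) (x y : ℝ) :
    |primitive s x - primitive s y| ≤ K * |x - y| := by
  rw [primitive_sub hs hK]
  have := intervalIntegral.norm_integral_le_of_norm_le_const (a := y) (b := x) (f := s) (C := K)
    (fun t _ => hK t)
  simpa using this

theorem primitive_hasDerivWithinAt_right (hs : Measurable s) (hK : ∀ x, |s x| ≤ K) {c x : ℝ}
    (h : Tendsto s (𝓝[>] x) (𝓝 c)) : HasDerivWithinAt (primitive s) c (Ioi x) x := by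
  have := intervalIntegral.integral_hasDerivWithinAt_of_tendsto_ae_right
    (intervalIntegrable_of_bounded hs hK 0 x) (s := Ici x) (t := Ioi x)
    (hs.stronglyMeasurable.stronglyMeasurableAtFilter) (h.mono_left inf_le_left)
  exact this.mono Ioi_subset_Ici_self

theorem primitive_hasDerivWithinAt_left (hs : Measurable s) (hK : ∀ x, |s x| ≤ K) {c x : ℝ}
    (h : Tendsto s (𝓝[<] x) (𝓝 c)) : HasDerivWithinAt (primitive s) c (Iio x) x := by
  have := intervalIntegral.integral_hasDerivWithinAt_of_tendsto_ae_right
    (intervalIntegrable_of_bounded hs hK 0 x) (s := Iic x) (t := Iic x)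
    -- The limit is needed only almost everywhere along `𝓝[≤] x`, and the point x itself is null.
    (hs.stronglyMeasurable.stronglyMeasurableAtFilter) (c := c) (by
      refine h.mono_left ?_
      have h1 : ({x}ᶜ : Set ℝ) ∈ ae (volume : Measure ℝ) := by
        rw [mem_ae_iff, compl_compl]; exact Real.volume_singleton
      rw [nhdsWithin, nhdsWithin, inf_assoc]
      refine inf_le_inf_left _ (le_principal_iff.2 ?_)
      filter_upwards [inter_mem_inf (mem_principal_self (Iic x)) h1] with y hy
      exact lt_of_le_of_ne hy.1 hy.2)
  exact this.mono Iio_subset_Iic_self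

theorem primitive_hasDerivAt (hs : Measurable s) (hK : ∀ x, |s x| ≤ K) {c x : ℝ} {t : ℝ → ℝ}
    (ht : ContinuousAt t x) (hc : t x = c) (h : ∀ᶠ y in 𝓝 x, s y = t y) :
    HasDerivAt (primitive s) c x := by
  have hcont : ContinuousAt s x := ht.congr (h.mono fun _ hy => hy.symm)
  have := intervalIntegral.integral_hasDerivAt_right (intervalIntegrable_of_bounded hs hK 0 x)
    hs.stronglyMeasurable.stronglyMeasurableAtFilter hcont
  rwa [h.self_of_nhds, hc] at this

end Primitive

section Selection

variable {G : ℝ → ℝ} {m M pm pM : ℝ} {p₁ p₃ p₄ f : ℝ → ℝ} {K : ℝ}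

theorem measurable_negSelection (hB : InverseBranches G m M pm pM p₁ p₃ p₄) (hf : Continuous f)
    (hmM : m < M) : Measurable (negSelection p₁ p₃ m M f) :=
  Measurable.ite (isOpen_highSet hf hmM).measurableSet (hB.cont₁.comp hf).measurable
    (hB.cont₃.comp hf).measurable

theorem abs_negSelection_le (h₁ : ∀ x, |p₁ (f x)| ≤ K) (h₃ : ∀ x, |p₃ (f x)| ≤ K) (x : ℝ) :
    |negSelection p₁ p₃ m M f x| ≤ K := by
  unfold negSelection
  split_ifs
  · exact h₁ x
  · exact h₃ x

theorem tendsto_negSelection_high (hB : InverseBranches G m M pm pM p₁ p₃ p₄)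
    (hf : Continuous f) {x : ℝ} {l : Filter ℝ} (hl : l ≤ 𝓝 x) (h : ∀ᶠ y in l, y ∈ highSet m M f) :
    Tendsto (negSelection p₁ p₃ m M f) l (𝓝 (p₁ (f x))) :=
  ((hB.cont₁.comp hf).continuousAt.tendsto.mono_left hl).congr' (by
    filter_upwards [h] with y hy
    rw [negSelection, if_pos hy, Function.comp])

theorem tendsto_negSelection_low (hB : InverseBranches G m M pm pM p₁ p₃ p₄)
    (hf : Continuous f) {x : ℝ} {l : Filter ℝ} (hl : l ≤ 𝓝 x) (h : ∀ᶠ y in l, y ∉ highSet m M f) :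
    Tendsto (negSelection p₁ p₃ m M f) l (𝓝 (p₃ (f x))) :=
  ((hB.cont₃.comp hf).continuousAt.tendsto.mono_left hl).congr' (by
    filter_upwards [h] with y hy
    rw [negSelection, if_neg hy, Function.comp])

/-- The primitive of the selection solves `G(F') = f` in the viscosity sense. -/
theorem primitive_negSelection_derivatives (hB : InverseBranches G m M pm pM p₁ p₃ p₄)
    (hW : IsDoubleWell G m M pm pM) (hf : Continuous f) (hf0 : ∀ x, 0 ≤ f x)
    (h₁ : ∀ x, |p₁ (f x)| ≤ K) (h₃ : ∀ x, |p₃ (f x)| ≤ K) (x : ℝ) :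
    ∃ l r, HasDerivWithinAt (primitive (negSelection p₁ p₃ m M f)) l (Iio x) x ∧
      HasDerivWithinAt (primitive (negSelection p₁ p₃ m M f)) r (Ioi x) x ∧
      (∀ q, l ≤ q → q ≤ r → f x ≤ G q) ∧ ∀ q, r ≤ q → q ≤ l → G q ≤ f x := by
  have hmM := hW.m_lt_M
  have hs := measurable_negSelection hB hf hmM
  have hK := abs_negSelection_le (m := m) (M := M) h₁ h₃
  have hlt := nhdsWithin_le_nhds (a := x) (s := Iio x)
  have hgt := nhdsWithin_le_nhds (a := x) (s := Ioi x)
  rcases eventually_left_highSet hf hmM x with hl | hl <;>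
    rcases eventually_right_highSet hf hmM x with hr | hr
  · have hfx := le_of_eventually_mem_highSet hf hgt hr
    refine ⟨_, _, primitive_hasDerivWithinAt_left hs hK (tendsto_negSelection_high hB hf hlt hl),
      primitive_hasDerivWithinAt_right hs hK (tendsto_negSelection_high hB hf hgt hr), ?_, ?_⟩
    · intro q h1 h2
      exact (hB.mem_Icc₁ hW hfx h1 h2).1
    · intro q h1 h2
      exact (hB.mem_Icc₁ hW hfx h1 h2).2
  -- The jump from `p₁ m` up to `p₃ m` is a convex kink: no slope q satisfies the subsolution test
  -- condition.
  · have hfx := eq_of_downcrossing hf hl hr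
    refine ⟨_, _, primitive_hasDerivWithinAt_left hs hK (tendsto_negSelection_high hB hf hlt hl),
      primitive_hasDerivWithinAt_right hs hK (tendsto_negSelection_low hB hf hgt hr), ?_, ?_⟩
    · intro q h1 h2
      rw [hfx] at h1 h2 ⊢
      exact hB.le_of_mem_kink_up hW h1 h2
    · intro q h1 h2
      rw [hfx] at h1 h2
      have h4 : p₁ m < p₃ m := by
        rw [hB.map₁]
        have : p₃ M ≤ p₃ m := hB.anti₃.antitone hmM.le
        rw [hB.map₃] at this
        exact hW.pm_lt_pM.trans_le this
      linarith
  -- The jump from `p₃ M` down to `p₁ M` is a concave kink: no slope q satisfies the supersolution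
  -- test condition.
  · have hfx := eq_of_upcrossing hf hmM hl hr
    refine ⟨_, _, primitive_hasDerivWithinAt_left hs hK (tendsto_negSelection_low hB hf hlt hl),
      primitive_hasDerivWithinAt_right hs hK (tendsto_negSelection_high hB hf hgt hr), ?_, ?_⟩
    · intro q h1 h2
      rw [hfx] at h1 h2
      have h4 : p₁ M < p₃ M := by
        rw [hB.map₃]
        have : p₁ M ≤ p₁ m := hB.anti₁.antitone hmM.le
        rw [hB.map₁] at this
        exact this.trans_lt hW.pm_lt_pM
      linarith
    · intro q h1 h2
      rw [hfx] at h1 h2 ⊢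
      exact hB.le_of_mem_kink_down hW h1 h2
  · have hfx := le_of_eventually_notMem_highSet hf hmM hgt hr
    refine ⟨_, _, primitive_hasDerivWithinAt_left hs hK (tendsto_negSelection_low hB hf hlt hl),
      primitive_hasDerivWithinAt_right hs hK (tendsto_negSelection_low hB hf hgt hr), ?_, ?_⟩
    · intro q h1 h2
      exact (hB.mem_Icc₃ hW (hf0 x) hfx h1 h2).1
    · intro q h1 h2
      exact (hB.mem_Icc₃ hW (hf0 x) hfx h1 h2).2

/-- Above M the path is in the high phase whatever its past, so the branch is known on a
neighbourhood. Such points, and those below m, are where left correctors can be glued. -/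
theorem primitive_negSelection_hasDerivAt_high (hB : InverseBranches G m M pm pM p₁ p₃ p₄)
    (hW : IsDoubleWell G m M pm pM) (hf : Continuous f)
    (h₁ : ∀ x, |p₁ (f x)| ≤ K) (h₃ : ∀ x, |p₃ (f x)| ≤ K) {x : ℝ} (hx : M < f x) :
    HasDerivAt (primitive (negSelection p₁ p₃ m M f)) (p₁ (f x)) x := by
  refine primitive_hasDerivAt (t := fun y => p₁ (f y)) (measurable_negSelection hB hf hW.m_lt_M)
    (abs_negSelection_le h₁ h₃) (hB.cont₁.comp hf).continuousAt rfl ?_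
  filter_upwards [(isOpen_highSet hf hW.m_lt_M).mem_nhds (mem_highSet_of_lt hW.m_lt_M hx)] with y hy
  rw [negSelection, if_pos hy]

theorem primitive_negSelection_hasDerivAt_low (hB : InverseBranches G m M pm pM p₁ p₃ p₄)
    (hW : IsDoubleWell G m M pm pM) (hf : Continuous f)
    (h₁ : ∀ x, |p₁ (f x)| ≤ K) (h₃ : ∀ x, |p₃ (f x)| ≤ K) {x : ℝ} (hx : f x < m) :
    HasDerivAt (primitive (negSelection p₁ p₃ m M f)) (p₃ (f x)) x := by
  refine primitive_hasDerivAt (t := fun y => p₃ (f y)) (measurable_negSelection hB hf hW.m_lt_M)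
    (abs_negSelection_le h₁ h₃) (hB.cont₃.comp hf).continuousAt rfl ?_
  filter_upwards [hf.continuousAt.eventually (gt_mem_nhds hx)] with y hy
  rw [negSelection, if_neg]
  intro h
  have := lt_of_mem_highSet h
  linarith

theorem primitive_pos_hasDerivAt (hB : InverseBranches G m M pm pM p₁ p₃ p₄) (hf : Continuous f)
    (h₄ : ∀ x, |p₄ (f x)| ≤ K) (x : ℝ) :
    HasDerivAt (primitive fun y => p₄ (f y)) (p₄ (f x)) x :=
  primitive_hasDerivAt (t := fun y => p₄ (f y)) (hB.cont₄.comp hf).measurable h₄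
    (hB.cont₄.comp hf).continuousAt rfl (Eventually.of_forall fun _ => rfl)

end Selection

/-! ### Correctors: exact ones, gluing and scaling -/

/-- Exact correctors at level `c`. -/
structure IsCorrector (G W F : ℝ → ℝ) (K c : ℝ) : Prop where
  lip : ∀ x y, |F x - F y| ≤ K * |x - y|
  deriv : ∀ y, ∃ l r, HasDerivWithinAt F l (Iio y) y ∧ HasDerivWithinAt F r (Ioi y) y ∧
    (∀ q, l ≤ q → q ≤ r → c ≤ G q + W y) ∧ ∀ q, r ≤ q → q ≤ l → G q + W y ≤ c

theorem IsCorrector.supercorrector {G W F : ℝ → ℝ} {K c c' : ℝ} (h : IsCorrector G W F K c)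
    (hc : c' ≤ c) : IsSupercorrector G W F K c' :=
  ⟨h.lip, fun y => by
    obtain ⟨l, r, hl, hr, h1, -⟩ := h.deriv y
    exact ⟨l, r, hl, hr, fun q hq hq' => hc.trans (h1 q hq hq')⟩⟩

theorem IsCorrector.subcorrector {G W F : ℝ → ℝ} {K c c' : ℝ} (h : IsCorrector G W F K c)
    (hc : c ≤ c') : IsSubcorrector G W F K c' :=
  ⟨h.lip, fun y => by
    obtain ⟨l, r, hl, hr, -, h1⟩ := h.deriv y
    exact ⟨l, r, hl, hr, fun q hq hq' => (h1 q hq hq').trans hc⟩⟩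

/-- `A - A z` on `(-∞, z]` and `B - B z` on `[z, ∞)`. -/
noncomputable def glueAt (A B : ℝ → ℝ) (z x : ℝ) : ℝ := if x ≤ z then A x - A z else B x - B z

section Glue

variable {A B : ℝ → ℝ} {z : ℝ}

theorem glueAt_lip {K : ℝ} (hA : ∀ x y, |A x - A y| ≤ K * |x - y|)
    (hB : ∀ x y, |B x - B y| ≤ K * |x - y|) (x y : ℝ) :
    |glueAt A B z x - glueAt A B z y| ≤ K * |x - y| := by
  have key : ∀ x y, x ≤ z → z < y → |glueAt A B z x - glueAt A B z y| ≤ K * |x - y| := by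
    intro x y hx hy
    rw [glueAt, glueAt, if_pos hx, if_neg (not_le.2 hy)]
    have e : |x - y| = |x - z| + |y - z| := by
      rw [abs_of_nonpos (by linarith), abs_of_nonpos (by linarith), abs_of_nonneg (by linarith)]
      ring
    rw [e, mul_add]
    refine (abs_sub _ _).trans (add_le_add (hA x z) (hB y z))
  rcases le_or_gt x z with hx | hx <;> rcases le_or_gt y z with hy | hy
  · simpa [glueAt, hx, hy] using hA x y
  · exact key x y hx hy
  · rw [abs_sub_comm, abs_sub_comm x]; exact key y x hy hx
  · simpa [glueAt, not_le.2 hx, not_le.2 hy] using hB x y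

theorem glueAt_left {l y : ℝ} (hy : y ≤ z) (h : HasDerivWithinAt A l (Iio y) y) :
    HasDerivWithinAt (glueAt A B z) l (Iio y) y := by
  refine (h.sub_const (A z)).congr (fun x hx => ?_) ?_
  · rw [glueAt, if_pos ((mem_Iio.1 hx).le.trans hy)]
  · rw [glueAt, if_pos hy]

theorem glueAt_right {r y : ℝ} (hy : z ≤ y) (h : HasDerivWithinAt B r (Ioi y) y) :
    HasDerivWithinAt (glueAt A B z) r (Ioi y) y := by
  refine (h.sub_const (B z)).congr (fun x hx => ?_) ?_
  · rw [glueAt, if_neg (not_le.2 (hy.trans_lt hx))]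
  · rcases hy.eq_or_lt with h0 | h0
    · rw [glueAt, if_pos h0.ge, h0]; simp
    · rw [glueAt, if_neg (not_le.2 h0)]

theorem glueAt_right_of_lt {r y : ℝ} (hy : y < z) (h : HasDerivWithinAt A r (Ioi y) y) :
    HasDerivWithinAt (glueAt A B z) r (Ioi y) y := by
  refine (h.sub_const (A z)).congr_of_eventuallyEq ?_ ?_
  · filter_upwards [nhdsWithin_le_nhds (gt_mem_nhds hy)] with x hx
    rw [glueAt, if_pos hx.le]
  · rw [glueAt, if_pos hy.le]

theorem glueAt_left_of_lt {l y : ℝ} (hy : z < y) (h : HasDerivWithinAt B l (Iio y) y) :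
    HasDerivWithinAt (glueAt A B z) l (Iio y) y := by
  refine (h.sub_const (B z)).congr_of_eventuallyEq ?_ ?_
  · filter_upwards [nhdsWithin_le_nhds (lt_mem_nhds hy)] with x hx
    rw [glueAt, if_neg (not_le.2 hx)]
  · rw [glueAt, if_neg (not_le.2 hy)]

/-- Away from z the test is inherited from A or B. At z the one-sided derivatives are a and b, so
`hq` is the only new condition, and it is vacuous for b < a. -/
theorem IsSupercorrector.glue {G W : ℝ → ℝ} {K c a b : ℝ} (hA : IsSupercorrector G W A K c)
    (hB : IsSupercorrector G W B K c) (ha : HasDerivAt A a z) (hb : HasDerivAt B b z)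
    (hq : ∀ q, a ≤ q → q ≤ b → c ≤ G q + W z) : IsSupercorrector G W (glueAt A B z) K c where
  lip := glueAt_lip hA.lip hB.lip
  super y := by
    rcases lt_trichotomy y z with hy | rfl | hy
    · obtain ⟨l, r, hl, hr, h⟩ := hA.super y
      exact ⟨l, r, glueAt_left hy.le hl, glueAt_right_of_lt hy hr, h⟩
    · exact ⟨a, b, glueAt_left le_rfl ha.hasDerivWithinAt, glueAt_right le_rfl hb.hasDerivWithinAt,
        hq⟩
    · obtain ⟨l, r, hl, hr, h⟩ := hB.super y
      exact ⟨l, r, glueAt_left_of_lt hy hl, glueAt_right hy.le hr, h⟩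

theorem IsSubcorrector.glue {G W : ℝ → ℝ} {K c a b : ℝ} (hA : IsSubcorrector G W A K c)
    (hB : IsSubcorrector G W B K c) (ha : HasDerivAt A a z) (hb : HasDerivAt B b z)
    (hq : ∀ q, b ≤ q → q ≤ a → G q + W z ≤ c) : IsSubcorrector G W (glueAt A B z) K c where
  lip := glueAt_lip hA.lip hB.lip
  sub y := by
    rcases lt_trichotomy y z with hy | rfl | hy
    · obtain ⟨l, r, hl, hr, h⟩ := hA.sub y
      exact ⟨l, r, glueAt_left hy.le hl, glueAt_right_of_lt hy hr, h⟩
    · exact ⟨a, b, glueAt_left le_rfl ha.hasDerivWithinAt, glueAt_right le_rfl hb.hasDerivWithinAt,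
        hq⟩
    · obtain ⟨l, r, hl, hr, h⟩ := hB.sub y
      exact ⟨l, r, glueAt_left_of_lt hy hl, glueAt_right hy.le hr, h⟩

end Glue

section Scale

variable {F : ℝ → ℝ} {ε : ℝ}

theorem scale_lip {K : ℝ} (hε : 0 < ε) (h : ∀ x y, |F x - F y| ≤ K * |x - y|) (x y : ℝ) :
    |ε * F (x / ε) - ε * F (y / ε)| ≤ K * |x - y| := by
  have := h (x / ε) (y / ε)
  rw [← mul_sub, abs_mul, abs_of_pos hε]
  rw [← sub_div, abs_div, abs_of_pos hε] at this
  calc ε * |F (x / ε) - F (y / ε)| ≤ ε * (K * (|x - y| / ε)) := by gcongr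
    _ = K * |x - y| := by field_simp

theorem scale_deriv {s t : Set ℝ} {d y : ℝ} (hε : 0 < ε) (hst : MapsTo (fun x => x / ε) s t)
    (h : HasDerivWithinAt F d t (y / ε)) :
    HasDerivWithinAt (fun x => ε * F (x / ε)) d s y := by
  have h1 : HasDerivWithinAt (fun x : ℝ => x / ε) (1 / ε) s y :=
    ((hasDerivAt_id y).div_const ε).hasDerivWithinAt
  refine ((HasDerivWithinAt.comp y h h1 hst).const_mul ε).congr_deriv ?_
  field_simp

theorem mapsTo_div_Iio (hε : 0 < ε) (y : ℝ) : MapsTo (fun x => x / ε) (Iio y) (Iio (y / ε)) :=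
  fun _ hx => mem_Iio.2 (div_lt_div_of_pos_right (mem_Iio.1 hx) hε)

theorem mapsTo_div_Ioi (hε : 0 < ε) (y : ℝ) : MapsTo (fun x => x / ε) (Ioi y) (Ioi (y / ε)) :=
  fun _ hx => mem_Ioi.2 (div_lt_div_of_pos_right (mem_Ioi.1 hx) hε)

theorem IsSupercorrector.scale {G W : ℝ → ℝ} {K c : ℝ} (hε : 0 < ε)
    (h : IsSupercorrector G W F K c) :
    IsSupercorrector G (fun x => W (x / ε)) (fun x => ε * F (x / ε)) K c where
  lip := scale_lip hε h.lip
  super y := by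
    obtain ⟨l, r, hl, hr, hq⟩ := h.super (y / ε)
    exact ⟨l, r, scale_deriv hε (mapsTo_div_Iio hε y) hl,
      scale_deriv hε (mapsTo_div_Ioi hε y) hr, hq⟩

theorem IsSubcorrector.scale {G W : ℝ → ℝ} {K c : ℝ} (hε : 0 < ε)
    (h : IsSubcorrector G W F K c) :
    IsSubcorrector G (fun x => W (x / ε)) (fun x => ε * F (x / ε)) K c where
  lip := scale_lip hε h.lip
  sub y := by
    obtain ⟨l, r, hl, hr, hq⟩ := h.sub (y / ε)
    exact ⟨l, r, scale_deriv hε (mapsTo_div_Iio hε y) hl,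
      scale_deriv hε (mapsTo_div_Ioi hε y) hr, hq⟩

end Scale

/-- `Φ` has asymptotic slope `θ` at `±∞`. -/
def HasSlope (Φ : ℝ → ℝ) (θ : ℝ) : Prop := ∀ δ > 0, ∃ C, ∀ x, |Φ x - θ * x| ≤ δ * |x| + C

/-- `T` meets every macroscopic interval, after rescaling. -/
def IsRecurrentSet (T : Set ℝ) : Prop :=
  ∀ x₀ : ℝ, ∀ ρ > 0, ∀ᶠ ε in 𝓝[>] (0 : ℝ), ∃ z ∈ T, |ε * z - x₀| < ρ

theorem HasSlope.neg {Φ : ℝ → ℝ} {θ : ℝ} (h : HasSlope Φ θ) : HasSlope (fun x => -Φ x) (-θ) := by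
  intro δ hδ
  obtain ⟨C, hC⟩ := h δ hδ
  refine ⟨C, fun x => ?_⟩
  rw [← abs_neg]; convert hC x using 2; ring

theorem eventually_mul_lt {C η : ℝ} (hη : 0 < η) : ∀ᶠ ε in 𝓝[>] (0 : ℝ), ε * C < η := by
  have h : Tendsto (fun ε : ℝ => ε * C) (𝓝[>] 0) (𝓝 0) := by
    have : Continuous fun ε : ℝ => ε * C := by fun_prop
    simpa using (this.tendsto 0).mono_left nhdsWithin_le_nhds
  exact h.eventually (gt_mem_nhds hη)

/-- If s vanished on a window of width ρ/ε around x₀/ε, its primitive would be constant there,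
whereas the slope c forces an increment cρ/ε up to an error that is small compared with 1/ε. -/
theorem isRecurrentSet_of_slope {s : ℝ → ℝ} {K c : ℝ} (hs : Measurable s) (hK : ∀ x, |s x| ≤ K)
    (hc : 0 < c) (h : HasSlope (primitive s) c) : IsRecurrentSet {x | s x ≠ 0} := by
  intro x₀ ρ hρ
  obtain ⟨δ, hδ, hδ2⟩ : ∃ δ, 0 < δ ∧ δ * (2 * (|x₀| + ρ)) < c * ρ / 2 := by
    refine ⟨c * ρ / (4 * (2 * (|x₀| + ρ))), by positivity, ?_⟩
    have : 0 < |x₀| + ρ := by positivity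
    have h0 : 0 < c * ρ := by positivity
    field_simp
    linarith
  obtain ⟨C, hC⟩ := h δ hδ
  filter_upwards [eventually_mul_lt (C := 2 * C) (show 0 < c * ρ / 2 by positivity),
    self_mem_nhdsWithin] with ε h1 hε
  have hε' : (0 : ℝ) < ε := hε
  by_contra hcon
  push Not at hcon
  have hzero : primitive s ((x₀ + ρ / 2) / ε) - primitive s ((x₀ - ρ / 2) / ε) = 0 := by
    rw [primitive_sub hs hK]
    refine intervalIntegral.integral_zero_ae (ae_of_all _ fun z hz => ?_)
    rw [uIoc_of_le (by gcongr; linarith)] at hz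
    by_contra hsz
    have h2 := hcon z hsz
    have h3 := hz.1
    have h4 := hz.2
    rw [div_lt_iff₀ hε'] at h3
    rw [le_div_iff₀ hε'] at h4
    have : |ε * z - x₀| ≤ ρ / 2 := by rw [abs_le]; constructor <;> linarith
    linarith
  have e1 := (abs_le.1 (hC ((x₀ + ρ / 2) / ε))).1
  have e2 := (abs_le.1 (hC ((x₀ - ρ / 2) / ε))).2
  have e3 : |(x₀ + ρ / 2) / ε| ≤ (|x₀| + ρ) / ε := by
    rw [abs_div, abs_of_pos hε']; gcongr
    refine (abs_add_le _ _).trans ?_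
    rw [abs_of_pos (by positivity : 0 < ρ / 2)]; linarith
  have e4 : |(x₀ - ρ / 2) / ε| ≤ (|x₀| + ρ) / ε := by
    rw [abs_div, abs_of_pos hε']; gcongr
    refine (abs_sub _ _).trans ?_
    rw [abs_of_pos (by positivity : 0 < ρ / 2)]; linarith
  have e5 : δ * |(x₀ + ρ / 2) / ε| ≤ δ * ((|x₀| + ρ) / ε) := by gcongr
  have e6 : δ * |(x₀ - ρ / 2) / ε| ≤ δ * ((|x₀| + ρ) / ε) := by gcongr
  have e7 : c * (ρ / ε) ≤ δ * (2 * (|x₀| + ρ)) / ε + 2 * C := by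
    have t1 : c * ((x₀ + ρ / 2) / ε) - c * ((x₀ - ρ / 2) / ε) = c * (ρ / ε) := by ring
    have t2 : δ * ((|x₀| + ρ) / ε) + δ * ((|x₀| + ρ) / ε) = δ * (2 * (|x₀| + ρ)) / ε := by ring
    linarith
  have e8 : c * ρ ≤ δ * (2 * (|x₀| + ρ)) + ε * (2 * C) := by
    have := mul_le_mul_of_nonneg_left e7 hε'.le
    have t1 : ε * (c * (ρ / ε)) = c * ρ := by field_simp
    have t2 : ε * (δ * (2 * (|x₀| + ρ)) / ε + 2 * C) = δ * (2 * (|x₀| + ρ)) + ε * (2 * C) := by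
      field_simp
    linarith
  linarith

theorem glueAt_neg (A B : ℝ → ℝ) (z x : ℝ) :
    glueAt (fun y => -A y) (fun y => -B y) z x = -glueAt A B z x := by
  unfold glueAt; split_ifs <;> ring

theorem glueAt_self (A B : ℝ → ℝ) (z : ℝ) : glueAt A B z z = 0 := by simp [glueAt]

theorem le_glueAt_of_slope {A B : ℝ → ℝ} {a b θ : ℝ} (hA : HasSlope A a) (hB : HasSlope B b)
    (ha : a ≤ θ) (hb : θ ≤ b) {δ : ℝ} (hδ : 0 < δ) :
    ∃ C, ∀ x z, θ * (x - z) - δ * (|x| + |z|) - C ≤ glueAt A B z x := by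
  obtain ⟨C, hC⟩ := hA δ hδ
  obtain ⟨D, hD⟩ := hB δ hδ
  have hC0 : 0 ≤ C := by have := (abs_nonneg _).trans (hC 0); simpa using this
  have hD0 : 0 ≤ D := by have := (abs_nonneg _).trans (hD 0); simpa using this
  refine ⟨2 * C + 2 * D, fun x z => ?_⟩
  unfold glueAt
  split_ifs with h
  · have h1 := (abs_le.1 (hC x)).1
    have h2 := (abs_le.1 (hC z)).2
    have h3 : 0 ≤ (θ - a) * (z - x) := mul_nonneg (by linarith) (by linarith)
    linarith
  · have h1 := (abs_le.1 (hD x)).1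
    have h2 := (abs_le.1 (hD z)).2
    have h3 : 0 ≤ (b - θ) * (x - z) := mul_nonneg (by linarith) (by linarith)
    linarith

/-- A slope a ≤ θ to the left of the kink and b ≥ θ to its right keep the glued function above the
line of slope θ, up to a sublinear error which rescaling makes small. The kink is at εz, within ρ of
x₀, so moving the base point from εz to x₀ costs at most (|θ| + K)ρ. -/
theorem eventually_le_scaled_glueAt {A B : ℝ → ℝ} {a b θ K x₀ : ℝ} {T : Set ℝ} (hK : 0 ≤ K)
    (lA : ∀ x y, |A x - A y| ≤ K * |x - y|) (lB : ∀ x y, |B x - B y| ≤ K * |x - y|)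
    (hA : HasSlope A a) (hB : HasSlope B b) (ha : a ≤ θ) (hb : θ ≤ b) (hT : IsRecurrentSet T)
    {η : ℝ} (hη : 0 < η) :
    ∀ᶠ ε in 𝓝[>] (0 : ℝ), ∃ z ∈ T, ∀ x, |x - x₀| ≤ 1 →
      θ * (x - x₀) - η ≤ ε * glueAt A B z (x / ε) - ε * glueAt A B z (x₀ / ε) := by
  obtain ⟨C, hC⟩ := le_glueAt_of_slope hA hB ha hb
    (show 0 < η / (8 * (|x₀| + 1)) by positivity)
  obtain ⟨ρ, hρ⟩ : ∃ ρ, ρ = min 1 (η / (4 * (|θ| + K + 1))) := ⟨_, rfl⟩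
  have hρ0 : 0 < ρ := by rw [hρ]; positivity
  have hρ1 : ρ ≤ 1 := hρ ▸ min_le_left _ _
  have hρ2 : (|θ| + K + 1) * ρ ≤ η / 4 := by
    have : ρ ≤ η / (4 * (|θ| + K + 1)) := hρ ▸ min_le_right _ _
    rw [le_div_iff₀ (by positivity)] at this
    linarith
  filter_upwards [hT x₀ ρ hρ0, eventually_mul_lt (C := C) (show 0 < η / 4 by positivity),
    self_mem_nhdsWithin] with ε ⟨z, hz, hzx⟩ h1 hε
  have hε' : (0 : ℝ) < ε := hε
  refine ⟨z, hz, fun x hx => ?_⟩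
  have h2 := mul_le_mul_of_nonneg_left (hC (x / ε) z) hε'.le
  have e2 : ε * (θ * (x / ε - z) - η / (8 * (|x₀| + 1)) * (|x / ε| + |z|) - C) =
      θ * (x - ε * z) - η / (8 * (|x₀| + 1)) * (|x| + |ε * z|) - ε * C := by
    rw [abs_div, abs_mul, abs_of_pos hε']; field_simp
  rw [e2] at h2
  have h3 := glueAt_lip lA lB (z := z) (x₀ / ε) z
  rw [glueAt_self, sub_zero] at h3
  have h4 : ε * glueAt A B z (x₀ / ε) ≤ K * ρ := by
    have h5 := mul_le_mul_of_nonneg_left ((le_abs_self _).trans h3) hε'.le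
    have e5 : ε * (K * |x₀ / ε - z|) = K * |ε * z - x₀| := by
      rw [abs_sub_comm, show ε * z - x₀ = ε * (z - x₀ / ε) by field_simp, abs_mul,
        abs_of_pos hε']; ring
    rw [e5] at h5
    exact h5.trans (mul_le_mul_of_nonneg_left hzx.le hK)
  have h6 : |x| ≤ |x₀| + 1 := by
    have := abs_sub_abs_le_abs_sub x x₀; linarith
  have h7 : |ε * z| ≤ |x₀| + 1 := by
    have := abs_sub_abs_le_abs_sub (ε * z) x₀; linarith
  have h8 : η / (8 * (|x₀| + 1)) * (|x| + |ε * z|) ≤ η / 4 := by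
    calc η / (8 * (|x₀| + 1)) * (|x| + |ε * z|)
        ≤ η / (8 * (|x₀| + 1)) * (2 * (|x₀| + 1)) := by gcongr; linarith
      _ = η / 4 := by field_simp; norm_num
  have h9 : θ * (ε * z - x₀) ≤ |θ| * ρ := by
    refine (le_abs_self _).trans ?_
    rw [abs_mul]
    exact mul_le_mul_of_nonneg_left hzx.le (abs_nonneg _)
  have h10 : θ * (x - ε * z) = θ * (x - x₀) - θ * (ε * z - x₀) := by ring
  linarith

theorem hasSupercorrectors_of_glue {G W : ℝ → ℝ} {θ c x₀ : ℝ}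
    (h : ∀ δ > 0, ∃ (A B : ℝ → ℝ) (a b K : ℝ) (T : Set ℝ), 0 ≤ K ∧
      (∀ x y, |A x - A y| ≤ K * |x - y|) ∧ (∀ x y, |B x - B y| ≤ K * |x - y|) ∧
      HasSlope A a ∧ HasSlope B b ∧ a ≤ θ ∧ θ ≤ b ∧ IsRecurrentSet T ∧
      ∀ z ∈ T, IsSupercorrector G W (glueAt A B z) K (c - δ)) :
    HasSupercorrectors G (fun ε x => W (x / ε)) x₀ θ c := by
  intro δ hδ
  obtain ⟨A, B, a, b, K, T, hK, lA, lB, hA, hB, ha, hb, hT, hz⟩ := h δ hδ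
  refine ⟨K, hK, fun η hη => ?_⟩
  filter_upwards [eventually_le_scaled_glueAt hK lA lB hA hB ha hb hT hη (x₀ := x₀),
    self_mem_nhdsWithin] with ε ⟨z, hzT, hx⟩ hε
  exact ⟨_, (hz z hzT).scale hε, hx⟩

theorem hasSubcorrectors_of_glue {G W : ℝ → ℝ} {θ c x₀ : ℝ}
    (h : ∀ δ > 0, ∃ (A B : ℝ → ℝ) (a b K : ℝ) (T : Set ℝ), 0 ≤ K ∧
      (∀ x y, |A x - A y| ≤ K * |x - y|) ∧ (∀ x y, |B x - B y| ≤ K * |x - y|) ∧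
      HasSlope A a ∧ HasSlope B b ∧ θ ≤ a ∧ b ≤ θ ∧ IsRecurrentSet T ∧
      ∀ z ∈ T, IsSubcorrector G W (glueAt A B z) K (c + δ)) :
    HasSubcorrectors G (fun ε x => W (x / ε)) x₀ θ c := by
  intro δ hδ
  obtain ⟨A, B, a, b, K, T, hK, lA, lB, hA, hB, ha, hb, hT, hz⟩ := h δ hδ
  refine ⟨K, hK, fun η hη => ?_⟩
  have key : ∀ F : ℝ → ℝ, (∀ x y, |F x - F y| ≤ K * |x - y|) →
      ∀ x y, |-F x - -F y| ≤ K * |x - y| := fun F hF x y => by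
    rw [← abs_neg]; convert hF x y using 2; ring
  filter_upwards [eventually_le_scaled_glueAt hK (key A lA) (key B lB) hA.neg hB.neg
    (neg_le_neg ha) (neg_le_neg hb) hT hη (x₀ := x₀), self_mem_nhdsWithin] with ε ⟨z, hzT, hx⟩ hε
  refine ⟨_, (hz z hzT).scale hε, fun x h1 => ?_⟩
  have := hx x h1
  simp only [glueAt_neg] at this
  linarith

/-! ### The effective Hamiltonian of a pair of slope functions -/

/-- Slopes of the decreasing and increasing families of correctors, parametrized by the level. -/
structure IsSlopePair (β : ℝ) (θL θR : ℝ → ℝ) : Prop where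
  anti : StrictAntiOn θL (Ici β)
  mono : StrictMonoOn θR (Ici β)
  left_nonpos : θL β ≤ 0
  right_nonneg : 0 ≤ θR β
  tendsto_left : Tendsto θL atTop atBot
  tendsto_right : Tendsto θR atTop atTop

/-- The smallest level whose correctors have slopes enclosing `θ`. -/
noncomputable def effHam (β : ℝ) (θL θR : ℝ → ℝ) (θ : ℝ) : ℝ :=
  sInf {l | β ≤ l ∧ θL l ≤ θ ∧ θ ≤ θR l}

section EffHam

variable {β : ℝ} {θL θR : ℝ → ℝ}

theorem IsSlopePair.left_le_right (h : IsSlopePair β θL θR) {l : ℝ} (hl : β ≤ l) :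
    θL l ≤ 0 ∧ 0 ≤ θR l :=
  ⟨(h.anti.antitoneOn self_mem_Ici hl hl).trans h.left_nonpos,
    h.right_nonneg.trans (h.mono.monotoneOn self_mem_Ici hl hl)⟩

theorem IsSlopePair.exists_level (h : IsSlopePair β θL θR) (θ : ℝ) :
    ∃ l, β ≤ l ∧ θL l ≤ θ ∧ θ ≤ θR l :=
  ((eventually_ge_atTop β).and ((h.tendsto_left.eventually_le_atBot θ).and
    (h.tendsto_right.eventually_ge_atTop θ))).exists

theorem effHam_le {θ l : ℝ} (h1 : β ≤ l) (h2 : θL l ≤ θ) (h3 : θ ≤ θR l) :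
    effHam β θL θR θ ≤ l :=
  csInf_le ⟨β, fun _ h => h.1⟩ ⟨h1, h2, h3⟩

theorem IsSlopePair.le_effHam (h : IsSlopePair β θL θR) (θ : ℝ) : β ≤ effHam β θL θR θ :=
  le_csInf (h.exists_level θ) fun _ h => h.1

/-- Some level below l encloses θ, and strict monotonicity of the slopes makes the enclosure at l
strict. -/
theorem IsSlopePair.of_effHam_lt (h : IsSlopePair β θL θR) {θ l : ℝ} (hl : effHam β θL θR θ < l) :
    β < l ∧ θL l < θ ∧ θ < θR l := by
  obtain ⟨k, ⟨h1, h2, h3⟩, hk⟩ := exists_lt_of_csInf_lt (h.exists_level θ) hl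
  exact ⟨h1.trans_lt hk, (h.anti h1 (h1.trans hk.le : β ≤ l) hk).trans_le h2,
    h3.trans_lt (h.mono h1 (h1.trans hk.le : β ≤ l) hk)⟩

theorem lt_or_lt_of_lt_effHam {θ l : ℝ} (hβ : β ≤ l)
    (hl : l < effHam β θL θR θ) : θ < θL l ∨ θR l < θ := by
  by_contra hcon
  push Not at hcon
  exact absurd (effHam_le hβ hcon.1 hcon.2) (not_le.2 hl)

theorem IsSlopePair.le_effHam_of (h : IsSlopePair β θL θR) {θ l : ℝ} (hl : θ < θL l ∨ θR l < θ) :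
    l ≤ effHam β θL θR θ := by
  by_contra hcon
  have := h.of_effHam_lt (not_le.1 hcon)
  rcases hl with hl | hl <;> linarith

/-- Values above or below a bound are certified by strict inequalities between θ and the slopes at
an intermediate level, and these are open in θ. Continuity of the slope functions is not needed:
jumps of θL become flat pieces. -/
theorem IsSlopePair.isContinuousCoercive (h : IsSlopePair β θL θR) :
    IsContinuousCoercive (effHam β θL θR) where
  continuous := by
    refine continuous_iff_continuousAt.2 fun θ => tendsto_order.2 ⟨fun a ha => ?_, fun a ha => ?_⟩
    · rcases lt_or_ge a β with hab | hab
      · exact Eventually.of_forall fun x => hab.trans_le (h.le_effHam x)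
      obtain ⟨b, hb, hb'⟩ := exists_between ha
      rcases lt_or_lt_of_lt_effHam (hab.trans hb.le) hb' with h1 | h1
      · filter_upwards [gt_mem_nhds h1] with x hx using hb.trans_le (h.le_effHam_of (Or.inl hx))
      · filter_upwards [lt_mem_nhds h1] with x hx using hb.trans_le (h.le_effHam_of (Or.inr hx))
    · obtain ⟨b, hb, hb'⟩ := exists_between ha
      obtain ⟨h1, h2, h3⟩ := h.of_effHam_lt hb
      filter_upwards [gt_mem_nhds h3, lt_mem_nhds h2] with x hx hx'
      exact (effHam_le h1.le hx'.le hx.le).trans_lt hb'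
  tendsto_atTop := tendsto_atTop.2 fun b => by
    filter_upwards [eventually_gt_atTop (θR b)] with x hx using h.le_effHam_of (Or.inr hx)
  tendsto_atBot := tendsto_atTop.2 fun b => by
    filter_upwards [eventually_lt_atBot (θL b)] with x hx using h.le_effHam_of (Or.inl hx)

end EffHam

/-! ### Correctors along a good path -/

/-- Paths on which all the spatial averages exist at rational levels, and which return near their
bounds at all macroscopic scales. -/
structure IsGoodPath (m M β : ℝ) (p₁ p₃ p₄ θL θR : ℝ → ℝ) (v : ℝ → ℝ) : Prop where
  cont : Continuous v
  nonneg : ∀ x, 0 ≤ v x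
  le_one : ∀ x, v x ≤ 1
  slope_left : ∀ q : ℚ, β ≤ q →
    HasSlope (primitive (negSelection p₁ p₃ m M fun x => q - β * v x)) (θL q)
  slope_right : ∀ q : ℚ, β ≤ q → HasSlope (primitive fun x => p₄ (q - β * v x)) (θR q)
  recurrent_low : ∀ η > 0, IsRecurrentSet {x | v x < η}
  recurrent_high : ∀ η > 0, IsRecurrentSet {x | 1 - η < v x}

section GoodPath

variable {G : ℝ → ℝ} {m M pm pM β : ℝ} {p₁ p₃ p₄ θL θR v : ℝ → ℝ}

theorem InverseBranches.exists_bound (hB : InverseBranches G m M pm pM p₁ p₃ p₄) (a b : ℝ) :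
    ∃ K, 0 ≤ K ∧ ∀ x ∈ Icc a b, |p₁ x| ≤ K ∧ |p₃ x| ≤ K ∧ |p₄ x| ≤ K := by
  have h1 := hB.cont₁
  have h3 := hB.cont₃
  have h4 := hB.cont₄
  obtain ⟨K, hK⟩ := (isCompact_Icc (a := a) (b := b)).exists_bound_of_continuousOn
    (f := fun x => |p₁ x| + |p₃ x| + |p₄ x|) (by fun_prop)
  refine ⟨max K 0, le_max_right _ _, fun x hx => ?_⟩
  have h := ((le_abs_self _).trans (hK x hx)).trans (le_max_left K 0)
  have a1 := abs_nonneg (p₁ x)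
  have a3 := abs_nonneg (p₃ x)
  have a4 := abs_nonneg (p₄ x)
  refine ⟨?_, ?_, ?_⟩ <;> linarith

theorem exists_isCorrector (hB : InverseBranches G m M pm pM p₁ p₃ p₄)
    (hW : IsDoubleWell G m M pm pM) (hβ : 0 < β) (hv : Continuous v) (hv0 : ∀ x, 0 ≤ v x)
    (hv1 : ∀ x, v x ≤ 1) (L : ℝ) :
    ∃ K, 0 ≤ K ∧ (∀ l x, β ≤ l → l ≤ L →
      |p₁ (l - β * v x)| ≤ K ∧ |p₃ (l - β * v x)| ≤ K ∧ |p₄ (l - β * v x)| ≤ K) ∧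
      ∀ l, β ≤ l → l ≤ L →
      IsCorrector G (fun x => β * v x)
        (primitive (negSelection p₁ p₃ m M fun x => l - β * v x)) K l ∧
      IsCorrector G (fun x => β * v x) (primitive fun x => p₄ (l - β * v x)) K l := by
  obtain ⟨K, hK0, hK⟩ := hB.exists_bound 0 L
  have hv' : ∀ l x, β ≤ l → l ≤ L → l - β * v x ∈ Icc 0 L := fun l x h1 h2 => by
    have e1 := mul_le_mul_of_nonneg_left (hv1 x) hβ.le
    have e2 := mul_nonneg hβ.le (hv0 x)
    constructor <;> linarith
  refine ⟨K, hK0, fun l x h1 h2 => hK _ (hv' l x h1 h2), fun l h1 h2 => ⟨?_, ?_⟩⟩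
  · have hf : Continuous fun x => l - β * v x := by fun_prop
    have k1 : ∀ x, |p₁ (l - β * v x)| ≤ K := fun x => (hK _ (hv' l x h1 h2)).1
    have k3 : ∀ x, |p₃ (l - β * v x)| ≤ K := fun x => (hK _ (hv' l x h1 h2)).2.1
    refine ⟨primitive_lip (measurable_negSelection hB hf hW.m_lt_M) (abs_negSelection_le k1 k3),
      fun y => ?_⟩
    obtain ⟨a, b, ha, hb, hq, hq'⟩ := primitive_negSelection_derivatives hB hW hf
      (fun x => (hv' l x h1 h2).1) k1 k3 y
    refine ⟨a, b, ha, hb, fun q e1 e2 => ?_, fun q e1 e2 => ?_⟩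
    · have := hq q e1 e2; linarith
    · have := hq' q e1 e2; linarith
  · have hf : Continuous fun x => l - β * v x := by fun_prop
    have k4 : ∀ x, |p₄ (l - β * v x)| ≤ K := fun x => (hK _ (hv' l x h1 h2)).2.2
    refine ⟨primitive_lip (hB.cont₄.comp hf).measurable k4, fun y => ?_⟩
    have hd := primitive_pos_hasDerivAt hB hf k4 y
    refine ⟨_, _, hd.hasDerivWithinAt, hd.hasDerivWithinAt, fun q e1 e2 => ?_, fun q e1 e2 => ?_⟩
    · rw [le_antisymm e2 e1, hB.right_inv₄ _ (hv' l y h1 h2).1]; linarith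
    · rw [le_antisymm e2 e1, hB.right_inv₄ _ (hv' l y h1 h2).1]; linarith

/-- One pair serves both purposes. A followed by B lies above the line of slope θ, and a convex kink
between them is tested as a supersolution. B followed by A lies below the line, and the same
gradient interval is tested as a subsolution. -/
theorem hasCorrectors_of_pair {W : ℝ → ℝ} {θ c x₀ : ℝ}
    (h : ∀ δ > 0, ∃ (A B : ℝ → ℝ) (a b lA lB K : ℝ) (T : Set ℝ), 0 ≤ K ∧
      IsCorrector G W A K lA ∧ IsCorrector G W B K lB ∧
      |lA - c| ≤ δ ∧ |lB - c| ≤ δ ∧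
      HasSlope A a ∧ HasSlope B b ∧ a ≤ θ ∧ θ ≤ b ∧ IsRecurrentSet T ∧
      ∀ z ∈ T, ∃ dA dB, HasDerivAt A dA z ∧ HasDerivAt B dB z ∧
        ∀ q, dA ≤ q → q ≤ dB → c - δ ≤ G q + W z ∧ G q + W z ≤ c + δ) :
    HasSupercorrectors G (fun ε x => W (x / ε)) x₀ θ c ∧
      HasSubcorrectors G (fun ε x => W (x / ε)) x₀ θ c := by
  constructor
  · refine hasSupercorrectors_of_glue fun δ hδ => ?_
    obtain ⟨A, B, a, b, lA, lB, K, T, hK, cA, cB, eA, eB, sA, sB, ha, hb, hT, hz⟩ := h δ hδ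
    rw [abs_le] at eA eB
    refine ⟨A, B, a, b, K, T, hK, cA.lip, cB.lip, sA, sB, ha, hb, hT, fun z hzT => ?_⟩
    obtain ⟨dA, dB, hdA, hdB, hq⟩ := hz z hzT
    exact (cA.supercorrector (by linarith)).glue (cB.supercorrector (by linarith)) hdA hdB
      fun q h1 h2 => (hq q h1 h2).1
  · refine hasSubcorrectors_of_glue fun δ hδ => ?_
    obtain ⟨A, B, a, b, lA, lB, K, T, hK, cA, cB, eA, eB, sA, sB, ha, hb, hT, hz⟩ := h δ hδ
    rw [abs_le] at eA eB
    refine ⟨B, A, b, a, K, T, hK, cB.lip, cA.lip, sB, sA, hb, ha, hT, fun z hzT => ?_⟩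
    obtain ⟨dA, dB, hdA, hdB, hq⟩ := hz z hzT
    exact (cB.subcorrector (by linarith)).glue (cA.subcorrector (by linarith)) hdB hdA
      fun q h1 h2 => (hq q h1 h2).2

/-- Just above c the slopes enclose θ; just below c they do not, so θ lies beyond θL or beyond θR
there. Accordingly the pair consists of two left correctors or of two right ones, at levels on
either side of c. At c = β there is no lower level, and a left corrector is paired with a right one
of the same level. -/
theorem IsGoodPath.hasCorrectors (hv : IsGoodPath m M β p₁ p₃ p₄ θL θR v)
    (hB : InverseBranches G m M pm pM p₁ p₃ p₄) (hW : IsDoubleWell G m M pm pM) (hβ : 0 < β)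
    (hmM : max β M < m + β) (hθ : IsSlopePair β θL θR) (x₀ θ : ℝ) :
    HasSupercorrectors G (fun ε x => β * v (x / ε)) x₀ θ (effHam β θL θR θ) ∧
      HasSubcorrectors G (fun ε x => β * v (x / ε)) x₀ θ (effHam β θL θR θ) := by
  obtain ⟨c, hc⟩ : ∃ c, c = effHam β θL θR θ := ⟨_, rfl⟩
  rw [← hc]
  have hβc : β ≤ c := hc ▸ hθ.le_effHam θ
  have hm0 : 0 < m := by have := (le_max_left β M).trans_lt hmM; linarith
  have hMm : M < m + β := (le_max_right β M).trans_lt hmM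
  have hmltM := hW.m_lt_M
  have hu1 := hv.le_one
  have hu0 := hv.nonneg
  refine hasCorrectors_of_pair (W := fun x => β * v x) fun δ hδ => ?_
  obtain ⟨K, hK0, hKb, hcor⟩ := exists_isCorrector hB hW hβ hv.cont hu0 hu1 (c + δ)
  have hf : ∀ l : ℝ, Continuous fun x => l - β * v x := fun l => by
    have := hv.cont; fun_prop
  have hpos : ∀ (l : ℝ) x, β ≤ l → 0 ≤ l - β * v x := fun l x hl => by
    have := mul_le_mul_of_nonneg_left (hu1 x) hβ.le; linarith
  have hdlow : ∀ (l : ℝ) z, β ≤ l → l ≤ c + δ → l - β * v z < m →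
      HasDerivAt (primitive (negSelection p₁ p₃ m M fun x => l - β * v x)) (p₃ (l - β * v z)) z :=
    fun l z h1 h2 h3 => primitive_negSelection_hasDerivAt_low hB hW (hf l)
      (fun x => (hKb l x h1 h2).1) (fun x => (hKb l x h1 h2).2.1) h3
  have hdhigh : ∀ (l : ℝ) z, β ≤ l → l ≤ c + δ → M < l - β * v z →
      HasDerivAt (primitive (negSelection p₁ p₃ m M fun x => l - β * v x)) (p₁ (l - β * v z)) z :=
    fun l z h1 h2 h3 => primitive_negSelection_hasDerivAt_high hB hW (hf l)
      (fun x => (hKb l x h1 h2).1) (fun x => (hKb l x h1 h2).2.1) h3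
  have hdpos : ∀ (l : ℝ) z, β ≤ l → l ≤ c + δ →
      HasDerivAt (primitive fun x => p₄ (l - β * v x)) (p₄ (l - β * v z)) z :=
    fun l z h1 h2 => primitive_pos_hasDerivAt hB (hf l) (fun x => (hKb l x h1 h2).2.2) z
  rcases hβc.eq_or_lt with hcβ | hcβ
  · -- convex kink at the minimal level
    obtain ⟨l, hl1, hl2⟩ := exists_rat_btwn (show c < c + min δ (m / 2) by
      have : 0 < min δ (m / 2) := by positivity
      linarith)
    have hle1 := min_le_left δ (m / 2)
    have hle2 := min_le_right δ (m / 2)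
    obtain ⟨-, hθ1, hθ2⟩ := hθ.of_effHam_lt (hc ▸ hl1)
    have hβl : β ≤ l := hβc.trans hl1.le
    have hlδ : (l : ℝ) ≤ c + δ := by linarith
    refine ⟨_, _, θL l, θR l, l, l, K, {x | 1 - min δ (m / 2) / β < v x}, hK0, (hcor l hβl hlδ).1,
      (hcor l hβl hlδ).2, ?_, ?_, hv.slope_left l hβl, hv.slope_right l hβl, hθ1.le, hθ2.le,
      hv.recurrent_high _ (by positivity), fun z hz => ?_⟩
    · rw [abs_le]; constructor <;> linarith
    · rw [abs_le]; constructor <;> linarith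
    have hz' : β - min δ (m / 2) < β * v z := by
      have := mul_lt_mul_of_pos_left (show 1 - min δ (m / 2) / β < v z from hz) hβ
      have e : β * (1 - min δ (m / 2) / β) = β - min δ (m / 2) := by field_simp
      linarith
    refine ⟨_, _, hdlow l z hβl hlδ (by linarith), hdpos l z hβl hlδ, fun q h1 h2 => ⟨?_, ?_⟩⟩
    · have := hW.nonneg q; linarith
    · have := hB.le_of_mem_Icc₃₄ hW (by linarith) h1 h2; linarith
  -- In this case θ < θL at every level from l' up to c, while θL < θ at all levels above c.
  by_cases hex : ∃ l', β ≤ l' ∧ l' < c ∧ θ < θL l'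
  · obtain ⟨l', hβ', hl', hθ'⟩ := hex
    have hleft : ∀ l, l' ≤ l → l < c → θ < θL l := fun l h1 h2 => by
      rcases lt_or_lt_of_lt_effHam (hβ'.trans h1) (hc ▸ h2) with h | h
      · exact h
      · have a1 := (hθ.left_le_right hβ').1
        have a2 := (hθ.left_le_right (hβ'.trans h1)).2
        linarith
    -- The two left correctors have to be glued where both follow the same branch. If c < m + β,
    -- both paths are below m where v is close to 1. Otherwise M < m + β ≤ c, and both paths are
    -- above M where v is close to 0.
    by_cases hcm : c < m + β
    · obtain ⟨l₁, h1, h2⟩ := exists_rat_btwn (show max l' (c - δ) < c from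
        max_lt hl' (by linarith))
      obtain ⟨l₂, h3, h4⟩ := exists_rat_btwn (show c < min (c + δ) (m + β) from
        lt_min (by linarith) hcm)
      have a1 := (le_max_left l' (c - δ)).trans h1.le
      have a2 := (le_max_right l' (c - δ)).trans h1.le
      have a3 := h4.le.trans (min_le_left _ _)
      have a4 := h4.trans_le (min_le_right _ _)
      obtain ⟨-, hθ1, hθ2⟩ := hθ.of_effHam_lt (hc ▸ h3)
      have b1 : β ≤ l₁ := hβ'.trans a1
      have b2 : β ≤ l₂ := hβc.trans h3.le
      refine ⟨_, _, θL l₂, θL l₁, l₂, l₁, K, {x | 1 - (m + β - l₂) / β < v x}, hK0,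
        (hcor l₂ b2 a3).1, (hcor l₁ b1 (by linarith)).1, ?_, ?_, hv.slope_left l₂ b2,
        hv.slope_left l₁ b1, hθ1.le, (hleft l₁ a1 h2).le,
        hv.recurrent_high _ (div_pos (by linarith) hβ), fun z hz => ?_⟩
      · rw [abs_le]; constructor <;> linarith
      · rw [abs_le]; constructor <;> linarith
      have hz' : β - (m + β - l₂) < β * v z := by
        have := mul_lt_mul_of_pos_left (show 1 - (m + β - l₂) / β < v z from hz) hβ
        have e : β * (1 - (m + β - l₂) / β) = β - (m + β - l₂) := by field_simp
        linarith
      refine ⟨_, _, hdlow l₂ z b2 a3 (by linarith), hdlow l₁ z b1 (by linarith) (by linarith),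
        fun q e1 e2 => ?_⟩
      have := hB.mem_Icc₃ hW (hpos l₁ z b1) (by linarith) e1 e2
      constructor <;> linarith
    · obtain ⟨l₁, h1, h2⟩ := exists_rat_btwn (show max (max l' (c - δ)) M < c from
        max_lt (max_lt hl' (by linarith)) (by linarith))
      obtain ⟨l₂, h3, h4⟩ := exists_rat_btwn (show c < c + δ by linarith)
      have a0 := (le_max_left _ M).trans h1.le
      have a1 := (le_max_left l' (c - δ)).trans a0
      have a2 := (le_max_right l' (c - δ)).trans a0
      have a4 := (le_max_right _ M).trans_lt h1
      obtain ⟨-, hθ1, hθ2⟩ := hθ.of_effHam_lt (hc ▸ h3)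
      have b1 : β ≤ l₁ := hβ'.trans a1
      have b2 : β ≤ l₂ := hβc.trans h3.le
      refine ⟨_, _, θL l₂, θL l₁, l₂, l₁, K, {x | v x < (l₁ - M) / β}, hK0,
        (hcor l₂ b2 h4.le).1, (hcor l₁ b1 (by linarith)).1, ?_, ?_, hv.slope_left l₂ b2,
        hv.slope_left l₁ b1, hθ1.le, (hleft l₁ a1 h2).le,
        hv.recurrent_low _ (div_pos (by linarith) hβ), fun z hz => ?_⟩
      · rw [abs_le]; constructor <;> linarith
      · rw [abs_le]; constructor <;> linarith
      have hz' : β * v z < l₁ - M := by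
        have : v z < (l₁ - M) / β := hz
        rw [lt_div_iff₀ hβ] at this; linarith
      refine ⟨_, _, hdhigh l₂ z b2 h4.le (by linarith), hdhigh l₁ z b1 (by linarith) (by linarith),
        fun q e1 e2 => ?_⟩
      have := hB.mem_Icc₁ hW (by linarith) e1 e2
      constructor <;> linarith
  -- Here θ exceeds θR at all levels in [β, c). Right correctors are differentiable everywhere, so
  -- any recurrent set of gluing points will do.
  · push Not at hex
    obtain ⟨l₁, h1, h2⟩ := exists_rat_btwn (show max β (c - δ) < c from max_lt hcβ (by linarith))
    obtain ⟨l₂, h3, h4⟩ := exists_rat_btwn (show c < c + δ by linarith)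
    have b1 := (le_max_left β (c - δ)).trans h1.le
    have a2 := (le_max_right β (c - δ)).trans h1.le
    have b2 : β ≤ l₂ := hβc.trans h3.le
    obtain ⟨-, hθ1, hθ2⟩ := hθ.of_effHam_lt (hc ▸ h3)
    have hr : θR l₁ < θ := by
      rcases lt_or_lt_of_lt_effHam b1 (hc ▸ h2) with h | h
      · have := hex l₁ b1 h2; linarith
      · exact h
    refine ⟨_, _, θR l₁, θR l₂, l₁, l₂, K, {x | v x < 1}, hK0,
      (hcor l₁ b1 (by linarith)).2, (hcor l₂ b2 h4.le).2, ?_, ?_, hv.slope_right l₁ b1,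
      hv.slope_right l₂ b2, hr.le, hθ2.le, hv.recurrent_low _ one_pos, fun z hz => ?_⟩
    · rw [abs_le]; constructor <;> linarith
    · rw [abs_le]; constructor <;> linarith
    refine ⟨_, _, hdpos l₁ z b1 (by linarith), hdpos l₂ z b2 h4.le, fun q e1 e2 => ?_⟩
    have := hB.mem_Icc₄ hW (hpos l₁ z b1) e1 e2
    constructor <;> linarith

end GoodPath

/-! ### Spatial averages of bounded stationary fields -/

/-- Leap from k to k + n and repeat. Each leap loses at most K times the weight b at its starting
point, and the last leap, which may overshoot R, is replaced by at most N steps at cost K each. -/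
theorem sub_le_of_exists_nonneg_step {Φ b : ℕ → ℝ} {K : ℝ} {N : ℕ} (hK : 0 ≤ K)
    (hb : ∀ k, 0 ≤ b k) (hstep : ∀ k n, -(K * n) ≤ Φ (k + n) - Φ k)
    (h : ∀ k, ∃ n, 1 ≤ n ∧ n ≤ N ∧ -(K * b k) ≤ Φ (k + n) - Φ k) (R : ℕ) :
    -(K * ∑ i ∈ Finset.range R, b i) - K * N ≤ Φ R - Φ 0 := by
  have key : ∀ j k, k + j = R → -(K * ∑ i ∈ Finset.Ico k R, b i) - K * N ≤ Φ R - Φ k := by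
    intro j
    induction j using Nat.strong_induction_on with
    | _ j ih =>
      intro k hk
      have hsum : 0 ≤ ∑ i ∈ Finset.Ico k R, b i := Finset.sum_nonneg fun i _ => hb i
      obtain ⟨n, hn1, hnN, hn⟩ := h k
      rcases le_or_gt (k + n) R with hle | hgt
      · have h1 := ih (j - n) (by omega) (k + n) (by omega)
        have h2 : b k + ∑ i ∈ Finset.Ico (k + n) R, b i ≤ ∑ i ∈ Finset.Ico k R, b i := by
          rw [Finset.sum_eq_sum_Ico_succ_bot (by omega : k < R)]
          exact add_le_add le_rfl (Finset.sum_le_sum_of_subset_of_nonneg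
            (Finset.Ico_subset_Ico_left (by omega)) fun i _ _ => hb i)
        have h3 := mul_le_mul_of_nonneg_left h2 hK
        linarith
      · have h1 := hstep k j
        rw [hk] at h1
        have h2 : (j : ℝ) ≤ N := by exact_mod_cast (by omega : j ≤ N)
        have h3 := mul_le_mul_of_nonneg_left h2 hK
        have h4 := mul_nonneg hK hsum
        linarith
  have := key R 0 (by omega)
  rwa [Nat.Ico_zero_eq_range] at this

theorem abs_sub_le_of_nat {Φ : ℝ → ℝ} {K c : ℝ} (hΦ : ∀ x y, |Φ x - Φ y| ≤ K * |x - y|)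
    (h0 : Φ 0 = 0) (h : ∀ δ > 0, ∀ᶠ n : ℕ in atTop, |Φ n - c * n| ≤ δ * n) {δ : ℝ} (hδ : 0 < δ) :
    ∃ C, ∀ x, 0 ≤ x → |Φ x - c * x| ≤ δ * x + C := by
  have hK : 0 ≤ K := by have := (abs_nonneg _).trans (hΦ 1 0); simpa using this
  obtain ⟨N, hN⟩ := eventually_atTop.1 (h δ hδ)
  refine ⟨(K + |c|) * (N + 1), fun x hx => ?_⟩
  have key : ∀ n : ℕ, (n : ℝ) ≤ x → |Φ x - c * x| ≤ |Φ n - c * n| + (K + |c|) * (x - n) := by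
    intro n hn
    have h1 := hΦ x n
    have h2 : |c * (x - n)| = |c| * (x - n) := by rw [abs_mul, abs_of_nonneg (a := x - n) (by linarith)]
    rw [abs_of_nonneg (a := x - n) (by linarith)] at h1
    have e : Φ x - c * x = (Φ n - c * n) + ((Φ x - Φ n) - c * (x - n)) := by ring
    rw [e]
    refine (abs_add_le _ _).trans (add_le_add le_rfl ((abs_sub _ _).trans ?_))
    linarith
  have hKc : 0 ≤ K + |c| := by positivity
  rcases le_or_gt (N : ℝ) x with hx' | hx'
  · have h1 := key ⌊x⌋₊ (Nat.floor_le hx)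
    have h2 := hN ⌊x⌋₊ (Nat.le_floor hx')
    have h3 := (Nat.lt_floor_add_one x)
    have h4 := Nat.floor_le hx
    have h5 : (K + |c|) * (x - ⌊x⌋₊) ≤ (K + |c|) * (N + 1) := by
      refine mul_le_mul_of_nonneg_left ?_ hKc
      have : (0 : ℝ) ≤ N := N.cast_nonneg
      linarith
    have h6 := mul_le_mul_of_nonneg_left h4 hδ.le
    linarith
  · have h1 := key 0 (by simpa using hx)
    simp only [Nat.cast_zero, h0, mul_zero, sub_zero, abs_zero, zero_add] at h1
    have h5 : (K + |c|) * x ≤ (K + |c|) * (N + 1) := mul_le_mul_of_nonneg_left (by linarith) hKc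
    have := mul_nonneg hδ.le hx
    linarith

/-- Bounded jointly measurable stationary fields. -/
structure IsStationaryField {Ω : Type*} [MeasurableSpace Ω] (τ : ℝ → Ω → Ω) (X : ℝ → Ω → ℝ)
    (K : ℝ) : Prop where
  measurable : Measurable (Function.uncurry X)
  shift : ∀ x y ω, X (x + y) ω = X x (τ y ω)
  bound : ∀ x ω, |X x ω| ≤ K

section Birkhoff

variable {Ω : Type*} [MeasurableSpace Ω] {μ : Measure Ω} {τ : ℝ → Ω → Ω} {X : ℝ → Ω → ℝ} {K : ℝ}

theorem IsStationaryField.measurable_left (hX : IsStationaryField τ X K) (ω : Ω) :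
    Measurable fun x => X x ω :=
  hX.measurable.comp (measurable_id.prodMk measurable_const)

theorem IsStationaryField.measurable_right (hX : IsStationaryField τ X K) (x : ℝ) :
    Measurable (X x) :=
  hX.measurable.comp (measurable_const.prodMk measurable_id)

theorem IsStationaryField.measurable_primitive (hX : IsStationaryField τ X K) (R : ℝ) :
    Measurable fun ω => primitive (fun x => X x ω) R := by
  have h : StronglyMeasurable (Function.uncurry fun ω x => X x ω) :=
    (hX.measurable.comp measurable_swap).stronglyMeasurable
  exact ((h.integral_prod_right (ν := volume.restrict (Ioc 0 R))).sub
    (h.integral_prod_right (ν := volume.restrict (Ioc R 0)))).measurable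

theorem IsStationaryField.integrable [IsFiniteMeasure μ] (hX : IsStationaryField τ X K) (x : ℝ) :
    Integrable (X x) μ :=
  Integrable.of_bound (hX.measurable_right x).aestronglyMeasurable K
    (ae_of_all _ fun ω => hX.bound x ω)

theorem IsStationaryField.abs_primitive_sub_le (hX : IsStationaryField τ X K) (ω : Ω) (a b : ℝ) :
    |primitive (fun x => X x ω) a - primitive (fun x => X x ω) b| ≤ K * |a - b| :=
  primitive_lip (hX.measurable_left ω) (fun x => hX.bound x ω) a b

theorem primitive_zero (s : ℝ → ℝ) : primitive s 0 = 0 := intervalIntegral.integral_same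

theorem IsStationaryField.primitive_shift (hX : IsStationaryField τ X K) (ω : Ω) (x R : ℝ) :
    primitive (fun y => X y (τ x ω)) R =
      primitive (fun y => X y ω) (R + x) - primitive (fun y => X y ω) x := by
  rw [primitive_sub (hX.measurable_left ω) fun x => hX.bound x ω]
  unfold primitive
  simp_rw [← hX.shift]
  rw [intervalIntegral.integral_comp_add_right (fun y => X y ω)]
  simp

theorem IsStationaryField.nonneg [Nonempty Ω] (hX : IsStationaryField τ X K) : 0 ≤ K :=
  (abs_nonneg _).trans (hX.bound 0 (Classical.arbitrary Ω))

theorem IsStationaryField.integral_eq (hτ : IsErgodicFlow μ τ) (hX : IsStationaryField τ X K)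
    (x : ℝ) : ∫ ω, X x ω ∂μ = ∫ ω, X 0 ω ∂μ := by
  have h := (hτ.measurePreserving x)
  have e : ∀ ω, X x ω = X 0 (τ x ω) := fun ω => by rw [← hX.shift, zero_add]
  simp_rw [e]
  conv_rhs => rw [← h.map_eq]
  rw [integral_map h.measurable.aemeasurable (hX.measurable_right 0).aestronglyMeasurable]

theorem IsStationaryField.integral_primitive [IsProbabilityMeasure μ] (hτ : IsErgodicFlow μ τ)
    (hX : IsStationaryField τ X K) {R : ℝ} (hR : 0 ≤ R) :
    ∫ ω, primitive (fun x => X x ω) R ∂μ = R * ∫ ω, X 0 ω ∂μ := by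
  unfold primitive
  simp_rw [intervalIntegral.integral_of_le hR]
  rw [integral_integral_swap]
  · simp_rw [hX.integral_eq hτ]
    simp [hR]
  · exact Integrable.of_bound (hX.measurable.comp measurable_swap).aestronglyMeasurable K
      (ae_of_all _ fun p => hX.bound p.2 p.1)

/-- Maximal inequality. -/
theorem IsStationaryField.integral_nonneg_of_exists [IsProbabilityMeasure μ]
    (hτ : IsErgodicFlow μ τ) (hX : IsStationaryField τ X K)
    (h : ∀ᵐ ω ∂μ, ∃ n : ℕ, 1 ≤ n ∧ 0 ≤ primitive (fun x => X x ω) n) : 0 ≤ ∫ ω, X 0 ω ∂μ := by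
  have : Nonempty Ω := μ.nonempty_of_neZero
  have hK := hX.nonneg
  obtain ⟨c, hc⟩ : ∃ c, c = ∫ ω, X 0 ω ∂μ := ⟨_, rfl⟩
  -- B N consists of the points without a nonnegative integral over a length from 1 to N. Along an
  -- orbit one leaps over nonnegative stretches and pays K for a unit step at each visit to B N;
  -- taking means over R and letting R grow gives c ≥ -K μ(B N), and B N shrinks to a null set.
  obtain ⟨B, hB⟩ : ∃ B : ℕ → Set Ω, ∀ N, B N = {ω | ∀ n : ℕ, 1 ≤ n → n ≤ N →
    primitive (fun x => X x ω) n < 0} := ⟨_, fun _ => rfl⟩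
  have hBm : ∀ N, MeasurableSet (B N) := fun N => by
    rw [hB]
    simp only [ofPred_forall]
    exact MeasurableSet.iInter fun n => MeasurableSet.iInter fun _ => MeasurableSet.iInter fun _ =>
      measurableSet_lt (hX.measurable_primitive _) measurable_const
  have hBa : Antitone B := fun N N' hN ω hω => by
    rw [hB] at hω ⊢
    exact fun n h1 h2 => hω n h1 (h2.trans hN)
  have hB0 : μ (⋂ N, B N) = 0 := by
    refine measure_mono_null (fun ω hω => ?_) h
    rintro ⟨n, hn, hn'⟩
    have := mem_iInter.1 hω n
    rw [hB] at this
    exact absurd (this n hn le_rfl) (not_lt.2 hn')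
  have hlim : Tendsto (fun N => μ.real (B N)) atTop (𝓝 0) := by
    have h1 := tendsto_measure_iInter_atTop (μ := μ) (fun N => (hBm N).nullMeasurableSet) hBa
      ⟨0, measure_ne_top _ _⟩
    rw [hB0] at h1
    have := (ENNReal.tendsto_toReal ENNReal.zero_ne_top).comp h1
    simpa [Measure.real, Function.comp_def] using this
  have key : ∀ N, -(K * μ.real (B N)) ≤ c := by
    intro N
    have hdet : ∀ ω (R : ℕ), -(K * ∑ i ∈ Finset.range R, (B N).indicator 1 (τ i ω)) - K * (N + 1 : ℕ) ≤
        primitive (fun x => X x ω) R := by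
      intro ω R
      -- Leaps are bounded by N + 1, so that the unit step is allowed even for N = 0.
      have := sub_le_of_exists_nonneg_step (Φ := fun k : ℕ => primitive (fun x => X x ω) k)
        (b := fun i : ℕ => (B N).indicator 1 (τ i ω)) (K := K) (N := N + 1) hK
        (fun k => indicator_nonneg (fun _ _ => zero_le_one) _)
        (fun k n => by
          have := (abs_le.1 (hX.abs_primitive_sub_le ω ((k + n : ℕ) : ℝ) k)).1
          push_cast at this ⊢
          simpa using this)
        (fun k => by
          by_cases hk : τ k ω ∈ B N
          · refine ⟨1, le_rfl, by omega, ?_⟩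
            have := (abs_le.1 (hX.abs_primitive_sub_le ω ((k + 1 : ℕ) : ℝ) k)).1
            rw [indicator_of_mem hk]
            push_cast at this ⊢
            simpa using this
          · rw [indicator_of_notMem hk]
            rw [hB] at hk
            simp only [mem_ofPred_eq, not_forall, not_lt] at hk
            obtain ⟨n, h1, h2, h3⟩ := hk
            refine ⟨n, h1, by omega, ?_⟩
            rw [hX.primitive_shift] at h3
            push_cast
            rw [add_comm (k : ℝ)]
            linarith) R
      simpa [primitive_zero] using this
    have hint : ∀ R : ℕ, -(K * (R * μ.real (B N))) - K * (N + 1 : ℕ) ≤ R * c := by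
      intro R
      have hind : ∀ i : ℕ, Integrable (fun ω => (B N).indicator (1 : Ω → ℝ) (τ i ω)) μ := fun i =>
        (hτ.measurePreserving i).integrable_comp_of_integrable
          ((integrable_const (1 : ℝ)).indicator (hBm N))
      have hS : Integrable (fun ω => -(K * ∑ i ∈ Finset.range R,
          (B N).indicator (1 : Ω → ℝ) (τ i ω))) μ :=
        ((integrable_finsetSum _ fun i _ => hind i).const_mul K).neg
      have e1 : ∫ ω, (-(K * ∑ i ∈ Finset.range R, (B N).indicator (1 : Ω → ℝ) (τ i ω)) -
          K * (N + 1 : ℕ)) ∂μ = -(K * (R * μ.real (B N))) - K * (N + 1 : ℕ) := by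
        rw [integral_sub hS (integrable_const _), integral_neg, integral_const_mul,
          integral_finsetSum _ fun i _ => hind i]
        have : ∀ i : ℕ, ∫ ω, (B N).indicator (1 : Ω → ℝ) (τ i ω) ∂μ = μ.real (B N) := fun i => by
          rw [← integral_map (φ := τ i) (f := (B N).indicator (1 : Ω → ℝ))
            (hτ.measurePreserving i).measurable.aemeasurable
            ((measurable_const.indicator (hBm N)).aestronglyMeasurable),
            (hτ.measurePreserving i).map_eq, integral_indicator_one (hBm N)]
        simp [this]
      rw [hc, ← hX.integral_primitive hτ (Nat.cast_nonneg R), ← e1]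
      refine integral_mono (hS.sub (integrable_const _)) ?_ fun ω => hdet ω R
      refine Integrable.of_bound (hX.measurable_primitive R).aestronglyMeasurable (K * R)
        (ae_of_all _ fun ω => ?_)
      have := hX.abs_primitive_sub_le ω R 0
      simpa [primitive_zero] using this
    by_contra hcon
    push Not at hcon
    obtain ⟨R, hR⟩ := exists_nat_gt (K * (N + 1 : ℕ) / (-(K * μ.real (B N)) - c))
    rw [div_lt_iff₀ (by linarith)] at hR
    have := hint R
    linarith
  have h1 : Tendsto (fun N => -(K * μ.real (B N))) atTop (𝓝 (-(K * 0))) := (hlim.const_mul K).neg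
  rw [← hc]
  simpa using le_of_tendsto' h1 key

theorem IsErgodicFlow.measure_eq_zero_or_one (hτ : IsErgodicFlow μ τ) {A : Set Ω}
    (hA : MeasurableSet A) (h : ∀ x ω, ω ∈ A → τ x ω ∈ A) : μ A = 0 ∨ μ A = 1 := by
  have e : ⋂ x, τ x '' A = A := by
    refine Subset.antisymm (fun ω hω => ?_) fun ω hω => mem_iInter.2 fun x => ?_
    · obtain ⟨y, hy, rfl⟩ := mem_iInter.1 hω 0
      exact h 0 y hy
    · refine ⟨τ (-x) ω, h _ _ hω, ?_⟩
      rw [← Function.comp_apply (f := τ x), ← hτ.add, add_neg_cancel, hτ.zero, id]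
  have := hτ.ergodic A hA (by rwa [e])
  rwa [e] at this

/-- The paths whose integral is at least n/(k+1) for arbitrarily large n, for some k, form an
invariant event. By ergodicity it is null or of full measure, and the latter would give a
nonnegative mean by the maximal inequality. -/
theorem IsStationaryField.ae_eventually_lt [IsProbabilityMeasure μ] (hτ : IsErgodicFlow μ τ)
    (hX : IsStationaryField τ X K) (h : ∫ ω, X 0 ω ∂μ < 0) :
    ∀ᵐ ω ∂μ, ∀ δ > 0, ∀ᶠ n : ℕ in atTop, primitive (fun x => X x ω) n < δ * n := by
  have : Nonempty Ω := μ.nonempty_of_neZero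
  have hK := hX.nonneg
  obtain ⟨A, hA⟩ : ∃ A : Set Ω, A = {ω | ∃ k : ℕ, ∀ N : ℕ, ∃ n : ℕ, N ≤ n ∧
    1 / ((k : ℝ) + 1) * n ≤ primitive (fun x => X x ω) n} := ⟨_, rfl⟩
  have hAm : MeasurableSet A := by
    rw [hA]
    simp only [ofPred_exists, ofPred_forall, ofPred_and]
    exact MeasurableSet.iUnion fun k => MeasurableSet.iInter fun N => MeasurableSet.iUnion fun n =>
      (MeasurableSet.const _).inter (measurableSet_le measurable_const (hX.measurable_primitive _))
  have hAi : ∀ x ω, ω ∈ A → τ x ω ∈ A := by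
    intro x ω hω
    rw [hA] at hω ⊢
    obtain ⟨k, hk⟩ := hω
    -- Halving the threshold 1/(k+1) absorbs the boundary terms, at most 2K|x|, produced by the
    -- shift.
    refine ⟨2 * k + 1, fun N => ?_⟩
    obtain ⟨R, hR⟩ := exists_nat_gt (2 * (K * |x|) * ((2 * k + 1 : ℕ) + 1))
    obtain ⟨n, hn, hn'⟩ := hk (max N R)
    refine ⟨n, (le_max_left _ _).trans hn, ?_⟩
    rw [hX.primitive_shift]
    have h1 := (abs_le.1 (hX.abs_primitive_sub_le ω (n + x) n)).1
    have h2 := (abs_le.1 (hX.abs_primitive_sub_le ω x 0)).2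
    rw [primitive_zero] at h2
    simp only [add_sub_cancel_left, sub_zero] at h1 h2
    have h3 : 2 * (K * |x|) * ((2 * k + 1 : ℕ) + 1) ≤ n :=
      hR.le.trans (by exact_mod_cast (le_max_right _ _).trans hn)
    push_cast at h3 ⊢
    have hk1 : (0 : ℝ) < k + 1 := by positivity
    have h4 : 2 * (K * |x|) ≤ 1 / (2 * k + 1 + 1) * n := by
      rw [one_div, inv_mul_eq_div, le_div_iff₀ (by positivity)]; exact h3
    have h5 : 1 / ((k : ℝ) + 1) * n = 2 * (1 / (2 * k + 1 + 1) * n) := by field_simp; ring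
    linarith
  have hA0 : μ A = 0 := by
    rcases hτ.measure_eq_zero_or_one hAm hAi with h0 | h1
    · exact h0
    · exfalso
      refine absurd (hX.integral_nonneg_of_exists hτ ?_) (not_le.2 h)
      have : ∀ᵐ ω ∂μ, ω ∈ A := by
        rw [ae_iff]; exact (prob_compl_eq_zero_iff hAm).2 h1
      filter_upwards [this] with ω hω
      rw [hA] at hω
      obtain ⟨k, hk⟩ := hω
      obtain ⟨n, hn, hn'⟩ := hk 1
      exact ⟨n, hn, (by positivity : (0 : ℝ) ≤ 1 / ((k : ℝ) + 1) * n).trans hn'⟩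
  have : ∀ᵐ ω ∂μ, ω ∉ A := by rw [ae_iff]; simpa using hA0
  filter_upwards [this] with ω hω δ hδ
  obtain ⟨k, hk⟩ := exists_nat_one_div_lt hδ
  rw [hA] at hω
  simp only [mem_ofPred_eq, not_exists, not_forall, not_and, not_le] at hω
  obtain ⟨N, hN⟩ := hω k
  filter_upwards [eventually_ge_atTop N] with n hn
  exact (hN n hn).trans_le (by gcongr)

theorem IsStationaryField.ae_eventually_le [IsProbabilityMeasure μ] (hτ : IsErgodicFlow μ τ)
    (hX : IsStationaryField τ X K) :
    ∀ᵐ ω ∂μ, ∀ δ > 0, ∀ᶠ n : ℕ in atTop,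
      primitive (fun x => X x ω) n ≤ (∫ ω, X 0 ω ∂μ) * n + δ * n := by
  obtain ⟨c, hc⟩ : ∃ c, c = ∫ ω, X 0 ω ∂μ := ⟨_, rfl⟩
  rw [← hc]
  have h : ∀ j : ℕ, ∀ᵐ ω ∂μ, ∀ δ > 0, ∀ᶠ n : ℕ in atTop,
      primitive (fun x => X x ω - (c + 1 / ((j : ℝ) + 1))) n < δ * n := by
    intro j
    have hY : IsStationaryField τ (fun x ω => X x ω - (c + 1 / ((j : ℝ) + 1)))
        (K + |c + 1 / ((j : ℝ) + 1)|) :=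
      ⟨hX.measurable.sub_const _, fun x y ω => by rw [hX.shift],
        fun x ω => (abs_sub _ _).trans (by have := hX.bound x ω; linarith)⟩
    refine hY.ae_eventually_lt hτ ?_
    rw [integral_sub (hX.integrable 0) (integrable_const _), ← hc]
    have : (0 : ℝ) < 1 / ((j : ℝ) + 1) := by positivity
    simp
    simpa using this
  filter_upwards [ae_all_iff.2 h] with ω hω δ hδ
  obtain ⟨j, hj⟩ := exists_nat_one_div_lt (half_pos hδ)
  filter_upwards [hω j (δ / 2) (half_pos hδ)] with n hn
  unfold primitive at hn ⊢
  rw [intervalIntegral.integral_sub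
    (intervalIntegrable_of_bounded (hX.measurable_left ω) (fun x => hX.bound x ω) _ _)
    intervalIntegrable_const, intervalIntegral.integral_const] at hn
  have : 1 / ((j : ℝ) + 1) * n ≤ δ / 2 * n := by gcongr
  simp only [smul_eq_mul, sub_zero] at hn
  linarith

theorem IsStationaryField.ae_exists_const [IsProbabilityMeasure μ] (hτ : IsErgodicFlow μ τ)
    (hX : IsStationaryField τ X K) :
    ∀ᵐ ω ∂μ, ∀ δ > 0, ∃ C, ∀ x, 0 ≤ x →
      |primitive (fun x => X x ω) x - (∫ ω, X 0 ω ∂μ) * x| ≤ δ * x + C := by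
  have hY : IsStationaryField τ (fun x ω => -X x ω) K :=
    ⟨hX.measurable.neg, fun x y ω => by rw [hX.shift], fun x ω => by rw [abs_neg]; exact hX.bound x ω⟩
  filter_upwards [hX.ae_eventually_le hτ, hY.ae_eventually_le hτ] with ω h1 h2 δ hδ
  refine abs_sub_le_of_nat (hX.abs_primitive_sub_le ω) (primitive_zero _) (fun δ hδ => ?_) hδ
  filter_upwards [h1 δ hδ, h2 δ hδ] with n e1 e2
  rw [integral_neg] at e2
  have : primitive (fun x => -X x ω) n = -primitive (fun x => X x ω) n :=
    intervalIntegral.integral_neg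
  rw [abs_le]; constructor <;> linarith

/-- Birkhoff's theorem for bounded stationary fields, in both directions. -/
theorem IsStationaryField.ae_hasSlope [IsProbabilityMeasure μ] (hτ : IsErgodicFlow μ τ)
    (hX : IsStationaryField τ X K) :
    ∀ᵐ ω ∂μ, HasSlope (primitive fun x => X x ω) (∫ ω, X 0 ω ∂μ) := by
  -- The reversed flow is ergodic too and yields the averages on the negative axis.
  have hτ' : IsErgodicFlow μ fun x => τ (-x) :=
    ⟨fun x => hτ.measurePreserving _, by simpa using hτ.zero,
      fun x y => by rw [neg_add, hτ.add], fun A hA hA' => by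
        have e : ⋂ x, τ (-x) '' A = ⋂ x, τ x '' A :=
          (Equiv.neg ℝ).surjective.iInter_comp fun x => τ x '' A
        rw [e] at hA' ⊢
        exact hτ.ergodic A hA hA'⟩
  have hY : IsStationaryField (fun x => τ (-x)) (fun x ω => X (-x) ω) K :=
    ⟨hX.measurable.comp (measurable_fst.neg.prodMk measurable_snd),
      fun x y ω => by rw [neg_add, hX.shift], fun x ω => hX.bound _ ω⟩
  filter_upwards [hX.ae_exists_const hτ, hY.ae_exists_const hτ'] with ω h1 h2 δ hδ
  obtain ⟨C, hC⟩ := h1 δ hδ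
  obtain ⟨D, hD⟩ := h2 δ hδ
  have e : ∀ x, primitive (fun x => X (-x) ω) x = -primitive (fun x => X x ω) (-x) := by
    intro x
    unfold primitive
    rw [intervalIntegral.integral_comp_neg (fun x => X x ω), neg_zero,
      intervalIntegral.integral_symm]
  refine ⟨max C D, fun x => ?_⟩
  rcases le_total 0 x with hx | hx
  · rw [abs_of_nonneg hx]
    exact (hC x hx).trans (add_le_add le_rfl (le_max_left _ _))
  · have h3 := hD (-x) (by linarith)
    rw [e, neg_neg, neg_zero] at h3
    rw [abs_of_nonpos hx, ← abs_neg]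
    refine le_trans (le_of_eq ?_) (h3.trans (add_le_add le_rfl (le_max_right _ _)))
    congr 1; ring

end Birkhoff

/-! ### Stationary potentials with values in `[0, 1]` -/

theorem forall_Icc_of_rat {f : ℝ → ℝ} (hf : Continuous f) {a b c : ℝ} (hab : a < b)
    (h : ∀ q : ℚ, a < q → q < b → c ≤ f q) : ∀ r ∈ Icc a b, c ≤ f r := by
  have hcl : IsClosed {r | c ≤ f r} := isClosed_le continuous_const hf
  have h1 : Ioo a b ∩ range ((↑) : ℚ → ℝ) ⊆ {r | c ≤ f r} := by
    rintro _ ⟨⟨h1, h2⟩, q, rfl⟩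
    exact h q h1 h2
  have h2 := Dense.open_subset_closure_inter (Rat.denseRange_cast (𝕜 := ℝ)) (isOpen_Ioo (a := a) (b := b))
  have h3 := h2.trans (closure_minimal h1 hcl)
  rw [← closure_Ioo hab.ne]
  exact closure_minimal h3 hcl

/-- A countable description, needed for joint measurability in position and path. The strict bound
on a compact interval is replaced by a uniform margin 1/(n+1), which can be checked at rationals;
the case where the starting point is x itself is kept apart. -/
theorem mem_highSet_iff_rat {f : ℝ → ℝ} (hf : Continuous f) {m M x : ℝ} (hmM : m < M) :
    x ∈ highSet m M f ↔ M < f x ∨ m < f x ∧ ∃ s : ℚ, (s : ℝ) < x ∧ M < f s ∧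
      ∃ n : ℕ, ∀ r : ℚ, (s : ℝ) < r → (r : ℝ) < x → m + 1 / ((n : ℝ) + 1) ≤ f r := by
  constructor
  · intro hx
    obtain ⟨s, hs, hM, hr⟩ := id hx
    rcases hs.eq_or_lt with rfl | hs
    · exact Or.inl hM
    refine Or.inr ⟨lt_of_mem_highSet hx, ?_⟩
    obtain ⟨ρ, hρ, h⟩ := exists_Ioo_of_eventually_nhds
      (hf.continuousAt.eventually (lt_mem_nhds hM))
    obtain ⟨q, hq1, hq2⟩ := exists_rat_btwn (show s < min x (s + ρ) from lt_min hs (by linarith))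
    have hqx := hq2.trans_le (min_le_left _ _)
    have hqρ := hq2.trans_le (min_le_right _ _)
    refine ⟨q, hqx, h q (by rw [abs_lt]; constructor <;> linarith), ?_⟩
    obtain ⟨t, ht, hmin⟩ := (isCompact_Icc (a := (q : ℝ)) (b := x)).exists_isMinOn
      (nonempty_Icc.2 hqx.le) hf.continuousOn
    obtain ⟨n, hn⟩ := exists_nat_one_div_lt (sub_pos.2 (hr t ⟨hq1.le.trans ht.1, ht.2⟩))
    refine ⟨n, fun r h1 h2 => ?_⟩
    have := isMinOn_iff.1 hmin r ⟨h1.le, h2.le⟩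
    linarith
  · rintro (h | ⟨-, s, hs, hM, n, h⟩)
    · exact mem_highSet_of_lt hmM h
    · refine ⟨s, hs.le, hM, fun r hr => ?_⟩
      have := forall_Icc_of_rat hf hs h r hr
      have : (0 : ℝ) < 1 / ((n : ℝ) + 1) := by positivity
      linarith

theorem highSet_shift (m M : ℝ) (f : ℝ → ℝ) (x y : ℝ) :
    x + y ∈ highSet m M f ↔ x ∈ highSet m M fun r => f (r + y) := by
  constructor
  · rintro ⟨s, hs, hM, hr⟩
    refine ⟨s - y, by linarith, by simpa using hM, fun r h => hr _ ⟨?_, ?_⟩⟩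
    · linarith [h.1]
    · linarith [h.2]
  · rintro ⟨s, hs, hM, hr⟩
    refine ⟨s + y, by linarith, hM, fun r h => ?_⟩
    have := hr (r - y) ⟨by linarith [h.1], by linarith [h.2]⟩
    simpa using this

/-- Stationary potentials all of whose values are in `[0, 1]`. -/
structure IsUnitPotential {Ω : Type*} [MeasurableSpace Ω] (μ : Measure Ω) (τ : ℝ → Ω → Ω)
    (V : ℝ → Ω → ℝ) : Prop extends IsStationaryPotential μ τ V where
  nonneg : ∀ x ω, 0 ≤ V x ω
  le_one : ∀ x ω, V x ω ≤ 1

section UnitPotential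

variable {Ω : Type*} [MeasurableSpace Ω] {μ : Measure Ω} {τ : ℝ → Ω → Ω} {V : ℝ → Ω → ℝ}

/-- Clamping to [0, 1] alters only a null set of paths, and every conclusion is insensitive to this.
Afterwards the bounds hold for all paths. -/
theorem IsStationaryPotential.exists_isUnitPotential (hV : IsStationaryPotential μ τ V) :
    ∃ V', IsUnitPotential μ τ V' ∧ ∀ᵐ ω ∂μ, ∀ x, V' x ω = V x ω := by
  have hae : ∀ᵐ ω ∂μ, ∀ x, max 0 (min 1 (V x ω)) = V x ω := by
    filter_upwards [hV.normalized] with ω hω x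
    rw [min_eq_right (hω.2.1 ⟨x, rfl⟩), max_eq_right (hω.1.1 ⟨x, rfl⟩)]
  refine ⟨fun x ω => max 0 (min 1 (V x ω)), ⟨⟨?_, fun x ω => ?_, fun ω => ?_, fun ω => ?_, ?_⟩,
    fun x ω => le_max_left _ _, fun x ω => max_le zero_le_one (min_le_left _ _)⟩, hae⟩
  · exact measurable_const.max (measurable_const.min hV.measurable)
  · simp only [hV.stationary x ω]
  · exact ⟨1, fun x => by
      rw [abs_of_nonneg (le_max_left _ _)]; exact max_le zero_le_one (min_le_left _ _)⟩
  · have h : LipschitzWith 1 fun y : ℝ => max 0 (min 1 y) :=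
      ((LipschitzWith.id.const_min 1).const_max 0)
    exact h.uniformContinuous.comp (hV.uniformContinuous ω)
  · filter_upwards [hV.normalized, hae] with ω hω h
    simpa only [h] using hω

theorem IsStationaryPotential.shift (hV : IsStationaryPotential μ τ V) (hτ : IsErgodicFlow μ τ)
    (x y : ℝ) (ω : Ω) : V (x + y) ω = V x (τ y ω) := by
  rw [hV.stationary, hτ.add, Function.comp, ← hV.stationary]

theorem IsStationaryPotential.continuous (hV : IsStationaryPotential μ τ V) (ω : Ω) :
    Continuous fun x => V x ω :=
  (hV.uniformContinuous ω).continuous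

theorem IsStationaryPotential.measurable_at (hV : IsStationaryPotential μ τ V) (x : ℝ) :
    Measurable (V x) :=
  hV.measurable.comp (measurable_const.prodMk measurable_id)

theorem IsStationaryPotential.measurableSet_highSet (hV : IsStationaryPotential μ τ V)
    {m M : ℝ} (hmM : m < M) (a b : ℝ) :
    MeasurableSet {p : ℝ × Ω | p.1 ∈ highSet m M fun y => a - b * V y p.2} := by
  have e : {p : ℝ × Ω | p.1 ∈ highSet m M fun y => a - b * V y p.2} =
      {p : ℝ × Ω | M < a - b * V p.1 p.2 ∨ m < a - b * V p.1 p.2 ∧ ∃ s : ℚ, (s : ℝ) < p.1 ∧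
      M < a - b * V s p.2 ∧ ∃ n : ℕ, ∀ r : ℚ, (s : ℝ) < r → (r : ℝ) < p.1 →
      m + 1 / ((n : ℝ) + 1) ≤ a - b * V r p.2} := by
    ext p
    exact mem_highSet_iff_rat (by have := hV.continuous p.2; fun_prop) hmM
  rw [e]
  have h0 : Measurable fun p : ℝ × Ω => a - b * V p.1 p.2 := (hV.measurable.const_mul b).const_sub a
  have h1 : ∀ r : ℝ, Measurable fun p : ℝ × Ω => a - b * V r p.2 := fun r =>
    (((hV.measurable_at r).comp measurable_snd).const_mul b).const_sub a
  have hlt : ∀ {f g : ℝ × Ω → ℝ}, Measurable f → Measurable g → Measurable fun p => f p < g p :=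
    fun hf hg => measurableSet_setOfPred.1 (measurableSet_lt hf hg)
  have hle : ∀ {f g : ℝ × Ω → ℝ}, Measurable f → Measurable g → Measurable fun p => f p ≤ g p :=
    fun hf hg => measurableSet_setOfPred.1 (measurableSet_le hf hg)
  refine measurableSet_setOfPred.2 ((hlt measurable_const h0).or
    ((hlt measurable_const h0).and (Measurable.exists fun s => ?_)))
  exact (hlt measurable_const measurable_fst).and ((hlt measurable_const (h1 s)).and
    (Measurable.exists fun n => Measurable.forall fun r => Measurable.imp measurable_const
    (Measurable.imp (hlt measurable_const measurable_fst) (hle measurable_const (h1 r)))))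

variable {G : ℝ → ℝ} {m M pm pM β : ℝ} {p₁ p₃ p₄ : ℝ → ℝ}

theorem IsUnitPotential.mem_Icc (hV : IsUnitPotential μ τ V) (hβ : 0 < β) (l x : ℝ) (ω : Ω) :
    l - β * V x ω ∈ Icc (l - β) l := by
  have h1 := mul_le_mul_of_nonneg_left (hV.le_one x ω) hβ.le
  have h2 := mul_nonneg hβ.le (hV.nonneg x ω)
  constructor <;> linarith

theorem IsUnitPotential.isStationaryField_left [IsProbabilityMeasure μ] (hV : IsUnitPotential μ τ V)
    (hτ : IsErgodicFlow μ τ) (hB : InverseBranches G m M pm pM p₁ p₃ p₄) (hmM : m < M)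
    (hβ : 0 < β) (l : ℝ) :
    ∃ K, IsStationaryField τ
      (fun x ω => negSelection p₁ p₃ m M (fun y => l - β * V y ω) x) K := by
  obtain ⟨K, -, hK⟩ := hB.exists_bound (l - β) l
  have hf : Measurable fun p : ℝ × Ω => l - β * V p.1 p.2 := (hV.measurable.const_mul β).const_sub l
  refine ⟨K, ?_, fun x y ω => ?_, fun x ω => abs_negSelection_le
    (fun x => (hK _ (hV.mem_Icc hβ l x ω)).1) (fun x => (hK _ (hV.mem_Icc hβ l x ω)).2.1) x⟩
  · exact Measurable.ite (hV.measurableSet_highSet hmM l β) (hB.cont₁.measurable.comp hf)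
      (hB.cont₃.measurable.comp hf)
  · have e : (x + y ∈ highSet m M fun y => l - β * V y ω) ↔
        x ∈ highSet m M fun r => l - β * V r (τ y ω) := by
      simp_rw [← hV.shift hτ]
      exact highSet_shift m M _ x y
    unfold negSelection
    simp only [hV.shift hτ]
    by_cases h : x + y ∈ highSet m M fun y => l - β * V y ω
    · rw [if_pos h, if_pos (e.1 h)]
    · rw [if_neg h, if_neg fun h' => h (e.2 h')]

theorem IsUnitPotential.isStationaryField_right (hV : IsUnitPotential μ τ V)
    (hτ : IsErgodicFlow μ τ) (hB : InverseBranches G m M pm pM p₁ p₃ p₄) (hβ : 0 < β) (l : ℝ) :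
    ∃ K, IsStationaryField τ (fun x ω => p₄ (l - β * V x ω)) K := by
  obtain ⟨K, -, hK⟩ := hB.exists_bound (l - β) l
  have hf : Measurable fun p : ℝ × Ω => l - β * V p.1 p.2 := (hV.measurable.const_mul β).const_sub l
  refine ⟨K, hB.cont₄.measurable.comp hf, fun x y ω => ?_,
    fun x ω => (hK _ (hV.mem_Icc hβ l x ω)).2.2⟩
  simp only [hV.shift hτ]

/-- Mean slope of the correctors with negative gradient. -/
noncomputable def leftSlope (μ : Measure Ω) (V : ℝ → Ω → ℝ) (p₁ p₃ : ℝ → ℝ) (m M β l : ℝ) : ℝ :=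
  ∫ ω, negSelection p₁ p₃ m M (fun y => l - β * V y ω) 0 ∂μ

/-- Mean slope of the correctors with positive gradient. -/
noncomputable def rightSlope (μ : Measure Ω) (V : ℝ → Ω → ℝ) (p₄ : ℝ → ℝ) (β l : ℝ) : ℝ :=
  ∫ ω, p₄ (l - β * V 0 ω) ∂μ

/-- Raising the path enlarges the high phase. A point that changes phase drops from a gradient at
least pM to one below pm; the others move along a decreasing branch. -/
theorem negSelection_lt (hB : InverseBranches G m M pm pM p₁ p₃ p₄)
    (hW : IsDoubleWell G m M pm pM) {f g : ℝ → ℝ} (h : ∀ x, f x < g x) (x : ℝ) :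
    negSelection p₁ p₃ m M g x < negSelection p₁ p₃ m M f x := by
  unfold negSelection
  by_cases hf : x ∈ highSet m M f
  · rw [if_pos hf, if_pos (highSet_subset_of_le (fun x => (h x).le) hf)]
    exact hB.anti₁ (h x)
  · rw [if_neg hf]
    split_ifs with hg
    · have h1 : p₁ (g x) < pm := hB.map₁ ▸ hB.anti₁ (lt_of_mem_highSet hg)
      have h2 : pM ≤ p₃ (f x) := by
        rw [← hB.map₃]
        refine hB.anti₃.antitone ?_
        by_contra hlt
        exact hf (mem_highSet_of_lt hW.m_lt_M (not_le.1 hlt))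
      linarith [hW.pm_lt_pM]
    · exact hB.anti₃ (h x)

theorem integral_lt_integral_of_lt [IsProbabilityMeasure μ] {f g : Ω → ℝ} (hf : Integrable f μ)
    (hg : Integrable g μ) (h : ∀ ω, f ω < g ω) : ∫ ω, f ω ∂μ < ∫ ω, g ω ∂μ := by
  refine lt_of_le_of_ne (integral_mono hf hg fun ω => (h ω).le) fun he => ?_
  have := (integral_eq_iff_of_ae_le hf hg (ae_of_all _ fun ω => (h ω).le)).1 he
  obtain ⟨ω, hω⟩ := this.exists
  exact (h ω).ne hω

theorem IsUnitPotential.isSlopePair [IsProbabilityMeasure μ] (hV : IsUnitPotential μ τ V)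
    (hτ : IsErgodicFlow μ τ) (hB : InverseBranches G m M pm pM p₁ p₃ p₄)
    (hW : IsDoubleWell G m M pm pM) (hβ : 0 < β) :
    IsSlopePair β (leftSlope μ V p₁ p₃ m M β) (rightSlope μ V p₄ β) := by
  have hL : ∀ l, Integrable (fun ω => negSelection p₁ p₃ m M (fun y => l - β * V y ω) 0) μ := by
    intro l
    obtain ⟨K, hK⟩ := hV.isStationaryField_left hτ hB hW.m_lt_M hβ l
    exact hK.integrable 0
  have hR : ∀ l, Integrable (fun ω => p₄ (l - β * V 0 ω)) μ := by
    intro l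
    obtain ⟨K, hK⟩ := hV.isStationaryField_right hτ hB hβ l
    exact hK.integrable 0
  refine ⟨fun a _ b _ hab => ?_, fun a _ b _ hab => ?_, ?_, ?_, ?_, ?_⟩
  · exact integral_lt_integral_of_lt (hL b) (hL a) fun ω =>
      negSelection_lt hB hW (fun x => by linarith) 0
  · exact integral_lt_integral_of_lt (hR a) (hR b) fun ω => hB.mono₄ (by linarith)
  · refine integral_nonpos fun ω => ?_
    unfold negSelection
    split_ifs with h
    · have h1 : p₁ (β - β * V 0 ω) < pm := by
        rw [← hB.map₁]; exact hB.anti₁ (lt_of_mem_highSet (f := fun y => β - β * V y ω) h)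
      have := hW.pm_lt_pM.trans hW.pM_neg
      exact (h1.trans this).le
    · have h1 : p₃ (β - β * V 0 ω) ≤ p₃ 0 := hB.anti₃.antitone (by simpa using (hV.mem_Icc hβ β 0 ω).1)
      rwa [hB.map₃_zero] at h1
  · refine integral_nonneg fun ω => ?_
    have h1 : p₄ 0 ≤ p₄ (β - β * V 0 ω) :=
      hB.mono₄.monotone (by simpa using (hV.mem_Icc hβ β 0 ω).1)
    rwa [hB.map₄] at h1
  · refine tendsto_atBot_mono' _ ?_ (hB.tendsto₁.comp (tendsto_atTop_add_const_right _ (-β) tendsto_id))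
    -- At levels above M + β the whole path exceeds M, so only p₁ is selected.
    filter_upwards [eventually_gt_atTop (M + β)] with l hl
    have h1 : ∀ ω, negSelection p₁ p₃ m M (fun y => l - β * V y ω) 0 ≤ p₁ (l + -β) := fun ω => by
      have := (hV.mem_Icc hβ l 0 ω).1
      rw [negSelection, if_pos (mem_highSet_of_lt hW.m_lt_M (by linarith))]
      exact hB.anti₁.antitone (by linarith)
    calc leftSlope μ V p₁ p₃ m M β l ≤ ∫ _, p₁ (l + -β) ∂μ :=
          integral_mono (hL l) (integrable_const _) h1
      _ = _ := by simp
  · refine tendsto_atTop_mono (fun l => ?_)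
      (hB.tendsto₄.comp (tendsto_atTop_add_const_right _ (-β) tendsto_id))
    have h1 : ∀ ω, p₄ (l + -β) ≤ p₄ (l - β * V 0 ω) := fun ω =>
      hB.mono₄.monotone (by have := (hV.mem_Icc hβ l 0 ω).1; linarith)
    calc _ = ∫ _, p₄ (l + -β) ∂μ := by simp
      _ ≤ _ := integral_mono (integrable_const _) (hR l) h1

theorem IsRecurrentSet.mono {S T : Set ℝ} (h : IsRecurrentSet S) (hST : S ⊆ T) :
    IsRecurrentSet T := fun x₀ ρ hρ => by
  filter_upwards [h x₀ ρ hρ] with ε ⟨z, hz, hz'⟩ using ⟨z, hST hz, hz'⟩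

/-- The mean of χ(V) is positive: otherwise χ(V) would vanish almost surely at all rationals, hence
everywhere by continuity. A positive mean is a positive slope, to which `isRecurrentSet_of_slope`
applies. -/
theorem IsUnitPotential.ae_isRecurrentSet [IsProbabilityMeasure μ] (hV : IsUnitPotential μ τ V)
    (hτ : IsErgodicFlow μ τ) {χ : ℝ → ℝ} (hχ : Continuous χ) (hχ0 : ∀ t, 0 ≤ χ t)
    (h : ∀ᵐ ω ∂μ, ∃ x, χ (V x ω) ≠ 0) :
    ∀ᵐ ω ∂μ, IsRecurrentSet {x | χ (V x ω) ≠ 0} := by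
  obtain ⟨K, hK⟩ := (isCompact_Icc (a := (0 : ℝ)) (b := 1)).exists_bound_of_continuousOn
    hχ.continuousOn
  have hX : IsStationaryField τ (fun x ω => χ (V x ω)) K :=
    ⟨hχ.measurable.comp hV.measurable, fun x y ω => by rw [hV.shift hτ],
      fun x ω => hK _ ⟨hV.nonneg x ω, hV.le_one x ω⟩⟩
  have hpos : 0 < ∫ ω, χ (V 0 ω) ∂μ := by
    refine lt_of_le_of_ne (integral_nonneg fun ω => hχ0 _) fun h0 => ?_
    have hz : ∀ q : ℚ, ∀ᵐ ω ∂μ, χ (V q ω) = 0 := fun q =>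
      (integral_eq_zero_iff_of_nonneg_ae (ae_of_all _ fun ω => hχ0 _) (hX.integrable q)).1
        ((hX.integral_eq hτ q).trans h0.symm)
    obtain ⟨ω, hω, x, hx⟩ := ((ae_all_iff.2 hz).and h).exists
    have hc : Continuous fun x => χ (V x ω) := hχ.comp (hV.continuous ω)
    have := (Rat.denseRange_cast (𝕜 := ℝ)).equalizer hc continuous_const (funext hω)
    exact hx (congrFun this x)
  filter_upwards [hX.ae_hasSlope hτ] with ω hω
  exact isRecurrentSet_of_slope (hX.measurable_left ω) (fun x => hX.bound x ω) hpos hω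

theorem IsUnitPotential.ae_isGoodPath [IsProbabilityMeasure μ] (hV : IsUnitPotential μ τ V)
    (hτ : IsErgodicFlow μ τ) (hB : InverseBranches G m M pm pM p₁ p₃ p₄)
    (hW : IsDoubleWell G m M pm pM) (hβ : 0 < β) :
    ∀ᵐ ω ∂μ, IsGoodPath m M β p₁ p₃ p₄ (leftSlope μ V p₁ p₃ m M β) (rightSlope μ V p₄ β)
      fun x => V x ω := by
  have h1 : ∀ᵐ ω ∂μ, ∀ q : ℚ,
      HasSlope (primitive (negSelection p₁ p₃ m M fun x => q - β * V x ω))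
        (leftSlope μ V p₁ p₃ m M β q) := ae_all_iff.2 fun q => by
    obtain ⟨K, hK⟩ := hV.isStationaryField_left hτ hB hW.m_lt_M hβ q
    exact hK.ae_hasSlope hτ
  have h2 : ∀ᵐ ω ∂μ, ∀ q : ℚ,
      HasSlope (primitive fun x => p₄ (q - β * V x ω)) (rightSlope μ V p₄ β q) :=
    ae_all_iff.2 fun q => by
      obtain ⟨K, hK⟩ := hV.isStationaryField_right hτ hB hβ q
      exact hK.ae_hasSlope hτ
  have h3 : ∀ᵐ ω ∂μ, ∀ n : ℕ, IsRecurrentSet {x | max (1 / ((n : ℝ) + 1) - V x ω) 0 ≠ 0} :=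
    ae_all_iff.2 fun n => by
      refine hV.ae_isRecurrentSet hτ (χ := fun t => max (1 / ((n : ℝ) + 1) - t) 0) (by fun_prop)
        (fun t => le_max_right _ _) ?_
      filter_upwards [hV.normalized] with ω hω
      by_contra hcon
      push Not at hcon
      have : (1 : ℝ) / ((n : ℝ) + 1) ≤ 0 := hω.1.2 (by
        rintro _ ⟨x, rfl⟩
        have := max_eq_right_iff.1 (hcon x)
        simpa using this)
      exact absurd this (not_le.2 (by positivity))
  have h4 : ∀ᵐ ω ∂μ, ∀ n : ℕ, IsRecurrentSet {x | max (V x ω - (1 - 1 / ((n : ℝ) + 1))) 0 ≠ 0} :=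
    ae_all_iff.2 fun n => by
      refine hV.ae_isRecurrentSet hτ (χ := fun t => max (t - (1 - 1 / ((n : ℝ) + 1))) 0)
        (by fun_prop) (fun t => le_max_right _ _) ?_
      filter_upwards [hV.normalized] with ω hω
      by_contra hcon
      push Not at hcon
      have h5 : 1 ≤ (1 : ℝ) - 1 / ((n : ℝ) + 1) := hω.2.2 (by
        rintro _ ⟨x, rfl⟩
        have := max_eq_right_iff.1 (hcon x)
        simpa using this)
      have : (0 : ℝ) < 1 / ((n : ℝ) + 1) := by positivity
      linarith
  filter_upwards [h1, h2, h3, h4] with ω h1 h2 h3 h4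
  refine ⟨hV.continuous ω, fun x => hV.nonneg x ω, fun x => hV.le_one x ω, fun q _ => h1 q,
    fun q _ => h2 q, fun η hη => ?_, fun η hη => ?_⟩
  · obtain ⟨n, hn⟩ := exists_nat_one_div_lt hη
    refine (h3 n).mono fun x hx => ?_
    have : ¬ (1 / ((n : ℝ) + 1) - V x ω ≤ 0) := fun h => hx (max_eq_right h)
    show V x ω < η
    linarith
  · obtain ⟨n, hn⟩ := exists_nat_one_div_lt hη
    refine (h4 n).mono fun x hx => ?_
    have : ¬ (V x ω - (1 - 1 / ((n : ℝ) + 1)) ≤ 0) := fun h => hx (max_eq_right h)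
    show 1 - η < V x ω
    linarith

/-- The effective Hamiltonian. -/
theorem IsUnitPotential.isEffectiveHamiltonian [IsProbabilityMeasure μ]
    (hV : IsUnitPotential μ τ V) (hτ : IsErgodicFlow μ τ) (hG : IsContinuousCoercive G)
    (hB : InverseBranches G m M pm pM p₁ p₃ p₄) (hW : IsDoubleWell G m M pm pM) (hβ : 0 < β)
    (hmM : max β M < m + β) :
    IsEffectiveHamiltonian μ G β V
      (effHam β (leftSlope μ V p₁ p₃ m M β) (rightSlope μ V p₄ β)) := by
  have hθ := hV.isSlopePair hτ hB hW hβ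
  refine ⟨hθ.isContinuousCoercive, ?_⟩
  filter_upwards [hV.ae_isGoodPath hτ hB hW hβ] with ω hω g hg
  have hcor := hω.hasCorrectors hB hW hβ hmM hθ
  refine homogenization_of_correctors (W := fun ε x => β * V (x / ε) ω) (B := β) hG
    hθ.isContinuousCoercive (fun ε hε => ?_) (fun ε hε x => ?_) (fun x₀ θ => (hcor x₀ θ).1)
    (fun x₀ θ => (hcor x₀ θ).2) hg
  · have h1 : UniformContinuous fun x : ℝ => x / ε := by
      simp_rw [div_eq_mul_inv, mul_comm _ ε⁻¹]
      exact uniformContinuous_const_smul ε⁻¹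
    have h2 : UniformContinuous fun x : ℝ => β * x :=
      uniformContinuous_const_smul β
    exact h2.comp ((hV.uniformContinuous ω).comp h1)
  · rw [abs_of_nonneg (mul_nonneg hβ.le (hV.nonneg _ ω))]
    have := mul_le_mul_of_nonneg_left (hV.le_one (x / ε) ω) hβ.le
    linarith

end UnitPotential

/-! ### Null modifications of the potential and uniqueness of the effective Hamiltonian -/

section Transfer

variable {Ω : Type*} [MeasurableSpace Ω] {μ : Measure Ω} {V V' : ℝ → Ω → ℝ} {G : ℝ → ℝ} {β : ℝ}
  {H H' : ℝ → ℝ}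

theorem IsEffectiveHamiltonian.congr_ae (h : IsEffectiveHamiltonian μ G β V H)
    (hV : ∀ᵐ ω ∂μ, ∀ x, V x ω = V' x ω) : IsEffectiveHamiltonian μ G β V' H := by
  refine ⟨h.continuousCoercive, ?_⟩
  filter_upwards [h.homogenization, hV] with ω h1 h2
  simpa only [h2] using h1

theorem IsViscositySolution.linear (H : ℝ → ℝ) (θ : ℝ) :
    IsViscositySolution (fun p _ => H p) (fun x => θ * x) fun z => θ * z.2 - z.1 * H θ := by
  have hd : ∀ z : ℝ × ℝ, HasFDerivAt (fun z : ℝ × ℝ => θ * z.2 - z.1 * H θ)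
      (θ • ContinuousLinearMap.snd ℝ ℝ ℝ - H θ • ContinuousLinearMap.fst ℝ ℝ ℝ) z := fun z => by
    have h := (hasFDerivAt_snd (𝕜 := ℝ) (E := ℝ) (F := ℝ) (p := z)).const_mul θ |>.sub
      ((hasFDerivAt_fst (𝕜 := ℝ) (E := ℝ) (F := ℝ) (p := z)).mul_const (H θ))
    exact h
  have key : ∀ φ : ℝ × ℝ → ℝ, ContDiff ℝ 1 φ → ∀ z : ℝ × ℝ,
      (IsLocalMax (fun z => θ * z.2 - z.1 * H θ - φ z) z ∨
        IsLocalMin (fun z => θ * z.2 - z.1 * H θ - φ z) z) →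
      fderiv ℝ φ z (1, 0) = -H θ ∧ fderiv ℝ φ z (0, 1) = θ := by
    intro φ hφ z hz
    have hφd := (hφ.differentiable one_ne_zero z).hasFDerivAt
    have h1 := (hd z).sub hφd
    have h2 : θ • ContinuousLinearMap.snd ℝ ℝ ℝ - H θ • ContinuousLinearMap.fst ℝ ℝ ℝ -
        fderiv ℝ φ z = 0 := by
      rcases hz with hz | hz
      · exact hz.hasFDerivAt_eq_zero h1
      · exact hz.hasFDerivAt_eq_zero h1
    rw [← sub_eq_zero.1 h2]
    simp
  refine ⟨?_, fun x => by simp, fun φ hφ t x _ hm => ?_, fun φ hφ t x _ hm => ?_⟩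
  · have h := (θ • ContinuousLinearMap.snd ℝ ℝ ℝ -
      H θ • ContinuousLinearMap.fst ℝ ℝ ℝ).uniformContinuous
    refine UniformContinuous.uniformContinuousOn (h.congr fun z => ?_)
    simp [mul_comm]
  · obtain ⟨h1, h2⟩ := key φ hφ _ (Or.inl hm)
    rw [h1, h2]; simp
  · obtain ⟨h1, h2⟩ := key φ hφ _ (Or.inr hm)
    rw [h1, h2]; simp

/-- For the initial condition θx the effective solution is θx - tH(θ). The oscillating solutions do
not involve the effective Hamiltonian, so their limits at (1, 0) identify H(θ) with H'(θ). -/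
theorem IsEffectiveHamiltonian.unique [NeZero μ] (h : IsEffectiveHamiltonian μ G β V H)
    (h' : IsEffectiveHamiltonian μ G β V H') : H = H' := by
  obtain ⟨ω, h1, h2⟩ := (h.homogenization.and h'.homogenization).exists
  funext θ
  have hg : UniformContinuous fun x : ℝ => θ * x :=
    uniformContinuous_const_smul θ
  obtain ⟨u, U, hu, hU, hlim⟩ := h1 _ hg
  obtain ⟨u', U', hu', hU', hlim'⟩ := h2 _ hg
  have hmem : ((1, 0) : ℝ × ℝ) ∈ Ici (0 : ℝ) ×ˢ (univ : Set ℝ) := by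
    constructor <;> simp
  have e1 := hU.2 _ (IsViscositySolution.linear H θ) hmem
  have e2 := hU'.2 _ (IsViscositySolution.linear H' θ) hmem
  have t1 := hlim.tendsto_at hmem
  have t2 := hlim'.tendsto_at hmem
  have e3 : (fun ε => u ε (1, 0)) =ᶠ[𝓝[>] 0] fun ε => u' ε (1, 0) := by
    filter_upwards [self_mem_nhdsWithin] with ε hε
    exact (hu' ε hε).2 _ (hu ε hε).1 hmem
  have e4 := tendsto_nhds_unique (t1.congr' e3) t2
  rw [← e1, ← e2] at e4
  simpa using e4

end Transfer

/-! ### The neutral set of a path -/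

theorem IsRecurrentSet.exists_lt {T : Set ℝ} (h : IsRecurrentSet T) (a : ℝ) : ∃ z ∈ T, z < a := by
  obtain ⟨ε, ⟨z, hz, hz'⟩, hε, hε'⟩ := ((h (-1) (1 / 2) (by norm_num)).and
    ((eventually_mul_lt (C := -a) (show (0 : ℝ) < 1 / 2 by norm_num)).and
    self_mem_nhdsWithin)).exists
  have h0 : (0 : ℝ) < ε := hε'
  refine ⟨z, hz, lt_of_mul_lt_mul_left (a := ε) ?_ h0.le⟩
  rw [abs_lt] at hz'
  linarith

theorem IsRecurrentSet.exists_gt {T : Set ℝ} (h : IsRecurrentSet T) (a : ℝ) : ∃ z ∈ T, a < z := by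
  obtain ⟨ε, ⟨z, hz, hz'⟩, hε, hε'⟩ := ((h 1 (1 / 2) (by norm_num)).and
    ((eventually_mul_lt (C := a) (show (0 : ℝ) < 1 / 2 by norm_num)).and
    self_mem_nhdsWithin)).exists
  have h0 : (0 : ℝ) < ε := hε'
  refine ⟨z, hz, lt_of_mul_lt_mul_left (a := ε) ?_ h0.le⟩
  rw [abs_lt] at hz'
  linarith

/-- The low phase of `f`, which is the high phase of `-f`. -/
def lowSet (m M : ℝ) (f : ℝ → ℝ) : Set ℝ := highSet (-M) (-m) fun x => -f x

/-- The points in neither phase. -/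
def neutralSet (m M : ℝ) (f : ℝ → ℝ) : Set ℝ := (highSet m M f ∪ lowSet m M f)ᶜ

section Neutral

variable {m M : ℝ} {f : ℝ → ℝ}

theorem mem_lowSet {x : ℝ} :
    x ∈ lowSet m M f ↔ ∃ s ≤ x, f s < m ∧ ∀ r ∈ Icc s x, f r < M := by
  simp only [lowSet, highSet, mem_ofPred_eq, neg_lt_neg_iff]

theorem neutralSet_neg : neutralSet (-M) (-m) (fun x => -f x) = neutralSet m M f := by
  simp only [neutralSet, lowSet, neg_neg, union_comm]

/-- Of the two witnessing times, the later one violates the bound attached to the earlier. -/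
theorem disjoint_highSet_lowSet : Disjoint (highSet m M f) (lowSet m M f) := by
  rw [disjoint_left]
  intro x hx hx'
  obtain ⟨s, hs, hM, hr⟩ := hx
  obtain ⟨s', hs', hm, hr'⟩ := mem_lowSet.1 hx'
  rcases le_total s s' with h | h
  · have := hr s' ⟨h, hs'⟩; linarith
  · have := hr' s ⟨h, hs⟩; linarith

theorem mem_Icc_of_mem_neutralSet (hmM : m < M) {x : ℝ} (hx : x ∈ neutralSet m M f) :
    m ≤ f x ∧ f x ≤ M := by
  simp only [neutralSet, mem_compl_iff, mem_union, not_or] at hx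
  constructor
  · by_contra h
    exact hx.2 (mem_highSet_of_lt (by linarith) (neg_lt_neg (not_le.1 h)))
  · by_contra h
    exact hx.1 (mem_highSet_of_lt hmM (not_le.1 h))

theorem exists_rat_left {p : ℝ → Prop} {a ρ : ℝ} (hρ : 0 < ρ)
    (hopen : ∀ s, p s → ∀ᶠ r in 𝓝 s, p r) (h : ∀ ρ > 0, ∃ s < a, a - ρ < s ∧ p s) :
    ∃ q : ℚ, (q : ℝ) < a ∧ a - ρ < q ∧ p q := by
  obtain ⟨s, hsa, hρs, hs⟩ := h ρ hρ
  obtain ⟨κ, hκ, hp⟩ := exists_Ioo_of_eventually_nhds (hopen s hs)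
  obtain ⟨q, hq, hq'⟩ := exists_rat_btwn (show s < min a (s + κ) from lt_min hsa (by linarith))
  have h1 := hq'.trans_le (min_le_left _ _)
  have h2 := hq'.trans_le (min_le_right _ _)
  exact ⟨q, h1, hρs.trans hq, hp q (by rw [abs_lt]; constructor <;> linarith)⟩

/-- The last point of closure of an open property before a point without it. -/
theorem exists_last_exit {p : ℝ → Prop} {x : ℝ} (hopen : ∀ s, p s → ∀ᶠ r in 𝓝 s, p r)
    (hx : ¬ p x) (hne : ∃ s ≤ x, p s) :
    ∃ a ≤ x, (∀ r ∈ Icc a x, ¬ p r) ∧ ∀ ρ > 0, ∃ s < a, a - ρ < s ∧ p s := by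
  obtain ⟨s₀, hs₀, hp₀⟩ := hne
  have hbdd : BddAbove {s | s ≤ x ∧ p s} := ⟨x, fun _ h => h.1⟩
  have hlub := isLUB_csSup (show {s | s ≤ x ∧ p s}.Nonempty from ⟨s₀, hs₀, hp₀⟩) hbdd
  obtain ⟨a, ha⟩ : ∃ a, a = sSup {s | s ≤ x ∧ p s} := ⟨_, rfl⟩
  rw [← ha] at hlub
  have hax : a ≤ x := hlub.2 fun _ h => h.1
  have hna : ¬ p a := by
    intro hpa
    obtain ⟨κ, hκ, hp⟩ := exists_Ioo_of_eventually_nhds (hopen a hpa)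
    rcases hax.eq_or_lt with rfl | hax
    · exact hx hpa
    have hlt : a < min x (a + κ / 2) := lt_min hax (by linarith)
    have := hlub.1 ⟨min_le_left x (a + κ / 2), hp _ (by
      have := min_le_right x (a + κ / 2)
      rw [abs_lt]; constructor <;> linarith)⟩
    linarith
  refine ⟨a, hax, fun r hr hpr => ?_, fun ρ hρ => ?_⟩
  · have := hlub.1 ⟨hr.2, hpr⟩
    exact hna (by rwa [le_antisymm hr.1 this])
  · obtain ⟨s, hs, hs', hs''⟩ := hlub.exists_between (show a - ρ < a by linarith)
    exact ⟨s, lt_of_le_of_ne hs'' fun h => hna (h ▸ hs.2), hs', hs.2⟩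

theorem isLeast_csInf_of_le {q x : ℝ} {S : Set ℝ} (hS : IsClosed S) (hx : x ∈ S) (hq : q ≤ x) :
    IsLeast {s | q ≤ s ∧ s ∈ S} (sInf {s | q ≤ s ∧ s ∈ S}) :=
  (isClosed_Ici.inter hS : IsClosed {s | q ≤ s ∧ s ∈ S}).isLeast_csInf ⟨x, hq, hx⟩
    ⟨q, fun _ h => h.1⟩

/-- Rational witnesses of a local maximum at the height `M`, first reached after `q`. -/
def IsMaxPattern (m M : ℝ) (f : ℝ → ℝ) (q r r' : ℚ) : Prop :=
  (q < r ∧ r < r') ∧ f q < m ∧ (∀ s ∈ Icc (q : ℝ) r', f s ≤ M) ∧ ∃ s ∈ Icc (q : ℝ) r, M ≤ f s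

/-- Rational witnesses of a local minimum at the height `m`, first reached after an excursion above
`M` which follows `b`. -/
def IsMinPattern (m M : ℝ) (f : ℝ → ℝ) (b b' q r r' : ℚ) : Prop :=
  (b < b' ∧ b' < q ∧ q < r ∧ r < r') ∧ f b < m ∧ (∀ s ∈ Icc (b : ℝ) b', f s ≤ M) ∧ M < f q ∧
    (∀ s ∈ Icc (b' : ℝ) r', m ≤ f s) ∧ ∃ s ∈ Icc (q : ℝ) r, f s ≤ m

/-- A neutral point lies in [m, M]; go back to the last exit a of the path from that interval. If
the path was below m just before a, it must have met M since, else x would be low; if it was above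
M, it must have met m since, else x would be high. Unless x is the first such meeting after some
rational, the meeting occurs strictly before x, and the path stays on one side of that height around
it: this is one of the two patterns. -/
theorem countable_neutralSet (hf : Continuous f) (hmM : m < M) (hlow : ∀ a, ∃ s < a, f s < m)
    (hmax : ∀ q r r', ¬ IsMaxPattern m M f q r r')
    (hmin : ∀ b b' q r r', ¬ IsMinPattern m M f b b' q r r') : (neutralSet m M f).Countable := by
  refine ((countable_range fun q : ℚ => sInf {s | (q : ℝ) ≤ s ∧ s ∈ {s | M ≤ f s}}).union
    (countable_range fun q : ℚ => sInf {s | (q : ℝ) ≤ s ∧ s ∈ {s | f s ≤ m}})).mono fun x hx => ?_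
  by_contra hcon
  simp only [mem_union, not_or] at hcon
  obtain ⟨hX, hY⟩ := hcon
  have hx' := mem_Icc_of_mem_neutralSet hmM hx
  simp only [neutralSet, mem_compl_iff, mem_union, not_or] at hx
  have ho1 : ∀ s, f s < m → ∀ᶠ r in 𝓝 s, f r < m := fun s hs =>
    hf.continuousAt.eventually (gt_mem_nhds hs)
  have ho2 : ∀ s, M < f s → ∀ᶠ r in 𝓝 s, M < f r := fun s hs =>
    hf.continuousAt.eventually (lt_mem_nhds hs)
  obtain ⟨a, hax, hmid, hleft⟩ := exists_last_exit (p := fun s => f s < m ∨ M < f s) (x := x)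
    (fun s hs => hs.elim (fun h => (ho1 s h).mono fun _ => Or.inl)
      fun h => (ho2 s h).mono fun _ => Or.inr)
    (by push Not; exact hx') (by
      obtain ⟨s, hs, hs'⟩ := hlow x
      exact ⟨s, hs.le, Or.inl hs'⟩)
  push Not at hmid
  by_cases hfa : f a < M
  · obtain ⟨ρ, hρ, hnear⟩ := exists_Ioo_of_eventually_nhds
      (hf.continuousAt.eventually (gt_mem_nhds hfa))
    obtain ⟨q, hqa, hρq, hq⟩ := exists_rat_left (p := fun s => f s < m) hρ ho1 fun κ hκ => by
      obtain ⟨s, hs, hs', h | h⟩ := hleft (min κ ρ) (lt_min hκ hρ)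
      · exact ⟨s, hs, by linarith [min_le_left κ ρ], h⟩
      · have := hnear s (by rw [abs_lt]; constructor <;> linarith [min_le_right κ ρ])
        linarith
    have hle : ∀ s ∈ Icc (q : ℝ) x, f s ≤ M := fun s hs => by
      rcases le_total s a with h | h
      · exact (hnear s (by rw [abs_lt]; constructor <;> linarith [hs.1])).le
      · exact (hmid s ⟨h, hs.2⟩).2
    have : ∃ r ∈ Icc (q : ℝ) x, M ≤ f r := by
      by_contra h
      push Not at h
      exact hx.2 (mem_lowSet.2 ⟨q, by linarith, hq, h⟩)
    obtain ⟨r, hr, hMr⟩ := this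
    have hleast := isLeast_csInf_of_le (S := {s | M ≤ f s}) (isClosed_le continuous_const hf) hMr hr.1
    obtain ⟨t, ht⟩ : ∃ t, t = sInf {s | (q : ℝ) ≤ s ∧ s ∈ {s | M ≤ f s}} := ⟨_, rfl⟩
    rw [← ht] at hleast
    -- As x is not a first hitting time after a rational, there is room for two rationals between t
    -- and x.
    have htx : t < x := lt_of_le_of_ne ((hleast.2 ⟨hr.1, hMr⟩).trans hr.2)
      fun h => hX ⟨q, by rw [← h, ht]⟩
    obtain ⟨r₁, h1, h2⟩ := exists_rat_btwn htx
    obtain ⟨r₂, h3, h4⟩ := exists_rat_btwn h2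
    have hqt := hleast.1.1
    exact hmax q r₁ r₂ ⟨⟨by exact_mod_cast hqt.trans_lt h1, by exact_mod_cast h3⟩, hq,
      fun s hs => hle s ⟨hs.1, hs.2.trans h4.le⟩, t, ⟨hqt, h1.le⟩, hleast.1.2⟩
  · have hfa' : m < f a := hmM.trans_le (not_lt.1 hfa)
    obtain ⟨ρ, hρ, hnear⟩ := exists_Ioo_of_eventually_nhds
      (hf.continuousAt.eventually (lt_mem_nhds hfa'))
    obtain ⟨q, hqa, hρq, hq⟩ := exists_rat_left (p := fun s => M < f s) hρ ho2 fun κ hκ => by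
      obtain ⟨s, hs, hs', h | h⟩ := hleft (min κ ρ) (lt_min hκ hρ)
      · have := hnear s (by rw [abs_lt]; constructor <;> linarith [min_le_right κ ρ])
        linarith
      · exact ⟨s, hs, by linarith [min_le_left κ ρ], h⟩
    have hge : ∀ s ∈ Icc (q : ℝ) x, m ≤ f s := fun s hs => by
      rcases le_total s a with h | h
      · exact (hnear s (by rw [abs_lt]; constructor <;> linarith [hs.1])).le
      · exact (hmid s ⟨h, hs.2⟩).1
    have : ∃ r ∈ Icc (q : ℝ) x, f r ≤ m := by
      by_contra h
      push Not at h
      exact hx.1 ⟨q, by linarith, hq, h⟩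
    obtain ⟨r, hr, hmr⟩ := this
    have hleast := isLeast_csInf_of_le (S := {s | f s ≤ m}) (isClosed_le hf continuous_const) hmr hr.1
    obtain ⟨t, ht⟩ : ∃ t, t = sInf {s | (q : ℝ) ≤ s ∧ s ∈ {s | f s ≤ m}} := ⟨_, rfl⟩
    rw [← ht] at hleast
    have htx : t < x := lt_of_le_of_ne ((hleast.2 ⟨hr.1, hmr⟩).trans hr.2)
      fun h => hY ⟨q, by rw [← h, ht]⟩
    have hqt := hleast.1.1
    obtain ⟨r₁, h1, h2⟩ := exists_rat_btwn htx
    obtain ⟨r₂, h3, h4⟩ := exists_rat_btwn h2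
    -- The minimum pattern must also record how the excursion began: z ends the last stretch below m
    -- before q, and around z the path is still below M.
    obtain ⟨z, hzq, hz, hzleft⟩ := exists_last_exit (p := fun s => f s < m) (x := q) ho1
      (by linarith) (by
        obtain ⟨s, hs, hs'⟩ := hlow q
        exact ⟨s, hs.le, hs'⟩)
    push Not at hz
    have hfz : f z < M := by
      refine lt_of_le_of_lt (b := m) (le_of_forall_pos_le_add fun κ hκ => ?_) hmM
      by_contra hlt
      obtain ⟨ρ', hρ', hn⟩ := exists_Ioo_of_eventually_nhds
        (hf.continuousAt.eventually (lt_mem_nhds (show m < f z by linarith)))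
      obtain ⟨s, hs, hs', hfs⟩ := hzleft ρ' hρ'
      have := hn s (by rw [abs_lt]; constructor <;> linarith)
      linarith
    obtain ⟨ρ', hρ', hn⟩ := exists_Ioo_of_eventually_nhds
      (hf.continuousAt.eventually (gt_mem_nhds hfz))
    have hzq' : z < q := lt_of_le_of_ne hzq fun h => by rw [h] at hfz; linarith
    obtain ⟨b, hbz, hb, hfb⟩ := exists_rat_left (p := fun s => f s < m) hρ' ho1 hzleft
    obtain ⟨b', hb1, hb2⟩ := exists_rat_btwn (show z < min (q : ℝ) (z + ρ') from
      lt_min hzq' (by linarith))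
    have hb3 := hb2.trans_le (min_le_left _ _)
    have hb4 := hb2.trans_le (min_le_right _ _)
    refine hmin b b' q r₁ r₂ ⟨⟨by exact_mod_cast hbz.trans hb1, by exact_mod_cast hb3,
      by exact_mod_cast hqt.trans_lt h1, by exact_mod_cast h3⟩, hfb, fun s hs => ?_, hq,
      fun s hs => ?_, t, ⟨hqt, h1.le⟩, hleast.1.2⟩
    · exact (hn s (by rw [abs_lt]; constructor <;> linarith [hs.1, hs.2])).le
    · rcases le_total s q with h | h
      · exact hz s ⟨hb1.le.trans hs.1, h⟩
      · exact hge s ⟨h, hs.2.trans h4.le⟩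

/-- Starting below m at time 0 forces `y (-1)` ≤ 0, so `x 0` is the first time after 0 at which the
path reaches M. It lies strictly inside an interval on which f ≤ M. -/
theorem IsLowerUpcrossing.isLocalMax (hf : Continuous f) {x y : ℤ → ℝ}
    (h : IsLowerUpcrossing m M f x y) (h0 : f 0 < m) {t r : ℝ} (ht0 : 0 ≤ t) (htr : t < r)
    (ht : M ≤ f t) (hle : ∀ s ∈ Icc 0 r, f s ≤ M) : IsLocalMax f (x 0) := by
  have hy : y (-1) ≤ 0 := (h.down (-1)).1 ⟨h.anchor.1, h0⟩
  have hx : x 0 ≤ t := (h.up 0).1 ⟨hy.trans ht0, ht⟩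
  have hcl : IsClosed {s | y (0 - 1) ≤ s ∧ M ≤ f s} :=
    isClosed_Ici.inter (isClosed_le continuous_const hf)
  have hfx := ((h.up 0).mem_of_isClosed ⟨t, hy.trans ht0, ht⟩ hcl).2
  filter_upwards [Ioo_mem_nhds h.anchor.2 (hx.trans_lt htr)] with s hs
  exact (hle s ⟨hs.1.le, hs.2.le⟩).trans hfx

/-- The bound on [0, b] prevents the excursion above M from starting before b. Hence `x 0` ≥ b, and
`y 0` lies strictly between b and r, where f ≥ m. -/
theorem IsUpperUpcrossing.isLocalMin (hf : Continuous f) (hmM : m < M) {x y : ℤ → ℝ}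
    (h : IsUpperUpcrossing m M f x y) (h0 : f 0 < m) {b s t r : ℝ} (hb : 0 ≤ b) (hbs : b ≤ s)
    (hst : s ≤ t) (htr : t < r) (hs : M < f s) (ht : f t ≤ m) (hle : ∀ s ∈ Icc 0 b, f s ≤ M)
    (hge : ∀ s ∈ Icc b r, m ≤ f s) : IsLocalMin f (y 0) := by
  have hy : y (-1) ≤ 0 := (h.down (-1)).1 ⟨h.anchor.1.le, h0.le⟩
  have hx : x 0 ≤ s := (h.up 0).1 ⟨hy.trans (hb.trans hbs), hs⟩
  have hbx : b ≤ x 0 := by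
    refine (h.up 0).2 fun w hw => ?_
    by_contra hlt
    have h1 : x 0 ≤ w := (h.up 0).1 hw
    have := hle w ⟨h.anchor.2.trans h1, (not_le.1 hlt).le⟩
    linarith [hw.2]
  have hfx : M ≤ f (x 0) := by
    have hmem := (h.up 0).mem_closure ⟨s, hy.trans (hb.trans hbs), hs⟩
    exact closure_minimal (fun w hw => hw.2.le) (isClosed_le continuous_const hf) hmem
  have hcl : IsClosed {s | x 0 ≤ s ∧ f s ≤ m} :=
    isClosed_Ici.inter (isClosed_le hf continuous_const)
  have hyt : y 0 ≤ t := (h.down 0).1 ⟨hx.trans hst, ht⟩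
  have hfy := (h.down 0).mem_of_isClosed ⟨t, hx.trans hst, ht⟩ hcl
  have hxy : x 0 < y 0 := lt_of_le_of_ne hfy.1 fun he => by
    have := hfy.2; rw [← he] at this; linarith
  filter_upwards [Ioo_mem_nhds (hbx.trans_lt hxy) (hyt.trans_lt htr)] with w hw
  exact hfy.2.trans (hge w ⟨hw.1.le, hw.2.le⟩)

end Neutral

/-! ### Existence of the upcrossing sequences -/

/-- The points at which `f` reaches the height `M` after having been below `m`. -/
def upcrossingSet (m M : ℝ) (f : ℝ → ℝ) : Set ℝ :=
  {x | M ≤ f x ∧ ∃ s < x, f s < m ∧ ∀ r ∈ Ico s x, f r < M}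

section Crossings

variable {m M : ℝ} {f : ℝ → ℝ} {x y : ℤ → ℝ}

theorem exists_mem_upcrossingSet (hf : Continuous f) (hmM : m < M) {s u : ℝ} (hsu : s ≤ u)
    (hs : f s < m) (hu : M ≤ f u) : ∃ t ∈ upcrossingSet m M f, s < t ∧ t ≤ u := by
  have hleast := isLeast_csInf_of_le (S := {s | M ≤ f s}) (isClosed_le continuous_const hf) hu hsu
  obtain ⟨t, ht⟩ : ∃ t, t = sInf {r | s ≤ r ∧ r ∈ {s | M ≤ f s}} := ⟨_, rfl⟩
  rw [← ht] at hleast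
  obtain ⟨⟨h1, h2⟩, h3⟩ := hleast
  simp only [mem_ofPred_eq] at h2
  have hst : s < t := lt_of_le_of_ne h1 fun h => by rw [← h] at h2; linarith
  refine ⟨t, ⟨h2, s, hst, hs, fun r hr => ?_⟩, hst, h3 ⟨hsu, hu⟩⟩
  by_contra hlt
  have : t ≤ r := h3 ⟨hr.1, not_lt.1 hlt⟩
  linarith [hr.2]

/-- After one point of the set the path must go below m before the next; by uniform continuity,
descending from M to m takes a minimal time. -/
theorem exists_gap_upcrossingSet (hf : UniformContinuous f) (hmM : m < M) :
    ∃ ℓ > 0, ∀ x ∈ upcrossingSet m M f, ∀ y ∈ upcrossingSet m M f, x < y → ℓ ≤ y - x := by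
  obtain ⟨ℓ, hℓ, h⟩ := Metric.uniformContinuous_iff.1 hf (M - m) (sub_pos.2 hmM)
  refine ⟨ℓ, hℓ, fun x hx y hy hxy => ?_⟩
  obtain ⟨-, s, hsy, hs, hr⟩ := hy
  have hxs : x < s := by
    by_contra hlt
    have := hr x ⟨not_lt.1 hlt, hxy⟩
    linarith [hx.1]
  by_contra hlt
  have := h (a := x) (b := s) (by rw [Real.dist_eq, abs_lt]; constructor <;> linarith)
  rw [Real.dist_eq] at this
  linarith [(le_abs_self (f x - f s)), hx.1]

/-- The gap makes all order intervals of S finite. A locally finite linear order without endpoints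
is isomorphic to ℤ. -/
theorem exists_orderIso_of_gap {S : Set ℝ} {ℓ : ℝ} (hℓ : 0 < ℓ)
    (hgap : ∀ x ∈ S, ∀ y ∈ S, x < y → ℓ ≤ y - x) (hbot : ∀ a, ∃ x ∈ S, x < a)
    (htop : ∀ a, ∃ x ∈ S, a < x) : Nonempty (ℤ ≃o S) := by
  classical
  have hfin : ∀ a b : S, (Icc a b).Finite := fun a b => by
    refine Finite.of_injOn (f := fun x : S => ⌊(x : ℝ) / ℓ⌋)
      (t := Icc ⌊(a : ℝ) / ℓ⌋ ⌊(b : ℝ) / ℓ⌋) (fun x hx => ⟨?_, ?_⟩) ?_ (finite_Icc _ _)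
    · have : (a : ℝ) ≤ x := hx.1
      exact Int.floor_le_floor (by gcongr)
    · have : (x : ℝ) ≤ b := hx.2
      exact Int.floor_le_floor (by gcongr)
    · intro x _ y _ hxy
      have h1 := Int.abs_sub_lt_one_of_floor_eq_floor hxy
      rw [← sub_div, abs_div, abs_of_pos hℓ, div_lt_one hℓ, abs_lt] at h1
      rcases lt_trichotomy (x : ℝ) y with h | h | h
      · have := hgap x x.2 y y.2 h; linarith
      · exact Subtype.ext h
      · have := hgap y y.2 x x.2 h; linarith
  let _ : LocallyFiniteOrder S := LocallyFiniteOrder.ofFiniteIcc hfin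
  let _ : SuccOrder S := LinearLocallyFiniteOrder.succOrder S
  let _ : PredOrder S := LinearLocallyFiniteOrder.predOrder S
  have : NoMaxOrder S := ⟨fun a => by
    obtain ⟨x, hx, h⟩ := htop a
    exact ⟨⟨x, hx⟩, h⟩⟩
  have : NoMinOrder S := ⟨fun a => by
    obtain ⟨x, hx, h⟩ := hbot a
    exact ⟨⟨x, hx⟩, h⟩⟩
  have : Nonempty S := by
    obtain ⟨x, hx, -⟩ := htop 0
    exact ⟨⟨x, hx⟩⟩
  exact ⟨(orderIsoIntOfLinearSuccPredArch (ι := S)).symm⟩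

/-- Unanchored sequences of alternating crossings, unbounded in both directions. -/
structure IsCrossing (m M : ℝ) (f : ℝ → ℝ) (x y : ℤ → ℝ) : Prop where
  up : ∀ i, IsGLB {s | y (i - 1) ≤ s ∧ M ≤ f s} (x i)
  down : ∀ i, IsGLB {s | x i ≤ s ∧ f s < m} (y i)
  exists_lt : ∀ a, ∃ i, x i < a
  exists_gt : ∀ a, ∃ i, a < x i

/-- Paths which go below `m` and above `M` arbitrarily far on both sides. -/
structure IsOscillating (m M : ℝ) (f : ℝ → ℝ) : Prop where
  low_left : ∀ a, ∃ s < a, f s < m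
  low_right : ∀ a, ∃ s, a < s ∧ f s < m
  high_left : ∀ a, ∃ s < a, M < f s
  high_right : ∀ a, ∃ s, a < s ∧ M < f s

theorem IsOscillating.neg (h : IsOscillating m M f) : IsOscillating (-M) (-m) fun x => -f x :=
  ⟨by simpa using h.high_left, by simpa using h.high_right, by simpa using h.low_left,
    by simpa using h.low_right⟩

theorem IsOscillating.exists_isCrossing (h : IsOscillating m M f) (hf : UniformContinuous f)
    (hmM : m < M) : ∃ x y, IsCrossing m M f x y := by
  have hfc := hf.continuous
  obtain ⟨ℓ, hℓ, hgap⟩ := exists_gap_upcrossingSet hf hmM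
  have hbot : ∀ a, ∃ x ∈ upcrossingSet m M f, x < a := fun a => by
    obtain ⟨u, hu, hMu⟩ := h.high_left a
    obtain ⟨s, hs, hms⟩ := h.low_left u
    obtain ⟨t, ht, -, htu⟩ := exists_mem_upcrossingSet hfc hmM hs.le hms hMu.le
    exact ⟨t, ht, htu.trans_lt hu⟩
  have htop : ∀ a, ∃ x ∈ upcrossingSet m M f, a < x := fun a => by
    obtain ⟨s, hs, hms⟩ := h.low_right a
    obtain ⟨u, hu, hMu⟩ := h.high_right s
    obtain ⟨t, ht, hst, -⟩ := exists_mem_upcrossingSet hfc hmM hu.le hms hMu.le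
    exact ⟨t, ht, hs.trans hst⟩
  obtain ⟨e⟩ := exists_orderIso_of_gap hℓ hgap hbot htop
  have hdown : ∀ i, IsGLB {s | (e i : ℝ) ≤ s ∧ f s < m} (sInf {s | (e i : ℝ) ≤ s ∧ f s < m}) :=
    fun i => isGLB_csInf (by
      obtain ⟨s, hs, hs'⟩ := h.low_right (e i)
      exact ⟨s, hs.le, hs'⟩) ⟨e i, fun _ hs => hs.1⟩
  refine ⟨fun i => e i, fun i => sInf {s | (e i : ℝ) ≤ s ∧ f s < m}, ⟨fun i => ⟨fun s hs => ?_,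
    fun b hb => hb ?_⟩, hdown, fun a => ?_, fun a => ?_⟩⟩
  · by_contra hlt
    push Not at hlt
    obtain ⟨hys, hMs⟩ := hs
    have hglb := hdown (i - 1)
    obtain ⟨y, hy⟩ : ∃ y, y = sInf {s | (e (i - 1) : ℝ) ≤ s ∧ f s < m} := ⟨_, rfl⟩
    rw [← hy] at hglb hys
    have hfy : f y ≤ m := by
      obtain ⟨w, hw, hw'⟩ := h.low_right (e (i - 1))
      exact closure_minimal (fun w hw => hw.2.le) (isClosed_le hfc continuous_const)
        (hglb.mem_closure ⟨w, hw.le, hw'⟩)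
    have hys' : y < s := lt_of_le_of_ne hys fun he => by rw [he] at hfy; linarith
    obtain ⟨w, hw, -, hws⟩ := hglb.exists_between hys'
    obtain ⟨t, ht, hwt, hts⟩ := exists_mem_upcrossingSet hfc hmM hws.le hw.2 hMs
    have h1 : e (i - 1) < ⟨t, ht⟩ := hw.1.trans_lt hwt
    have h2 : (⟨t, ht⟩ : upcrossingSet m M f) < e i := hts.trans_lt hlt
    -- The new upcrossing t would lie strictly between those numbered i - 1 and i.
    rw [← e.apply_symm_apply ⟨t, ht⟩, e.lt_iff_lt] at h1 h2
    omega
  · obtain ⟨hM, s, hs, hms, hr⟩ := (e i).2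
    refine ⟨(hdown (i - 1)).1 ⟨?_, hms⟩ |>.trans hs.le, hM⟩
    by_contra hlt
    have hlt' : (e (i - 1) : ℝ) < e i := e.lt_iff_lt.2 (by omega)
    have := hr _ ⟨(not_le.1 hlt).le, hlt'⟩
    linarith [(e (i - 1)).2.1]
  · obtain ⟨t, ht, hta⟩ := hbot a
    exact ⟨e.symm ⟨t, ht⟩, by simpa using hta⟩
  · obtain ⟨t, ht, hta⟩ := htop a
    exact ⟨e.symm ⟨t, ht⟩, by simpa using hta⟩

theorem IsCrossing.le (h : IsCrossing m M f x y) (i : ℤ) : x i ≤ y i ∧ y (i - 1) ≤ x i :=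
  ⟨(h.down i).2 fun _ hs => hs.1, (h.up i).2 fun _ hs => hs.1⟩

theorem exists_anchor {z : ℤ → ℝ} (hz : ∀ i, z (i - 1) ≤ z i) {p : ℝ → Prop}
    (hp : ∀ a b, a ≤ b → p a → p b) (h1 : ∃ i, p (z i)) (h2 : ∃ i, ¬ p (z i)) :
    ∃ k, p (z k) ∧ ¬ p (z (k - 1)) := by
  have hmono : Monotone z := monotone_int_of_le_succ fun i => by simpa using hz (i + 1)
  obtain ⟨j, hj⟩ := h2
  obtain ⟨k, hk, hk'⟩ := Int.exists_least_of_bdd (P := fun i => p (z i))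
    ⟨j, fun i hi => by
      by_contra hlt
      exact hj (hp _ _ (hmono (not_le.1 hlt).le) hi)⟩ h1
  exact ⟨k, hk, fun h => by have := hk' _ h; omega⟩

theorem IsCrossing.exists_isLowerUpcrossing (h : IsCrossing m M f x y) :
    ∃ k : ℤ, IsLowerUpcrossing m M f (fun i => x (i + k)) fun i => y (i + k) := by
  obtain ⟨k, hk, hk'⟩ := exists_anchor (z := x) (p := fun a => 0 < a)
    (fun i => (h.le (i - 1)).1.trans (h.le i).2) (fun a b hab ha => ha.trans_le hab)
    (h.exists_gt 0) (by
      obtain ⟨i, hi⟩ := h.exists_lt 0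
      exact ⟨i, hi.le.not_gt⟩)
  refine ⟨k, fun i => ?_, fun i => h.down _, ?_⟩
  · have := h.up (i + k)
    rwa [add_sub_right_comm] at this
  · rw [neg_add_eq_sub, zero_add]
    exact ⟨not_lt.1 hk', hk⟩

/-- For -f with thresholds -M and -m, the points reaching -m are the arrivals of f at m, and the
descents below -M are its passages above M. The two sequences exchange roles, with an index shift of
one. -/
theorem IsCrossing.exists_isUpperUpcrossing (h : IsCrossing (-M) (-m) (fun s => -f s) x y) :
    ∃ k : ℤ, IsUpperUpcrossing m M f (fun i => y (i + k - 1)) fun i => x (i + k) := by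
  obtain ⟨k, hk, hk'⟩ := exists_anchor (z := fun i => y (i - 1)) (p := fun a => 0 ≤ a)
    (fun i => (h.le (i - 1)).2.trans (h.le (i - 1)).1) (fun a b hab ha => ha.trans hab)
    (by
      obtain ⟨i, hi⟩ := h.exists_gt 0
      exact ⟨i + 1, by simpa using hi.le.trans (h.le i).1⟩) (by
      obtain ⟨i, hi⟩ := h.exists_lt 0
      exact ⟨i, ((h.le i).2.trans_lt hi).not_ge⟩)
  refine ⟨k, fun i => ?_, fun i => ?_, ?_⟩
  · have := h.down (i + k - 1)
    simp only [neg_lt_neg_iff] at this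
    rwa [add_sub_right_comm] at this ⊢
  · have := h.up (i + k)
    simpa only [neg_le_neg_iff] using this
  · rw [neg_add_eq_sub, zero_add]
    exact ⟨not_le.1 hk', hk⟩

/-- At a local maximum X the path touches M without exceeding it, so points just to the right are
not high: going further back, the path was below M since Y, where it was at most m. They are not low
either, because f = M at X and f > m since. A whole interval would then be neutral. -/
theorem IsCrossing.not_isLocalMax (h : IsCrossing m M f x y) (hf : Continuous f) (hmM : m < M)
    (h0 : volume (neutralSet m M f) = 0) (i : ℤ) : ¬ IsLocalMax f (x i) := by
  intro hmax
  have hup := h.up i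
  have hdown := h.down (i - 1)
  obtain ⟨X, hX⟩ : ∃ X, X = x i := ⟨_, rfl⟩
  obtain ⟨Y, hY⟩ : ∃ Y, Y = y (i - 1) := ⟨_, rfl⟩
  rw [← hX] at hup hmax
  rw [← hY] at hup hdown
  have hfY : f Y ≤ m := closure_minimal (fun w hw => hw.2.le) (isClosed_le hf continuous_const)
    (hdown.mem_closure hdown.nonempty)
  have hcl : IsClosed {s | Y ≤ s ∧ M ≤ f s} := isClosed_Ici.inter (isClosed_le continuous_const hf)
  obtain ⟨hYX, hMX⟩ := hup.mem_of_isClosed hup.nonempty hcl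
  have hlt : ∀ s, Y ≤ s → s < X → f s < M := fun s h1 h2 => by
    by_contra hcon
    have := hup.1 ⟨h1, not_lt.1 hcon⟩
    linarith
  have hYX' : Y < X := lt_of_le_of_ne hYX fun he => by rw [he] at hfY; linarith
  have hfX : f X = M := by
    refine le_antisymm (le_of_tendsto
      (hf.continuousAt.tendsto.mono_left (nhdsWithin_le_nhds (s := Iio X))) ?_) hMX
    filter_upwards [Ioo_mem_nhdsLT hYX'] with s hs using (hlt s hs.1.le hs.2).le
  obtain ⟨ρ, hρ, hnear⟩ := exists_Ioo_of_eventually_nhds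
    (hmax.and (hf.continuousAt.eventually (lt_mem_nhds (show m < f X by linarith))))
  have hsub : Ioo X (X + ρ) ⊆ neutralSet m M f := by
    intro q hq
    have hin : ∀ s, X ≤ s → s ≤ q → f s ≤ f X ∧ m < f s := fun s h1 h2 =>
      hnear s (by rw [abs_lt]; constructor <;> linarith [hq.2])
    simp only [neutralSet, mem_compl_iff, mem_union, not_or]
    constructor
    · rintro ⟨s, hs, hMs, hr⟩
      rcases le_or_gt X s with h1 | h1
      · linarith [(hin s h1 hs).1]
      rcases le_or_gt Y s with h2 | h2
      · linarith [hlt s h2 h1]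
      · linarith [hr Y ⟨h2.le, hYX.trans hq.1.le⟩]
    · rw [mem_lowSet]
      rintro ⟨s, hs, hms, hr⟩
      rcases le_or_gt X s with h1 | h1
      · linarith [(hin s h1 hs).2]
      · linarith [hr X ⟨h1.le, hq.1.le⟩]
  have := (measure_mono_null hsub h0)
  rw [Real.volume_Ioo, ENNReal.ofReal_eq_zero] at this
  linarith

theorem exists_upcrossings_of_null (h : IsOscillating m M f) (hf : UniformContinuous f)
    (hmM : m < M) (h0 : volume (neutralSet m M f) = 0) :
    (∃ x y, IsLowerUpcrossing m M f x y ∧ ¬ IsLocalMax f (x 0)) ∧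
      ∃ x y, IsUpperUpcrossing m M f x y ∧ ¬ IsLocalMin f (y 0) := by
  constructor
  · obtain ⟨x, y, hxy⟩ := h.exists_isCrossing hf hmM
    obtain ⟨k, hk⟩ := hxy.exists_isLowerUpcrossing
    exact ⟨_, _, hk, hxy.not_isLocalMax hf.continuous hmM h0 _⟩
  · obtain ⟨x, y, hxy⟩ := h.neg.exists_isCrossing hf.neg (neg_lt_neg hmM)
    obtain ⟨k, hk⟩ := hxy.exists_isUpperUpcrossing
    refine ⟨_, _, hk, fun hmin => ?_⟩
    exact hxy.not_isLocalMax hf.continuous.neg (neg_lt_neg hmM) (by rwa [neutralSet_neg]) _ hmin.neg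

end Crossings

/-! ### Flat pieces of the effective Hamiltonian -/

/-- Between the right limit a and the value `θL h`, the slope θ is enclosed at every level above h
and at no level between β and h. Conversely, a flat interval must lie between the limits of one of
the slope functions at h; continuity of θR excludes the right side. -/
theorem IsSlopePair.hasFlatPiece_iff {β h a : ℝ} {θL θR : ℝ → ℝ} (hθ : IsSlopePair β θL θR)
    (hβ : β < h) (hL : Tendsto θL (𝓝[<] h) (𝓝 (θL h))) (hL' : Tendsto θL (𝓝[>] h) (𝓝 a))
    (hR : Continuous θR) : HasFlatPiece (effHam β θL θR) h ↔ a < θL h := by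
  have hev : ∀ᶠ l in 𝓝[<] h, β ≤ l ∧ l < h := by
    filter_upwards [Ioo_mem_nhdsLT hβ] with l hl using ⟨hl.1.le, hl.2⟩
  constructor
  · rintro ⟨b, c, hbc, hflat⟩
    rcases lt_or_ge 0 c with hc | hc
    · exfalso
      obtain ⟨d, hd, hdc⟩ := exists_between (max_lt hbc hc)
      have hbd := (le_max_left b 0).trans hd.le
      have h0d := (le_max_right b 0).trans hd.le
      have h1 : θR h ≤ d := by
        refine le_of_tendsto (hR.continuousAt.tendsto.mono_left nhdsWithin_le_nhds) (hev.mono ?_)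
        rintro l ⟨hl, hlh⟩
        rcases lt_or_lt_of_lt_effHam hl (hlh.trans_eq (hflat d ⟨hbd, hdc.le⟩).symm) with h | h
        · linarith [(hθ.left_le_right hl).1]
        · exact h.le
      have h2 : c ≤ θR h := by
        refine ge_of_tendsto (hR.continuousAt.tendsto.mono_left
          (nhdsWithin_le_nhds (s := Ioi h))) ?_
        filter_upwards [self_mem_nhdsWithin] with l hl
        exact (hθ.of_effHam_lt ((hflat c ⟨hbc.le, le_rfl⟩).trans_lt hl)).2.2.le
      linarith
    · obtain ⟨d, hbd, hdc⟩ := exists_between hbc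
      have h1 : d ≤ θL h := by
        refine ge_of_tendsto hL (hev.mono ?_)
        rintro l ⟨hl, hlh⟩
        rcases lt_or_lt_of_lt_effHam hl (hlh.trans_eq (hflat d ⟨hbd.le, hdc.le⟩).symm) with h | h
        · exact h.le
        · linarith [(hθ.left_le_right hl).2]
      have h2 : a ≤ b := by
        refine le_of_tendsto hL' ?_
        filter_upwards [self_mem_nhdsWithin] with l hl
        exact (hθ.of_effHam_lt ((hflat b ⟨le_rfl, hbc.le⟩).trans_lt hl)).2.1.le
      linarith
  · intro ha
    refine ⟨a, θL h, ha, fun θ hθ' => le_antisymm (le_of_forall_gt_imp_ge_of_dense fun l hl => ?_)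
      ?_⟩
    · have hβl := hβ.le.trans hl.le
      have h1 : θL l ≤ a := by
        refine ge_of_tendsto hL' ?_
        filter_upwards [Ioo_mem_nhdsGT hl] with k hk
        exact (hθ.anti (hβ.trans hk.1).le hβl hk.2).le
      exact effHam_le hβl (h1.trans hθ'.1) (hθ'.2.trans
        ((hθ.left_le_right hβ.le).1.trans (hθ.left_le_right hβl).2))
    · by_contra hlt
      obtain ⟨l, hl, hlh⟩ := exists_between (not_le.1 hlt)
      obtain ⟨h1, h2, -⟩ := hθ.of_effHam_lt hl
      linarith [hθ.anti h1.le hβ.le hlh, hθ'.2]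

section LevelLimits

variable {g : ℝ → ℝ} {m M h x : ℝ}

/-- Being high is witnessed by strict inequalities on a compact interval, so it survives a small
decrease of the level. -/
theorem eventually_mem_highSet_left (hg : Continuous g) (hx : x ∈ highSet m M fun y => h - g y) :
    ∀ᶠ l in 𝓝[<] h, x ∈ highSet m M fun y => l - g y := by
  obtain ⟨s, hs, hM, hr⟩ := hx
  obtain ⟨t, ht, hmin⟩ := (isCompact_Icc (a := s) (b := x)).exists_isMinOn (nonempty_Icc.2 hs)
    (show Continuous fun y => h - g y by fun_prop).continuousOn
  have hmt := hr t ht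
  refine nhdsWithin_le_nhds ?_
  filter_upwards [lt_mem_nhds (show h - (h - g s - M) < h by linarith),
    lt_mem_nhds (show h - (h - g t - m) < h by linarith)] with l h1 h2
  refine ⟨s, hs, by linarith, fun r hr' => ?_⟩
  have := isMinOn_iff.1 hmin r hr'
  linarith

theorem eventually_notMem_highSet_right (hg : Continuous g)
    (hx : x ∈ lowSet m M fun y => h - g y) :
    ∀ᶠ l in 𝓝[>] h, x ∉ highSet m M fun y => l - g y := by
  obtain ⟨s, hs, hm, hr⟩ := mem_lowSet.1 hx
  obtain ⟨t, ht, hmax⟩ := (isCompact_Icc (a := s) (b := x)).exists_isMaxOn (nonempty_Icc.2 hs)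
    (show Continuous fun y => h - g y by fun_prop).continuousOn
  have hMt := hr t ht
  refine nhdsWithin_le_nhds ?_
  filter_upwards [gt_mem_nhds (show h < h + (m - (h - g s)) by linarith),
    gt_mem_nhds (show h < h + (M - (h - g t)) by linarith)] with l h1 h2
  refine fun hmem => disjoint_left.1 disjoint_highSet_lowSet hmem (mem_lowSet.2
    ⟨s, hs, by linarith, fun r hr' => ?_⟩)
  have := isMaxOn_iff.1 hmax r hr'
  linarith

/-- Let t be the last time up to x at which the path meets M at level h. At the higher level l it
exceeds M at t. A later descent to m at level l would be a descent below m at level h, and as x is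
not low this would be followed by another meeting with M, after t. -/
theorem mem_highSet_of_notMem_lowSet (hg : Continuous g) (hmM : m < M)
    (hx : x ∉ lowSet m M fun y => h - g y) (hlow : ∃ s ≤ x, h - g s < m) {l : ℝ} (hl : h < l) :
    x ∈ highSet m M fun y => l - g y := by
  obtain ⟨s₀, hs₀, hm₀⟩ := hlow
  have key : ∀ s ≤ x, h - g s < m → ∃ r ∈ Icc s x, M ≤ h - g r := fun s hs hms => by
    by_contra hcon
    push Not at hcon
    exact hx (mem_lowSet.2 ⟨s, hs, hms, hcon⟩)
  have hcomp : IsCompact (Icc s₀ x ∩ {r | M ≤ h - g r}) :=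
    isCompact_Icc.inter_right (isClosed_le continuous_const (by fun_prop))
  obtain ⟨t, ⟨ht, hMt⟩, hlast⟩ := hcomp.exists_isGreatest (key s₀ hs₀ hm₀)
  simp only [mem_ofPred_eq] at hMt
  refine ⟨t, ht.2, by linarith, fun r hr => ?_⟩
  by_contra hlt
  obtain ⟨r', hr', hM'⟩ := key r hr.2 (by linarith)
  have hle : r' ≤ t := hlast ⟨⟨ht.1.trans (hr.1.trans hr'.1), hr'.2⟩, hM'⟩
  have : r = t := le_antisymm (hr'.1.trans hle) hr.1
  rw [this] at hlt
  linarith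

end LevelLimits

section Slopes

variable {Ω : Type*} [MeasurableSpace Ω] {μ : Measure Ω} {τ : ℝ → Ω → Ω} {V : ℝ → Ω → ℝ}
  {G : ℝ → ℝ} {m M pm pM β : ℝ} {p₁ p₃ p₄ : ℝ → ℝ}

open scoped Classical in
/-- The right limit of the gradient selections as the level decreases to `h`. -/
noncomputable def negSelectionRight (p₁ p₃ : ℝ → ℝ) (m M : ℝ) (f : ℝ → ℝ) (x : ℝ) : ℝ :=
  if x ∈ lowSet m M f then p₃ (f x) else p₁ (f x)

theorem IsUnitPotential.tendsto_leftSlope_of_ae [IsProbabilityMeasure μ]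
    (hV : IsUnitPotential μ τ V) (hτ : IsErgodicFlow μ τ)
    (hB : InverseBranches G m M pm pM p₁ p₃ p₄) (hW : IsDoubleWell G m M pm pM) (hβ : 0 < β)
    {h : ℝ} {F : Filter ℝ} [F.IsCountablyGenerated] (hF : F ≤ 𝓝 h) {S : Ω → ℝ}
    (hlim : ∀ᵐ ω ∂μ, Tendsto (fun l => negSelection p₁ p₃ m M (fun y => l - β * V y ω) 0) F
      (𝓝 (S ω))) :
    Tendsto (leftSlope μ V p₁ p₃ m M β) F (𝓝 (∫ ω, S ω ∂μ)) := by
  obtain ⟨K, -, hK⟩ := hB.exists_bound (h - 1 - β) (h + 1)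
  refine tendsto_integral_filter_of_dominated_convergence (fun _ => K) ?_ ?_
    (integrable_const _) hlim
  · refine Eventually.of_forall fun l => ?_
    obtain ⟨K', hK'⟩ := hV.isStationaryField_left hτ hB hW.m_lt_M hβ l
    exact (hK'.measurable_right 0).aestronglyMeasurable
  · filter_upwards [hF (Ioo_mem_nhds (show h - 1 < h by linarith) (show h < h + 1 by linarith))]
      with l hl
    refine ae_of_all _ fun ω => ?_
    have hin : ∀ x, l - β * V x ω ∈ Icc (h - 1 - β) (h + 1) := fun x => by
      have := hV.mem_Icc hβ l x ω
      exact ⟨by linarith [hl.1, this.1], by linarith [hl.2, this.2]⟩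
    exact abs_negSelection_le (f := fun y => l - β * V y ω) (fun x => (hK _ (hin x)).1)
      (fun x => (hK _ (hin x)).2.1) 0

/-- Belonging to the high phase persists at slightly lower levels, and not belonging to it persists
at all lower levels, so the selection is left-continuous in the level for each path. -/
theorem IsUnitPotential.tendsto_leftSlope_left [IsProbabilityMeasure μ]
    (hV : IsUnitPotential μ τ V) (hτ : IsErgodicFlow μ τ)
    (hB : InverseBranches G m M pm pM p₁ p₃ p₄) (hW : IsDoubleWell G m M pm pM) (hβ : 0 < β)
    (h : ℝ) :
    Tendsto (leftSlope μ V p₁ p₃ m M β) (𝓝[<] h) (𝓝 (leftSlope μ V p₁ p₃ m M β h)) := by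
  refine hV.tendsto_leftSlope_of_ae hτ hB hW hβ nhdsWithin_le_nhds (ae_of_all _ fun ω => ?_)
  have hg : Continuous fun y => β * V y ω := (hV.continuous ω).const_mul β
  have hc : ∀ p : ℝ → ℝ, Continuous p → Tendsto (fun l => p (l - β * V 0 ω)) (𝓝[<] h)
      (𝓝 (p (h - β * V 0 ω))) := fun p hp =>
    ((hp.comp (continuous_id.sub continuous_const)).tendsto h).mono_left nhdsWithin_le_nhds
  unfold negSelection
  split_ifs with h0
  · refine (hc p₁ hB.cont₁).congr' ?_
    filter_upwards [eventually_mem_highSet_left hg h0] with l hl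
    rw [if_pos hl]
  · refine (hc p₃ hB.cont₃).congr' ?_
    filter_upwards [self_mem_nhdsWithin] with l hl
    rw [if_neg fun hmem => h0 (highSet_subset_of_le (fun x => by
      linarith [mem_Iio.1 hl]) hmem)]

theorem IsUnitPotential.tendsto_leftSlope_right [IsProbabilityMeasure μ]
    (hV : IsUnitPotential μ τ V) (hτ : IsErgodicFlow μ τ)
    (hB : InverseBranches G m M pm pM p₁ p₃ p₄) (hW : IsDoubleWell G m M pm pM) (hβ : 0 < β)
    {h : ℝ} (hlow : ∀ᵐ ω ∂μ, ∃ s ≤ 0, h - β * V s ω < m) :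
    Tendsto (leftSlope μ V p₁ p₃ m M β) (𝓝[>] h)
      (𝓝 (∫ ω, negSelectionRight p₁ p₃ m M (fun y => h - β * V y ω) 0 ∂μ)) := by
  refine hV.tendsto_leftSlope_of_ae hτ hB hW hβ nhdsWithin_le_nhds ?_
  filter_upwards [hlow] with ω hω
  have hg : Continuous fun y => β * V y ω := (hV.continuous ω).const_mul β
  have hc : ∀ p : ℝ → ℝ, Continuous p → Tendsto (fun l => p (l - β * V 0 ω)) (𝓝[>] h)
      (𝓝 (p (h - β * V 0 ω))) := fun p hp =>
    ((hp.comp (continuous_id.sub continuous_const)).tendsto h).mono_left nhdsWithin_le_nhds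
  unfold negSelection negSelectionRight
  split_ifs with h0
  · refine (hc p₃ hB.cont₃).congr' ?_
    filter_upwards [eventually_notMem_highSet_right hg h0] with l hl
    rw [if_neg hl]
  · refine (hc p₁ hB.cont₁).congr' ?_
    filter_upwards [self_mem_nhdsWithin] with l hl
    rw [if_pos (mem_highSet_of_notMem_lowSet hg hW.m_lt_M h0 hω hl)]

theorem IsUnitPotential.continuous_rightSlope [IsProbabilityMeasure μ]
    (hV : IsUnitPotential μ τ V) (hB : InverseBranches G m M pm pM p₁ p₃ p₄) (hβ : 0 < β) :
    Continuous (rightSlope μ V p₄ β) := by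
  refine continuous_iff_continuousAt.2 fun h => ?_
  obtain ⟨K, -, hK⟩ := hB.exists_bound (h - 1 - β) (h + 1)
  refine tendsto_integral_filter_of_dominated_convergence (fun _ => K) ?_ ?_
    (integrable_const _) (ae_of_all _ fun ω => ?_)
  · exact Eventually.of_forall fun l => (hB.cont₄.measurable.comp
      (((hV.measurable_at 0).const_mul β).const_sub l)).aestronglyMeasurable
  · filter_upwards [Ioo_mem_nhds (show h - 1 < h by linarith) (show h < h + 1 by linarith)]
      with l hl
    refine ae_of_all _ fun ω => (hK _ ?_).2.2
    have := hV.mem_Icc hβ l 0 ω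
    exact ⟨by linarith [hl.1, this.1], by linarith [hl.2, this.2]⟩
  · exact (hB.cont₄.comp (continuous_id.sub continuous_const)).tendsto h

theorem negSelectionRight_le (hB : InverseBranches G m M pm pM p₁ p₃ p₄)
    (hW : IsDoubleWell G m M pm pM) (f : ℝ → ℝ) (x : ℝ) :
    negSelectionRight p₁ p₃ m M f x ≤ negSelection p₁ p₃ m M f x ∧
      (negSelectionRight p₁ p₃ m M f x = negSelection p₁ p₃ m M f x ↔ x ∉ neutralSet m M f) := by
  by_cases h1 : x ∈ highSet m M f
  · have h2 : x ∉ lowSet m M f := disjoint_left.1 disjoint_highSet_lowSet h1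
    simp [negSelectionRight, negSelection, neutralSet, h1, h2]
  by_cases h2 : x ∈ lowSet m M f
  · simp [negSelectionRight, negSelection, neutralSet, h1, h2]
  have h3 : x ∈ neutralSet m M f := by simp [neutralSet, h1, h2]
  obtain ⟨hm, hM⟩ := mem_Icc_of_mem_neutralSet hW.m_lt_M h3
  have h4 : p₁ (f x) < p₃ (f x) := by
    have e1 : p₁ (f x) ≤ p₁ m := hB.anti₁.antitone hm
    have e2 : p₃ M ≤ p₃ (f x) := hB.anti₃.antitone hM
    rw [hB.map₁] at e1
    rw [hB.map₃] at e2
    linarith [hW.pm_lt_pM]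
  rw [negSelectionRight, negSelection, if_neg h1, if_neg h2]
  exact ⟨h4.le, fun h => absurd h h4.ne, fun h => absurd h3 h⟩

theorem IsUnitPotential.measurableSet_lowSet (hV : IsUnitPotential μ τ V) (hmM : m < M)
    (h : ℝ) : MeasurableSet {p : ℝ × Ω | p.1 ∈ lowSet m M fun y => h - β * V y p.2} := by
  have := hV.measurableSet_highSet (neg_lt_neg hmM) (-h) (-β)
  convert this using 5
  unfold lowSet
  congr 2
  funext y
  ring

theorem IsUnitPotential.measurableSet_neutralSet (hV : IsUnitPotential μ τ V) (hmM : m < M)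
    (h : ℝ) : MeasurableSet {p : ℝ × Ω | p.1 ∈ neutralSet m M fun y => h - β * V y p.2} :=
  ((hV.measurableSet_highSet hmM h β).union (hV.measurableSet_lowSet hmM h)).compl

/-- The jump of the left slope is the mean of the difference between the selection and its right
limit. This difference is nonnegative and vanishes exactly when 0 is not neutral. -/
theorem IsUnitPotential.hasFlatPiece_iff [IsProbabilityMeasure μ]
    (hV : IsUnitPotential μ τ V) (hτ : IsErgodicFlow μ τ)
    (hB : InverseBranches G m M pm pM p₁ p₃ p₄) (hW : IsDoubleWell G m M pm pM) (hβ : 0 < β)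
    {h : ℝ} (hh : β < h) (hlow : ∀ᵐ ω ∂μ, ∃ s ≤ 0, h - β * V s ω < m) :
    HasFlatPiece (effHam β (leftSlope μ V p₁ p₃ m M β) (rightSlope μ V p₄ β)) h ↔
      ¬ ∀ᵐ ω ∂μ, (0 : ℝ) ∉ neutralSet m M fun y => h - β * V y ω := by
  rw [(hV.isSlopePair hτ hB hW hβ).hasFlatPiece_iff hh (hV.tendsto_leftSlope_left hτ hB hW hβ h)
    (hV.tendsto_leftSlope_right hτ hB hW hβ hlow) (hV.continuous_rightSlope hB hβ)]
  obtain ⟨K, -, hK⟩ := hB.exists_bound (h - β) h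
  have hf : Measurable fun ω => h - β * V 0 ω := ((hV.measurable_at 0).const_mul β).const_sub h
  have hR : Integrable (fun ω => negSelectionRight p₁ p₃ m M (fun y => h - β * V y ω) 0) μ := by
    refine Integrable.of_bound (C := K) (Measurable.aestronglyMeasurable ?_)
      (ae_of_all _ fun ω => ?_)
    · exact Measurable.ite ((hV.measurableSet_lowSet hW.m_lt_M h).preimage measurable_prodMk_left)
        (hB.cont₃.measurable.comp hf) (hB.cont₁.measurable.comp hf)
    · unfold negSelectionRight
      split_ifs
      · exact (hK _ (hV.mem_Icc hβ h 0 ω)).2.1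
      · exact (hK _ (hV.mem_Icc hβ h 0 ω)).1
  have hL : Integrable (fun ω => negSelection p₁ p₃ m M (fun y => h - β * V y ω) 0) μ := by
    obtain ⟨K', hK'⟩ := hV.isStationaryField_left hτ hB hW.m_lt_M hβ h
    exact hK'.integrable 0
  have hle := fun ω => negSelectionRight_le hB hW (fun y => h - β * V y ω) 0
  have h1 := integral_eq_iff_of_ae_le hR hL (ae_of_all _ fun ω => (hle ω).1)
  have h2 : (∀ᵐ ω ∂μ, (0 : ℝ) ∉ neutralSet m M fun y => h - β * V y ω) ↔
      (fun ω => negSelectionRight p₁ p₃ m M (fun y => h - β * V y ω) 0) =ᵐ[μ]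
        fun ω => negSelection p₁ p₃ m M (fun y => h - β * V y ω) 0 :=
    eventually_congr (Eventually.of_forall fun ω => (hle ω).2.symm)
  rw [h2, ← h1]
  exact (integral_mono hR hL fun ω => (hle ω).1).lt_iff_ne

end Slopes

/-! ### The upcrossing and downcrossing events -/

section Patterns

variable {Ω : Type*} [MeasurableSpace Ω] {μ : Measure Ω} {τ : ℝ → Ω → Ω} {V : ℝ → Ω → ℝ}
  {G : ℝ → ℝ} {m M pm pM β : ℝ} {p₁ p₃ p₄ : ℝ → ℝ}

theorem measurableSet_forall_Icc {f : ℝ → Ω → ℝ} (hf : ∀ x, Measurable (f x))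
    (hc : ∀ ω, Continuous fun x => f x ω) {a b : ℝ} (hab : a < b) (c : ℝ) :
    MeasurableSet {ω | ∀ s ∈ Icc a b, c ≤ f s ω} := by
  have e : {ω | ∀ s ∈ Icc a b, c ≤ f s ω} = ⋂ q : ℚ, {ω | a < q → (q : ℝ) < b → c ≤ f q ω} := by
    ext ω
    simp only [mem_ofPred_eq, mem_iInter]
    exact ⟨fun h q h1 h2 => h q ⟨h1.le, h2.le⟩, forall_Icc_of_rat (hc ω) hab⟩
  rw [e]
  exact MeasurableSet.iInter fun q => measurableSet_setOfPred.2
    (Measurable.imp measurable_const (Measurable.imp measurable_const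
      (measurableSet_setOfPred.1 (measurableSet_le measurable_const (hf q)))))

theorem measurableSet_exists_Icc {f : ℝ → Ω → ℝ} (hf : ∀ x, Measurable (f x))
    (hc : ∀ ω, Continuous fun x => f x ω) {a b : ℝ} (hab : a < b) (c : ℝ) :
    MeasurableSet {ω | ∃ s ∈ Icc a b, f s ω ≤ c} := by
  have e : {ω | ∃ s ∈ Icc a b, f s ω ≤ c} =
      (⋃ n : ℕ, {ω | ∀ s ∈ Icc a b, c + 1 / ((n : ℝ) + 1) ≤ f s ω})ᶜ := by
    ext ω
    simp only [mem_ofPred_eq, mem_compl_iff, mem_iUnion, not_exists]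
    constructor
    · rintro ⟨s, hs, hsc⟩ n hn
      have := hn s hs
      have : (0 : ℝ) < 1 / ((n : ℝ) + 1) := by positivity
      linarith
    · intro h
      obtain ⟨t, ht, hmin⟩ := (isCompact_Icc (a := a) (b := b)).exists_isMinOn
        (nonempty_Icc.2 hab.le) (hc ω).continuousOn
      refine ⟨t, ht, not_lt.1 fun hlt => ?_⟩
      obtain ⟨n, hn⟩ := exists_nat_one_div_lt (sub_pos.2 hlt)
      refine h n fun s hs => ?_
      have := isMinOn_iff.1 hmin s hs
      linarith
  rw [e]
  exact (MeasurableSet.iUnion fun n => measurableSet_forall_Icc hf hc hab _).compl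

theorem measurableSet_isMaxPattern {f : ℝ → Ω → ℝ} (hf : ∀ x, Measurable (f x))
    (hc : ∀ ω, Continuous fun x => f x ω) (m M : ℝ) (q r r' : ℚ) :
    MeasurableSet {ω | IsMaxPattern m M (fun x => f x ω) q r r'} := by
  by_cases h : q < r ∧ r < r'
  · have h1 : (q : ℝ) < r := by exact_mod_cast h.1
    have h2 : (q : ℝ) < r' := by exact_mod_cast h.1.trans h.2
    have e1 := measurableSet_forall_Icc (f := fun x ω => -f x ω) (fun x => (hf x).neg)
      (fun ω => (hc ω).neg) h2 (-M)
    have e2 := measurableSet_exists_Icc (f := fun x ω => -f x ω) (fun x => (hf x).neg)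
      (fun ω => (hc ω).neg) h1 (-M)
    simp only [neg_le_neg_iff] at e1 e2
    exact (MeasurableSet.const _).inter ((measurableSet_lt (hf q) measurable_const).inter
      (e1.inter e2))
  · convert MeasurableSet.empty
    exact eq_empty_of_forall_notMem fun ω hω => h hω.1

theorem measurableSet_isMinPattern {f : ℝ → Ω → ℝ} (hf : ∀ x, Measurable (f x))
    (hc : ∀ ω, Continuous fun x => f x ω) (m M : ℝ) (b b' q r r' : ℚ) :
    MeasurableSet {ω | IsMinPattern m M (fun x => f x ω) b b' q r r'} := by
  by_cases h : b < b' ∧ b' < q ∧ q < r ∧ r < r'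
  · have h1 : (b : ℝ) < b' := by exact_mod_cast h.1
    have h2 : (b' : ℝ) < r' := by exact_mod_cast h.2.1.trans (h.2.2.1.trans h.2.2.2)
    have h3 : (q : ℝ) < r := by exact_mod_cast h.2.2.1
    have e1 := measurableSet_forall_Icc (f := fun x ω => -f x ω) (fun x => (hf x).neg)
      (fun ω => (hc ω).neg) h1 (-M)
    simp only [neg_le_neg_iff] at e1
    exact (MeasurableSet.const _).inter ((measurableSet_lt (hf b) measurable_const).inter
      (e1.inter ((measurableSet_lt measurable_const (hf q)).inter
      ((measurableSet_forall_Icc hf hc h2 m).inter (measurableSet_exists_Icc hf hc h3 m)))))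
  · convert MeasurableSet.empty
    exact eq_empty_of_forall_notMem fun ω hω => h hω.1

/-- Seen from q, the pattern starts below m at time 0, which is the situation of
`IsLowerUpcrossing.isLocalMax`. -/
theorem IsStationaryPotential.notMem_upcrossingEvent (hV : IsStationaryPotential μ τ V)
    (hτ : IsErgodicFlow μ τ) {h : ℝ} {q r r' : ℚ} {ω : Ω}
    (hp : IsMaxPattern m M (fun s => h - β * V s ω) q r r') :
    τ q ω ∉ upcrossingEvent m M β V h := by
  rintro ⟨x, y, hxy, hmax⟩
  obtain ⟨⟨-, hrr⟩, hq, hle, t, ht, hMt⟩ := hp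
  have hrr' : (r : ℝ) < r' := by exact_mod_cast hrr
  have e : ∀ s, V s (τ q ω) = V (s + q) ω := fun s => (hV.shift hτ s q ω).symm
  refine hmax (hxy.isLocalMax (t := t - q) (r := r' - q) ?_ ?_ ?_ ?_ ?_ fun s hs => ?_)
  · have := hV.continuous (τ q ω); fun_prop
  · simpa only [e, zero_add] using hq
  · linarith [ht.1]
  · linarith [ht.2]
  · simpa only [e, sub_add_cancel] using hMt
  · simp only [e]
    exact hle (s + q) ⟨by linarith [hs.1], by linarith [hs.2]⟩

theorem IsStationaryPotential.notMem_downcrossingEvent (hV : IsStationaryPotential μ τ V)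
    (hτ : IsErgodicFlow μ τ) (hmM : m < M) {h : ℝ} {b b' q r r' : ℚ} {ω : Ω}
    (hp : IsMinPattern m M (fun s => h - β * V s ω) b b' q r r') :
    τ b ω ∉ downcrossingEvent m M β V h := by
  rintro ⟨x, y, hxy, hmin⟩
  obtain ⟨⟨hbb, hbq, -, hrr⟩, hb, hle, hq, hge, t, ht, hmt⟩ := hp
  have hrr' : (r : ℝ) < r' := by exact_mod_cast hrr
  have hbb' : (b : ℝ) < b' := by exact_mod_cast hbb
  have hbq' : (b' : ℝ) < q := by exact_mod_cast hbq
  have e : ∀ s, V s (τ b ω) = V (s + b) ω := fun s => (hV.shift hτ s b ω).symm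
  refine hmin (hxy.isLocalMin (b := b' - b) (s := q - b) (t := t - b) (r := r' - b) ?_ hmM ?_ ?_ ?_
    ?_ ?_ ?_ ?_ (fun s hs => ?_) fun s hs => ?_)
  · have := hV.continuous (τ b ω); fun_prop
  · simpa only [e, zero_add] using hb
  · linarith
  · linarith
  · linarith [ht.1]
  · linarith [ht.2]
  · simpa only [e, sub_add_cancel] using hq
  · simpa only [e, sub_add_cancel] using hmt
  · simp only [e]
    exact hle (s + b) ⟨by linarith [hs.1], by linarith [hs.2]⟩
  · simp only [e]
    exact hge (s + b) ⟨by linarith [hs.1], by linarith [hs.2]⟩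

/-- E avoids a shifted copy of A, which is measurable and has the same positive measure.
Measurability of E itself is not required. -/
theorem IsErgodicFlow.measure_lt_one_of_notMem [IsProbabilityMeasure μ] (hτ : IsErgodicFlow μ τ)
    {A E : Set Ω} (hA : MeasurableSet A) (h0 : μ A ≠ 0) (q : ℝ) (h : ∀ ω ∈ A, τ q ω ∉ E) :
    μ E < 1 := by
  have hB := hτ.measurePreserving (-q)
  have hsub : E ⊆ (τ (-q) ⁻¹' A)ᶜ := fun ω hω hmem => by
    refine h _ hmem ?_
    rwa [← Function.comp_apply (f := τ q), ← hτ.add, add_neg_cancel, hτ.zero]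
  refine (measure_mono hsub).trans_lt ?_
  rw [prob_compl_eq_one_sub (hB.measurable hA), hB.measure_preimage hA.nullMeasurableSet]
  exact ENNReal.sub_lt_self ENNReal.one_ne_top one_ne_zero h0

/-- Fubini for the neutral set in space and probability: by stationarity all slices at a fixed
position have the same probability. -/
theorem IsUnitPotential.ae_null_iff [IsProbabilityMeasure μ] (hV : IsUnitPotential μ τ V)
    (hτ : IsErgodicFlow μ τ) (hmM : m < M) (h : ℝ) :
    (∀ᵐ ω ∂μ, volume (neutralSet m M fun y => h - β * V y ω) = 0) ↔
      ∀ᵐ ω ∂μ, (0 : ℝ) ∉ neutralSet m M fun y => h - β * V y ω := by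
  have hS := hV.measurableSet_neutralSet (β := β) hmM h
  obtain ⟨S, hSdef⟩ : ∃ S : Set (ℝ × Ω),
    S = {p | p.1 ∈ neutralSet m M fun y => h - β * V y p.2} := ⟨_, rfl⟩
  rw [← hSdef] at hS
  have hslice : ∀ x : ℝ, μ (Prod.mk x ⁻¹' S) = μ (Prod.mk (0 : ℝ) ⁻¹' S) := fun x => by
    have h0 : MeasurableSet (Prod.mk (0 : ℝ) ⁻¹' S) := hS.preimage measurable_prodMk_left
    rw [← (hτ.measurePreserving x).measure_preimage h0.nullMeasurableSet]
    congr 1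
    ext ω
    simp only [hSdef, mem_preimage, mem_ofPred_eq, ← hV.shift hτ, neutralSet, lowSet,
      mem_compl_iff, mem_union]
    rw [← highSet_shift m M (fun y => h - β * V y ω),
      ← highSet_shift (-M) (-m) (fun y => -(h - β * V y ω)), zero_add]
  have h1 := Measure.measure_prod_null (μ := volume) (ν := μ) hS
  have h2 := Measure.measure_prod_null (μ := μ) (ν := volume) (hS.preimage measurable_swap)
  rw [(Measure.measurePreserving_swap (μ := μ) (ν := (volume : Measure ℝ))).measure_preimage
    hS.nullMeasurableSet, h1] at h2
  have e1 : (∀ᵐ ω ∂μ, volume (neutralSet m M fun y => h - β * V y ω) = 0) ↔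
      (fun ω => volume (Prod.mk ω ⁻¹' (Prod.swap ⁻¹' S))) =ᵐ[μ] 0 := by
    rw [hSdef]; rfl
  have e2 : (∀ᵐ ω ∂μ, (0 : ℝ) ∉ neutralSet m M fun y => h - β * V y ω) ↔
      μ (Prod.mk (0 : ℝ) ⁻¹' S) = 0 := by
    rw [ae_iff, hSdef]
    simp only [not_not]
    rfl
  rw [e1, ← h2, e2]
  simp_rw [hslice]
  constructor
  · intro hae
    obtain ⟨x, hx⟩ := hae.exists
    exact hx
  · intro h0
    exact Eventually.of_forall fun _ => h0

theorem IsGoodPath.isOscillating {θL θR v : ℝ → ℝ}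
    (hv : IsGoodPath m M β p₁ p₃ p₄ θL θR v) (hβ : 0 < β) {h : ℝ} (hh : M < h)
    (hh' : h < m + β) : IsOscillating m M fun x => h - β * v x := by
  have hlow : ∀ s, 1 - (m + β - h) / β < v s → h - β * v s < m := fun s hs => by
    have h1 := mul_lt_mul_of_pos_left hs hβ
    have e : β * (1 - (m + β - h) / β) = β - (m + β - h) := by field_simp
    linarith
  have hhigh : ∀ s, v s < (h - M) / β → M < h - β * v s := fun s hs => by
    rw [lt_div_iff₀ hβ] at hs
    linarith
  have hl := hv.recurrent_high ((m + β - h) / β) (div_pos (by linarith) hβ)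
  have hr := hv.recurrent_low ((h - M) / β) (div_pos (by linarith) hβ)
  refine ⟨fun a => ?_, fun a => ?_, fun a => ?_, fun a => ?_⟩
  · obtain ⟨s, hs, hsa⟩ := hl.exists_lt a
    exact ⟨s, hsa, hlow s hs⟩
  · obtain ⟨s, hs, hsa⟩ := hl.exists_gt a
    exact ⟨s, hsa, hlow s hs⟩
  · obtain ⟨s, hs, hsa⟩ := hr.exists_lt a
    exact ⟨s, hsa, hhigh s hs⟩
  · obtain ⟨s, hs, hsa⟩ := hr.exists_gt a
    exact ⟨s, hsa, hhigh s hs⟩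

/-- There are countably many rational patterns. If each had probability zero, the neutral set would
be almost surely countable, hence null; so a flat piece gives one pattern positive probability. The
converse is `exists_upcrossings_of_null`, path by path. -/
theorem IsUnitPotential.hasFlatPiece_iff_measure_lt_one [IsProbabilityMeasure μ]
    (hV : IsUnitPotential μ τ V) (hτ : IsErgodicFlow μ τ)
    (hB : InverseBranches G m M pm pM p₁ p₃ p₄) (hW : IsDoubleWell G m M pm pM) (hβ : 0 < β)
    {h : ℝ} (hh : h ∈ Ioo (max β M) (m + β)) :
    HasFlatPiece (effHam β (leftSlope μ V p₁ p₃ m M β) (rightSlope μ V p₄ β)) h ↔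
      μ (upcrossingEvent m M β V h ∩ downcrossingEvent m M β V h) < 1 := by
  have hmM := hW.m_lt_M
  have hβh : β < h := (le_max_left β M).trans_lt hh.1
  have hMh : M < h := (le_max_right β M).trans_lt hh.1
  have hosc : ∀ᵐ ω ∂μ, IsOscillating m M fun x => h - β * V x ω := by
    filter_upwards [hV.ae_isGoodPath hτ hB hW hβ] with ω hω
    exact hω.isOscillating hβ hMh hh.2
  rw [hV.hasFlatPiece_iff hτ hB hW hβ hβh (by
    filter_upwards [hosc] with ω hω
    obtain ⟨s, hs, hms⟩ := hω.low_left 0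
    exact ⟨s, hs.le, hms⟩), ← hV.ae_null_iff hτ hmM h]
  have hf : ∀ x, Measurable fun ω => h - β * V x ω := fun x =>
    ((hV.measurable_at x).const_mul β).const_sub h
  have hc : ∀ ω, Continuous fun x => h - β * V x ω := fun ω => by
    have := hV.continuous ω; fun_prop
  constructor
  · intro hnot
    by_cases hmax : ∀ q r r' : ℚ, μ {ω | IsMaxPattern m M (fun x => h - β * V x ω) q r r'} = 0
    · by_cases hmin : ∀ b b' q r r' : ℚ,
          μ {ω | IsMinPattern m M (fun x => h - β * V x ω) b b' q r r'} = 0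
      · exfalso
        refine hnot ?_
        have h1 : ∀ᵐ ω ∂μ, ∀ q r r', ¬ IsMaxPattern m M (fun x => h - β * V x ω) q r r' := by
          simp only [ae_all_iff]
          exact fun q r r' => measure_eq_zero_iff_ae_notMem.1 (hmax q r r')
        have h2 : ∀ᵐ ω ∂μ, ∀ b b' q r r',
            ¬ IsMinPattern m M (fun x => h - β * V x ω) b b' q r r' := by
          simp only [ae_all_iff]
          exact fun b b' q r r' => measure_eq_zero_iff_ae_notMem.1 (hmin b b' q r r')
        filter_upwards [hosc, h1, h2] with ω ho h1 h2
        exact (countable_neutralSet (hc ω) hmM ho.low_left h1 h2).measure_zero _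
      · push Not at hmin
        obtain ⟨b, b', q, r, r', h0⟩ := hmin
        refine (measure_mono inter_subset_right).trans_lt
          (hτ.measure_lt_one_of_notMem (measurableSet_isMinPattern hf hc m M b b' q r r') h0 b ?_)
        exact fun ω hω => hV.notMem_downcrossingEvent hτ hmM hω
    · push Not at hmax
      obtain ⟨q, r, r', h0⟩ := hmax
      refine (measure_mono inter_subset_left).trans_lt
        (hτ.measure_lt_one_of_notMem (measurableSet_isMaxPattern hf hc m M q r r') h0 q ?_)
      exact fun ω hω => hV.notMem_upcrossingEvent hτ hω
  · intro hlt hnull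
    refine hlt.ne ?_
    have hae : ∀ᵐ ω ∂μ, ω ∈ upcrossingEvent m M β V h ∩ downcrossingEvent m M β V h := by
      filter_upwards [hosc, hnull] with ω ho h0
      have huc : UniformContinuous fun x => h - β * V x ω :=
        uniformContinuous_const.sub ((uniformContinuous_const_smul β).comp (hV.uniformContinuous ω))
      exact exists_upcrossings_of_null ho huc hmM h0
    exact (measure_congr (eventuallyEq_univ.2 hae)).trans measure_univ

end Patterns

/-! ### Conclusion -/

/-- Homogenization of the Hamilton-Jacobi equation with a double-well Hamiltonian, and the heights
of the flat pieces of its effective Hamiltonian. -/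
theorem theorem3p4 {Ω : Type*} [MeasurableSpace Ω] (μ : Measure Ω) [IsProbabilityMeasure μ]
    (τ : ℝ → Ω → Ω) (hτ : IsErgodicFlow μ τ)
    (V : ℝ → Ω → ℝ) (hV : IsStationaryPotential μ τ V)
    (G : ℝ → ℝ) (hG : IsContinuousCoercive G)
    (m M pm pM : ℝ) (hW : IsDoubleWell G m M pm pM)
    (β : ℝ) (hβ : 0 < β) (hmM : max β M < m + β) :
    (∃! Hbar : ℝ → ℝ, IsEffectiveHamiltonian μ G β V Hbar) ∧
    ∀ Hbar : ℝ → ℝ, IsEffectiveHamiltonian μ G β V Hbar →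
      ∀ h ∈ Ioo (max β M) (m + β),
        HasFlatPiece Hbar h ↔
          μ (upcrossingEvent m M β V h ∩ downcrossingEvent m M β V h) < 1 := by
  obtain ⟨p₁, p₃, p₄, hB⟩ := hW.exists_inverseBranches hG
  obtain ⟨V', hV', hae⟩ := hV.exists_isUnitPotential
  have hH := (hV'.isEffectiveHamiltonian hτ hG hB hW hβ hmM).congr_ae hae
  refine ⟨⟨_, hH, fun H hH' => hH'.unique hH⟩, fun H hH' h hh => ?_⟩
  rw [hH'.unique hH, hV'.hasFlatPiece_iff_measure_lt_one hτ hB hW hβ hh]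
  -- Both events depend on ω only through the path of the potential, so clamping changes them by a
  -- null set.
  have e : (upcrossingEvent m M β V' h ∩ downcrossingEvent m M β V' h : Set Ω) =ᵐ[μ]
      (upcrossingEvent m M β V h ∩ downcrossingEvent m M β V h : Set Ω) := by
    refine eventuallyEq_set.2 ?_
    filter_upwards [hae] with ω hω
    simp only [upcrossingEvent, downcrossingEvent, mem_inter_iff, mem_ofPred_eq, hω]
  rw [measure_congr e]
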